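/- Let $\mathbb D$ be the open unit disk in $\mathbb C$ and $dA=\frac1\pi\,dx\,dy$ the normalized area measure on it. For $0<p<\infty$ and $\alpha>-1$, let $D^p_\alpha$ be the space of all functions $f$ holomorphic in $\mathbb D$ with $$\|f\|_{D^p_\alpha}=\Big(|f(0)|^p+\int_{\mathbb D}|f'(z)|^p(1-|z|^2)^\alpha\,dA(z)\Big)^{1/p}<\infty .$$ For an interval (arc) $I\subset\partial\mathbb D$ of positive normalized length $|I|\in(0,1]$, put $S(I)=\{re^{i\theta}: e^{i\theta}\in I,\ 1-|I|\le r<1\}$. For $s>0$, a positive Borel measure $\mu$ on $\mathbb D$ is an $s$-Carleson measure if there is a constant $C>0$ with $\mu(S(I))\le C|I|^s$ for all intervals $I\subset\partial\mathbb D$. Theorem. Let $\alpha,\beta>-1$, $0<p<q<\infty$, let $g$ be holomorphic in $\mathbb D$, put $d\mu_{g,q,\beta}(z)=(1-|z|^2)^\beta|g'(z)|^q\,dA(z)$, and let $M_gf=gf$. Say that $M_g:D^p_\alpha\to D^q_\beta$ is bounded if there is a finite constant $C$ such that $gf\in D^q_\beta$ and $\|gf\|_{D^q_\beta}\le C\|f\|_{D^p_\alpha}$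 for all $f\in D^p_\alpha$. Consider the growth condition $$(\ast)\qquad |g(z)|=O\Big((1-|z|^2)^{\frac{2+\alpha}{p}-\frac{2+\beta}{q}}\Big)\quad\text{as }|z|\to1^- .$$ (1) If $p<\alpha+2$, then $M_g:D^p_\alpha\to D^q_\beta$ is bounded if and only if $\mu_{g,q,\beta}$ is a $\frac{q(\alpha+2-p)}{p}$-Carleson measure and $(\ast)$ holds. (2) If $p=\alpha+2$, then $M_g:D^p_\alpha\to D^q_\beta$ is bounded if and only if $(\ast)$ holds and there is a constant $C>0$ such that $\mu_{g,q,\beta}(S(I))\le C\big(\log\frac1{|I|}\big)^{(1/p-1)q}$ for all intervals $I\subset\partial\mathbb D$ (here $p>1$, so the exponent is negative, and the right-hand side is read as $+\infty$ when $|I|=1$). (3) If $p>\alpha+2$, then $M_g:D^p_\alpha\to D^q_\beta$ is bounded if and only if $(\ast)$ holds and $g\in D^q_\beta$; moreover, $g\in D^q_\beta$ if and only if $\mu_{g,q,\beta}$ is a finite measure. -/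

import Mathlib

open MeasureTheory Filter Topology Asymptotics Set
open scoped ENNReal NNReal

noncomputable section

namespace DirichletMult

/-- The open unit disk. -/
def disk : Set ℂ := Metric.ball 0 1

/-- The normalized area measure `dA = (1/π) dx dy` on the unit disk. -/
def areaMeasure : Measure ℂ :=
  ENNReal.ofReal (1 / Real.pi) • (volume : Measure ℂ).restrict disk

/-- The (quasi-)norm of the weighted Dirichlet space, with values in `[0, ∞]`. Only the values
of `f` in the disk matter. -/
def dirichletNorm (p α : ℝ) (f : ℂ → ℂ) : ℝ≥0∞ :=
  (‖f 0‖ₑ ^ p +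
    ∫⁻ z, ‖deriv f z‖ₑ ^ p * ENNReal.ofReal ((1 - ‖z‖ ^ 2) ^ α) ∂areaMeasure) ^ (1 / p)

/-- The weighted Dirichlet space: functions holomorphic in the disk with finite norm. -/
def dirichletSpace (p α : ℝ) : Set (ℂ → ℂ) :=
  {f | DifferentiableOn ℂ f disk ∧ dirichletNorm p α f < ∞}

/-- `T` is a bounded operator from the `(p, α)`-Dirichlet space to the `(q, β)`-Dirichlet
space. -/
def IsBoundedOp (p α q β : ℝ) (T : (ℂ → ℂ) → ℂ → ℂ) : Prop :=
  ∃ C : ℝ≥0, ∀ f ∈ dirichletSpace p α,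
    T f ∈ dirichletSpace q β ∧ dirichletNorm q β (T f) ≤ C * dirichletNorm p α f

/-- The multiplication operator with symbol `g`. -/
def mulOp (g f : ℂ → ℂ) : ℂ → ℂ := fun z => g z * f z

/-- `I` is an interval (arc) of the unit circle, open, closed or half-open, of positive
normalized length `l` (so `0 < l ≤ 1`). -/
def IsArc (I : Set ℂ) (l : ℝ) : Prop :=
  ∃ (a b : ℝ) (J : Set ℝ), a < b ∧ b ≤ a + 2 * Real.pi ∧ Ioo a b ⊆ J ∧ J ⊆ Icc a b ∧
    I = (fun θ : ℝ => Complex.exp (θ * Complex.I)) '' J ∧ l = (b - a) / (2 * Real.pi)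

/-- The Carleson square over the arc `I` of normalized length `l`. -/
def carlesonSquare (I : Set ℂ) (l : ℝ) : Set ℂ :=
  {z | ∃ r : ℝ, ∃ ζ ∈ I, 1 - l ≤ r ∧ r < 1 ∧ z = r * ζ}

/-- `μ` is an `s`-Carleson measure. -/
def IsCarleson (s : ℝ) (μ : Measure ℂ) : Prop :=
  ∃ C : ℝ, 0 < C ∧ ∀ (I : Set ℂ) (l : ℝ), IsArc I l →
    μ (carlesonSquare I l) ≤ ENNReal.ofReal (C * l ^ s)

/-- `μ(S(I)) ≤ C (log (1/|I|)) ^ t` for all arcs `I`. The power is taken in `[0, ∞]`, so that for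
`t < 0` the right-hand side is `∞` when `|I| = 1`. -/
def IsLogCarleson (t : ℝ) (μ : Measure ℂ) : Prop :=
  ∃ C : ℝ, 0 < C ∧ ∀ (I : Set ℂ) (l : ℝ), IsArc I l →
    μ (carlesonSquare I l) ≤ ENNReal.ofReal C * ENNReal.ofReal (Real.log (1 / l)) ^ t

/-- The measure `(1 - |z|²) ^ β |g'(z)| ^ q dA(z)`. -/
def symbolMeasure (g : ℂ → ℂ) (q β : ℝ) : Measure ℂ :=
  areaMeasure.withDensity fun z => ENNReal.ofReal ((1 - ‖z‖ ^ 2) ^ β) * ‖deriv g z‖ₑ ^ q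

/-- `|g(z)| = O((1 - |z|²) ^ γ)` as `|z| → 1⁻`. -/
def GrowthBigO (g : ℂ → ℂ) (γ : ℝ) : Prop :=
  g =O[comap (fun z : ℂ => ‖z‖) (𝓝[<] (1 : ℝ))] fun z : ℂ => (1 - ‖z‖ ^ 2) ^ γ

end DirichletMult

end

/-! Write `(g f)' = g' f + g f'`. Functions of finite energy satisfy `|f'(z)|^p (1-|z|²)^(2+α) ≤ C ·
energy` (`exists_deriv_growth`). As `p < q`, one can split `|f'|^q = |f'|^p |f'|^(q-p)` and bound
the second factor pointwise; the growth condition on `g` has exactly the exponent that turns what is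
left into the energy of `f` (`exists_lintegral_mul_deriv_le`). The growth condition is also
necessary: test `M_g` on a kernel power times `z - a`, which vanishes at `a`, so that `(g f)'(a) =
g(a) f'(a)`. Hence boundedness means the growth condition together with the embedding of `D^p_α`
into `L^q(μ)`, where `μ = |g'|^q (1-|z|²)^β dA`.

The embedding is discretised on the dyadic tree of boxes in the disk. The value `|f(z)|` is at most
`|f(0)|` plus the sum of the jumps `2^(-n) sup |f'|` over the boxes met by the radius to `z`
(`enorm_le_branchSum`), and by the sub-mean value property the weighted `ℓ^p` norm of the jumps is
controlled by the energy (`exists_tsum_boxJump_le`). What remains is a Hardy inequality on a tree.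
Its weak type form follows from Hölder once a one-parameter kernel sum is bounded, and the strong
type form follows by truncating the jumps at dyadic heights (`branchSum_strong_type`). The kernel
sum is computed for geometric weights when `p < α + 2` and for constant weights with logarithmic
masses when `p = α + 2`. When `p > α + 2` the jumps decay geometrically and `f` is bounded, so
finiteness of `μ` suffices.

For the necessity of the Carleson conditions, test on powers of the Szegő kernel, respectively on
its logarithm, with the pole over the midpoint of the arc, and apply Chebyshev's inequality. The
norms of the test functions come from a Möbius change of variables (`exists_lintegral_kernel_le`)
and a dyadic superposition of it (`exists_lintegral_kernel_le_log`). -/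

open scoped ComplexConjugate

namespace DirichletMult

/-! ### Sums along the branches of a dyadic tree -/

section Tree

variable {X : Type*}

/-- The sum of `b` along the branch of vertices `(n, c n x)`, `n ≤ N x`. -/
noncomputable def branchSum (c : ℕ → X → ℕ) (N : X → ℕ) (b : ℕ → ℕ → ℝ≥0∞) (x : X) : ℝ≥0∞ :=
  ∑ n ∈ Finset.range (N x + 1), b n (c n x)

/-- The points whose branch passes through the vertex `(n, j)`. -/
def branchCell (c : ℕ → X → ℕ) (N : X → ℕ) (n j : ℕ) : Set X := {x | n ≤ N x ∧ c n x = j}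

theorem branchSum_eq_tsum (c : ℕ → X → ℕ) (N : X → ℕ) (b : ℕ → ℕ → ℝ≥0∞) (x : X) :
    branchSum c N b x =
      ∑' n, ∑' j, (branchCell c N n j).indicator (fun _ => b n j) x := by
  classical
  have h1 : ∀ n, ∑' j, (branchCell c N n j).indicator (fun _ => b n j) x =
      if n ≤ N x then b n (c n x) else 0 := by
    intro n
    rw [tsum_eq_single (c n x)]
    · simp [branchCell, indicator_apply]
    · intro j hj
      simp [branchCell, hj.symm]
  simp_rw [h1]
  rw [tsum_eq_sum (s := Finset.range (N x + 1)), branchSum]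
  · refine Finset.sum_congr rfl fun n hn => ?_
    rw [if_pos (by simpa [Nat.lt_succ_iff] using hn)]
  · intro n hn
    rw [if_neg (by simpa [Nat.lt_succ_iff] using hn)]

variable [MeasurableSpace X] {c : ℕ → X → ℕ} {N : X → ℕ}

theorem measurableSet_branchCell (hc : ∀ n, Measurable (c n)) (hN : Measurable N) (n j : ℕ) :
    MeasurableSet (branchCell c N n j) :=
  (hN (MeasurableSet.of_discrete (s := {k | n ≤ k}))).inter
    (hc n (MeasurableSet.of_discrete (s := {j})))

theorem measurable_branchSum (hc : ∀ n, Measurable (c n)) (hN : Measurable N)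
    (b : ℕ → ℕ → ℝ≥0∞) : Measurable (branchSum c N b) := by
  have : branchSum c N b = fun x => ∑' n, ∑' j,
      (branchCell c N n j).indicator (fun _ => b n j) x := by
    ext x
    exact branchSum_eq_tsum c N b x
  rw [this]
  exact Measurable.tsum fun n => Measurable.tsum fun j =>
    measurable_const.indicator (measurableSet_branchCell hc hN n j)

theorem lintegral_branchSum (hc : ∀ n, Measurable (c n)) (hN : Measurable N)
    (b : ℕ → ℕ → ℝ≥0∞) (ν : Measure X) :
    ∫⁻ x, branchSum c N b x ∂ν = ∑' n, ∑' j, b n j * ν (branchCell c N n j) := by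
  have hm : ∀ n j, Measurable ((branchCell c N n j).indicator (fun _ => b n j)) := fun n j =>
    measurable_const.indicator (measurableSet_branchCell hc hN n j)
  simp_rw [branchSum_eq_tsum]
  rw [lintegral_tsum fun n => (Measurable.tsum fun j => hm n j).aemeasurable]
  refine tsum_congr fun n => ?_
  rw [lintegral_tsum fun j => (hm n j).aemeasurable]
  refine tsum_congr fun j => ?_
  rw [lintegral_indicator_const (measurableSet_branchCell hc hN n j)]

theorem tsum_measure_branchCell_le (hc : ∀ n, Measurable (c n)) (hN : Measurable N)
    (ν : Measure X) (n : ℕ) : ∑' j, ν (branchCell c N n j) ≤ ν univ := by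
  rw [← measure_iUnion]
  · exact measure_mono (subset_univ _)
  · intro i j hij
    refine Set.disjoint_left.2 fun x hx hx' => hij ?_
    exact hx.2.symm.trans hx'.2
  · exact fun j => measurableSet_branchCell hc hN n j

/-- Hölder's inequality for sums in `[0, ∞]`. -/
theorem tsum_mul_le_Lp_mul_Lq {ι : Type*} [Countable ι] {p p' : ℝ} (hp : p.HolderConjugate p')
    (f g : ι → ℝ≥0∞) :
    ∑' i, f i * g i ≤ (∑' i, f i ^ p) ^ (1 / p) * (∑' i, g i ^ p') ^ (1 / p') := by
  let _ : MeasurableSpace ι := ⊤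
  have := ENNReal.lintegral_mul_le_Lp_mul_Lq (Measure.count : Measure ι) hp
    (f := f) (g := g) (measurable_of_countable f).aemeasurable
    (measurable_of_countable g).aemeasurable
  simpa [lintegral_count] using this

/-- Each factor `f i ^ (r - 1)` is at most the same power of the whole sum. With `r = q / p` this is
how `p ≤ q` enters the tree inequality. -/
theorem tsum_rpow_le_rpow_tsum {ι : Type*} {r : ℝ} (hr : 1 ≤ r) (f : ι → ℝ≥0∞) :
    ∑' i, f i ^ r ≤ (∑' i, f i) ^ r := by
  have h : ∀ x : ℝ≥0∞, x ^ r = x * x ^ (r - 1) := by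
    intro x
    conv_rhs => rw [← ENNReal.rpow_one x]
    rw [← ENNReal.rpow_mul, one_mul,
      ← ENNReal.rpow_add_of_nonneg _ _ zero_le_one (by linarith)]
    congr 1
    ring
  calc ∑' i, f i ^ r ≤ ∑' i, f i * (∑' i, f i) ^ (r - 1) := by
        refine ENNReal.tsum_le_tsum fun i => ?_
        rw [h]
        gcongr
        exact ENNReal.le_tsum i
    _ = (∑' i, f i) ^ r := by rw [ENNReal.tsum_mul_right, h]

/-- The weak type inequality for branch sums. -/
theorem branchSum_weak_type {μ : Measure X} [IsFiniteMeasure μ]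
    (hc : ∀ n, Measurable (c n)) (hN : Measurable N)
    {p p' q : ℝ} (hp : p.HolderConjugate p') (hq : 0 < q) {w m : ℕ → ℝ≥0∞} {K : ℝ≥0∞}
    (hw : ∀ n, w n ≠ 0) (hw' : ∀ n, w n ≠ ∞)
    (hm : ∀ n j, μ (branchCell c N n j) ≤ m n)
    (hK : ∀ t : ℝ≥0∞, t ≠ 0 → t ≠ ∞ →
      ∑' n, (w n)⁻¹ ^ p' * min (m n) t ^ (p' - 1) ≤ K * t ^ (p' - 1 - p' / q))
    (b : ℕ → ℕ → ℝ≥0∞) {lam : ℝ≥0∞} {E : Set X} (hE : MeasurableSet E)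
    (hlam : ∀ x ∈ E, lam ≤ branchSum c N b x) :
    lam ^ q * μ E ≤ K ^ (q / p') * (∑' n, ∑' j, (b n j * w n) ^ p) ^ (q / p) := by
  have hp'1 : 0 < p' - 1 := by linarith [hp.symm.lt]
  have hp'0 : 0 < p' := hp.symm.pos
  set M := μ E with hM
  rcases eq_or_ne M 0 with h0 | h0
  · simp [h0]
  have hMtop : M ≠ ∞ := measure_ne_top _ _
  set A := ∑' n, ∑' j, (b n j * w n) ^ p with hA
  -- The dual side of Hölder. The mass `y` of `E` in a cell is at most `min (m n) M`, so `y ^ p' ≤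
  -- min (m n) M ^ (p' - 1) * y`; the cells of one generation are disjoint, so the remaining masses
  -- add up to at most `M`, and the kernel condition at `t = M` finishes.
  have hS : ∑' n, ∑' j, ((w n)⁻¹ * μ.restrict E (branchCell c N n j)) ^ p' ≤
      K * M ^ (p' - p' / q) := by
    calc ∑' n, ∑' j, ((w n)⁻¹ * μ.restrict E (branchCell c N n j)) ^ p'
        ≤ ∑' n, ∑' j, (w n)⁻¹ ^ p' * min (m n) M ^ (p' - 1) *
            μ.restrict E (branchCell c N n j) := by
          refine ENNReal.tsum_le_tsum fun n => ENNReal.tsum_le_tsum fun j => ?_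
          rw [ENNReal.mul_rpow_of_nonneg _ _ hp'0.le, mul_assoc]
          gcongr
          set y := μ.restrict E (branchCell c N n j)
          have hy : y ≤ min (m n) M := by
            refine le_min ((Measure.restrict_apply_le _ _).trans (hm n j)) ?_
            exact (measure_mono (subset_univ _)).trans (by simp [hM])
          calc y ^ p' = y ^ (p' - 1) * y := by
                conv_rhs => rw [← ENNReal.rpow_one y]
                rw [← ENNReal.rpow_mul, one_mul,
                  ← ENNReal.rpow_add_of_nonneg _ _ hp'1.le zero_le_one]
                congr 1
                ring
            _ ≤ min (m n) M ^ (p' - 1) * y := by gcongr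
      _ ≤ ∑' n, (w n)⁻¹ ^ p' * min (m n) M ^ (p' - 1) * M := by
          refine ENNReal.tsum_le_tsum fun n => ?_
          rw [ENNReal.tsum_mul_left]
          gcongr
          exact (tsum_measure_branchCell_le hc hN _ n).trans (by simp [hM])
      _ ≤ K * M ^ (p' - 1 - p' / q) * M := by
          rw [ENNReal.tsum_mul_right]
          gcongr
          exact hK M h0 hMtop
      _ = K * M ^ (p' - p' / q) := by
          rw [mul_assoc]
          congr 1
          conv_lhs => enter [2]; rw [← ENNReal.rpow_one M]
          rw [← ENNReal.rpow_add _ _ h0 hMtop]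
          congr 1
          ring
  -- Integrate the lower bound over `E`, exchange sum and integral, and insert `w * w⁻¹` before
  -- applying Hölder.
  have h1 : lam * M ≤ A ^ (1 / p) * (K * M ^ (p' - p' / q)) ^ (1 / p') := by
    calc lam * M = ∫⁻ _ in E, lam ∂μ := by rw [setLIntegral_const]
      _ ≤ ∫⁻ x in E, branchSum c N b x ∂μ := setLIntegral_mono' hE hlam
      _ = ∑' n, ∑' j, b n j * μ.restrict E (branchCell c N n j) := lintegral_branchSum hc hN b _
      _ = ∑' i : ℕ × ℕ, (b i.1 i.2 * w i.1) *
            ((w i.1)⁻¹ * μ.restrict E (branchCell c N i.1 i.2)) := by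
          rw [ENNReal.tsum_prod']
          refine tsum_congr fun n => tsum_congr fun j => ?_
          rw [← mul_assoc, mul_assoc (b n j), ENNReal.mul_inv_cancel (hw n) (hw' n), mul_one]
      _ ≤ _ := tsum_mul_le_Lp_mul_Lq hp _ _
      _ ≤ _ := by
          rw [ENNReal.tsum_prod', ENNReal.tsum_prod']
          gcongr
  have h2 : lam ^ q * M ^ q ≤ A ^ (q / p) * K ^ (q / p') * M ^ (q - 1) := by
    calc lam ^ q * M ^ q = (lam * M) ^ q := (ENNReal.mul_rpow_of_nonneg _ _ hq.le).symm
      _ ≤ (A ^ (1 / p) * (K * M ^ (p' - p' / q)) ^ (1 / p')) ^ q := by gcongr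
      _ = _ := by
        rw [ENNReal.mul_rpow_of_nonneg _ _ hq.le,
          ENNReal.mul_rpow_of_nonneg K _ (by positivity), ENNReal.mul_rpow_of_nonneg _ _ hq.le,
          ← ENNReal.rpow_mul, ← ENNReal.rpow_mul, ← ENNReal.rpow_mul, ← ENNReal.rpow_mul,
          mul_assoc, show 1 / p * q = q / p by ring, show 1 / p' * q = q / p' by ring,
          show (p' - p' / q) * (q / p') = q - 1 by field_simp]
  have h3 : M ^ q = M * M ^ (q - 1) := by
    conv_rhs => rw [← ENNReal.rpow_one M]
    rw [← ENNReal.rpow_mul, one_mul, ← ENNReal.rpow_add _ _ h0 hMtop]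
    congr 1
    ring
  rw [h3, ← mul_assoc] at h2
  -- The kernel exponent was chosen so that both sides carry the factor `M ^ (q - 1)`, which is
  -- finite and nonzero and cancels.
  have h4 := (ENNReal.mul_le_mul_iff_left (ENNReal.rpow_pos (pos_iff_ne_zero.2 h0) hMtop).ne'
    (ENNReal.rpow_ne_top_of_ne_zero h0 hMtop)).1 h2
  rwa [mul_comm (A ^ _)] at h4

/-! ### Truncation at dyadic heights and the strong type inequality -/

/-- The sum of `a` over the strict ancestors of the vertex `(n, j)`. -/
noncomputable def ancestorSum (a : ℕ → ℕ → ℝ≥0∞) : ℕ → ℕ → ℝ≥0∞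
  | 0, _ => 0
  | n + 1, j => ancestorSum a n (j / 2) + a n (j / 2)

theorem ancestorSum_eq_sum (hcc : ∀ n x, c (n + 1) x / 2 = c n x) (a : ℕ → ℕ → ℝ≥0∞) (n : ℕ)
    (x : X) : ancestorSum a n (c n x) = ∑ k ∈ Finset.range n, a k (c k x) := by
  induction n with
  | zero => simp [ancestorSum]
  | succ n ih => rw [ancestorSum, hcc, ih, Finset.sum_range_succ]

theorem ancestorSum_ne_top {a : ℕ → ℕ → ℝ≥0∞} (ha : ∀ n j, a n j ≠ ∞) (n j : ℕ) :
    ancestorSum a n j ≠ ∞ := by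
  induction n generalizing j with
  | zero => simp [ancestorSum]
  | succ n ih => exact ENNReal.add_ne_top.2 ⟨ih _, ha _ _⟩

/-- The part of the jump of the partial sums of `a` at `(n, j)` that lies in the dyadic interval
`(2 ^ k, 2 ^ (k + 1)]`. -/
noncomputable def truncatedJump (a : ℕ → ℕ → ℝ≥0∞) (k : ℤ) (n j : ℕ) : ℝ≥0∞ :=
  volume (Ioc (ancestorSum a n j).toReal (ancestorSum a n j + a n j).toReal ∩
    Ioc ((2 : ℝ) ^ k) (2 ^ (k + 1)))

/-- The pieces are the traces on disjoint intervals `(2 ^ k, 2 ^ (k + 1)]` of one interval of length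
`a n j`. -/
theorem tsum_truncatedJump_le {a : ℕ → ℕ → ℝ≥0∞} (ha : ∀ n j, a n j ≠ ∞) (n j : ℕ) :
    ∑' k, truncatedJump a k n j ≤ a n j := by
  unfold truncatedJump
  rw [← measure_iUnion]
  · refine (measure_mono (iUnion_subset fun k => inter_subset_left)).trans ?_
    rw [Real.volume_Ioc, ENNReal.toReal_add (ancestorSum_ne_top ha n j) (ha n j),
      add_sub_cancel_left, ENNReal.ofReal_toReal (ha n j)]
  · intro k l hkl
    have : Monotone fun k : ℤ => (2 : ℝ) ^ k := fun k l h => zpow_le_zpow_right₀ (by norm_num) h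
    exact (this.pairwise_disjoint_on_Ioc_succ hkl).mono inter_subset_right inter_subset_right
  · exact fun k => measurableSet_Ioc.inter measurableSet_Ioc

/-- Along a branch the jump intervals tile `(0, total]`. If the total reaches `2 ^ (k + 1)`, they
cover the whole of `(2 ^ k, 2 ^ (k + 1)]`, whose length is `2 ^ k`. -/
theorem le_branchSum_truncatedJump (hcc : ∀ n x, c (n + 1) x / 2 = c n x)
    {a : ℕ → ℕ → ℝ≥0∞} (ha : ∀ n j, a n j ≠ ∞) (k : ℤ) {x : X}
    (hx : ENNReal.ofReal (2 ^ (k + 1)) ≤ branchSum c N a x) :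
    ENNReal.ofReal (2 ^ k) ≤ branchSum c N (truncatedJump a k) x := by
  have h : ∀ n, volume (Ioc 0 (ancestorSum a n (c n x)).toReal ∩
      Ioc ((2 : ℝ) ^ k) (2 ^ (k + 1))) ≤
      ∑ i ∈ Finset.range n, truncatedJump a k i (c i x) := by
    intro n
    induction n with
    | zero => simp [ancestorSum]
    | succ n ih =>
      rw [Finset.sum_range_succ]
      refine le_trans ?_ (add_le_add ih le_rfl)
      refine le_trans (measure_mono ?_) (measure_union_le _ _)
      rw [← union_inter_distrib_right, ancestorSum, hcc]
      gcongr
      exact Ioc_subset_Ioc_union_Ioc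
  refine le_trans ?_ (h (N x + 1))
  rw [ancestorSum_eq_sum hcc, ← branchSum]
  have hfin : branchSum c N a x ≠ ∞ := ENNReal.sum_ne_top.2 fun n _ => ha _ _
  have hle : (2 : ℝ) ^ (k + 1) ≤ (branchSum c N a x).toReal :=
    (ENNReal.ofReal_le_iff_le_toReal hfin).1 hx
  rw [inter_eq_right.2 (Ioc_subset_Ioc (by positivity) hle), Real.volume_Ioc]
  apply ENNReal.ofReal_le_ofReal
  rw [zpow_add_one₀ (by norm_num)]
  linarith

/-- The strong type inequality for branch sums, by truncation. -/
theorem branchSum_strong_type {μ : Measure X} [IsFiniteMeasure μ]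
    (hc : ∀ n, Measurable (c n)) (hN : Measurable N) (hcc : ∀ n x, c (n + 1) x / 2 = c n x)
    {p p' q : ℝ} (hp : p.HolderConjugate p') (hq : p ≤ q) {w m : ℕ → ℝ≥0∞} {K : ℝ≥0∞}
    (hw : ∀ n, w n ≠ 0) (hw' : ∀ n, w n ≠ ∞)
    (hm : ∀ n j, μ (branchCell c N n j) ≤ m n)
    (hK : ∀ t : ℝ≥0∞, t ≠ 0 → t ≠ ∞ →
      ∑' n, (w n)⁻¹ ^ p' * min (m n) t ^ (p' - 1) ≤ K * t ^ (p' - 1 - p' / q))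
    (a : ℕ → ℕ → ℝ≥0∞) (ha : ∀ n j, a n j ≠ ∞) :
    ∫⁻ x, branchSum c N a x ^ q ∂μ ≤
      4 ^ q * K ^ (q / p') * (∑' n, ∑' j, (a n j * w n) ^ p) ^ (q / p) := by
  have hq0 : 0 < q := hp.pos.trans_le hq
  have hmeas : Measurable (branchSum c N a) := measurable_branchSum hc hN a
  set E : ℤ → Set X := fun k => {x | ENNReal.ofReal (2 ^ (k + 1)) ≤ branchSum c N a x}
  have hE : ∀ k, MeasurableSet (E k) := fun k => measurableSet_le measurable_const hmeas
  have hpt : ∀ x, branchSum c N a x ^ q ≤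
      ∑' k : ℤ, (E k).indicator (fun _ => (4 * ENNReal.ofReal (2 ^ k)) ^ q) x := by
    intro x
    have hfin : branchSum c N a x ≠ ∞ := ENNReal.sum_ne_top.2 fun n _ => ha _ _
    rcases eq_or_ne (branchSum c N a x) 0 with h0 | h0
    · simp [h0, hq0]
    obtain ⟨k, hk1, hk2⟩ := exists_mem_Ico_zpow (ENNReal.toReal_pos h0 hfin)
      (one_lt_two : (1 : ℝ) < 2)
    -- The value lies in `[2 ^ k, 2 ^ (k + 1))`, so the point is in `E (k - 1)` and the value is
    -- below `4 * 2 ^ (k - 1)`; this is the origin of the factor 4.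
    refine le_trans ?_ (ENNReal.le_tsum (k - 1))
    have hxE : x ∈ E (k - 1) := by
      change ENNReal.ofReal _ ≤ _
      rw [sub_add_cancel]
      exact (ENNReal.ofReal_le_iff_le_toReal hfin).2 hk1
    rw [indicator_of_mem hxE]
    gcongr
    rw [← ENNReal.ofReal_toReal hfin, show (4 : ℝ≥0∞) = ENNReal.ofReal 4 by simp,
      ← ENNReal.ofReal_mul (by norm_num)]
    apply ENNReal.ofReal_le_ofReal
    rw [zpow_add_one₀ (by norm_num)] at hk2
    rw [zpow_sub_one₀ (by norm_num)]
    linarith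
  calc ∫⁻ x, branchSum c N a x ^ q ∂μ
      ≤ ∫⁻ x, ∑' k : ℤ, (E k).indicator (fun _ => (4 * ENNReal.ofReal (2 ^ k)) ^ q) x ∂μ :=
        lintegral_mono hpt
    _ = ∑' k : ℤ, 4 ^ q * (ENNReal.ofReal (2 ^ k) ^ q * μ (E k)) := by
        rw [lintegral_tsum fun k => (measurable_const.indicator (hE k)).aemeasurable]
        refine tsum_congr fun k => ?_
        rw [lintegral_indicator_const (hE k), ENNReal.mul_rpow_of_nonneg _ _ hq0.le, mul_assoc]
    _ ≤ ∑' k : ℤ, 4 ^ q * (K ^ (q / p') *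
          (∑' n, ∑' j, (truncatedJump a k n j * w n) ^ p) ^ (q / p)) := by
        refine ENNReal.tsum_le_tsum fun k => ?_
        gcongr 4 ^ q * ?_
        -- The weak inequality is applied to the truncated jumps rather than to `a`: their energies
        -- for different `k` can be summed, whereas the full energy would recur for each `k`.
        exact branchSum_weak_type hc hN hp hq0 hw hw' hm hK _ (hE k) fun x hx =>
          le_branchSum_truncatedJump hcc ha k hx
    _ = 4 ^ q * K ^ (q / p') *
          ∑' k : ℤ, (∑' n, ∑' j, (truncatedJump a k n j * w n) ^ p) ^ (q / p) := by
        rw [ENNReal.tsum_mul_left, ENNReal.tsum_mul_left, mul_assoc]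
    _ ≤ 4 ^ q * K ^ (q / p') *
          (∑' k : ℤ, ∑' n, ∑' j, (truncatedJump a k n j * w n) ^ p) ^ (q / p) := by
        gcongr
        exact tsum_rpow_le_rpow_tsum ((one_le_div hp.pos).2 hq) _
    _ ≤ _ := by
        have : 0 ≤ q / p := div_nonneg hq0.le hp.pos.le
        gcongr
        rw [ENNReal.tsum_comm]
        refine ENNReal.tsum_le_tsum fun n => ?_
        rw [ENNReal.tsum_comm]
        refine ENNReal.tsum_le_tsum fun j => ?_
        -- At one vertex, the `p`-th powers of the truncated pieces add up to at most the `p`-th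
        -- power of the whole jump, because `p ≥ 1`.
        refine (tsum_rpow_le_rpow_tsum hp.lt.le _).trans ?_
        rw [ENNReal.tsum_mul_right]
        have := hp.nonneg
        gcongr
        exact tsum_truncatedJump_le ha n j

end Tree

/-! ### Kernel conditions for geometric and logarithmic scales -/

theorem ennreal_rpow_neg_le_rpow_neg {x y : ℝ≥0∞} {r : ℝ} (hr : 0 ≤ r) (h : x ≤ y) :
    y ^ (-r) ≤ x ^ (-r) := by
  rw [ENNReal.rpow_neg, ENNReal.rpow_neg, ENNReal.inv_le_inv]
  gcongr

theorem tsum_int_two_rpow_ne_top {δ : ℝ} (hδ : 0 < δ) :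
    ∑' k : ℤ, (2 : ℝ≥0∞) ^ (-(δ * |(k : ℝ)|)) ≠ ∞ := by
  have hr : (2 : ℝ≥0∞) ^ (-δ) < 1 := ENNReal.rpow_lt_one_of_one_lt_of_neg (by norm_num) (by linarith)
  have hgeo : ∑' n : ℕ, ((2 : ℝ≥0∞) ^ (-δ)) ^ n ≠ ∞ := by
    rw [ENNReal.tsum_geometric]
    exact ENNReal.inv_ne_top.2 (tsub_pos_of_lt hr).ne'
  have h := ENNReal.summable (f := fun n : ℕ => (2 : ℝ≥0∞) ^ (-(δ * |((n : ℤ) : ℝ)|))).hasSum.of_nat_of_neg_add_one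
    (f := fun k : ℤ => (2 : ℝ≥0∞) ^ (-(δ * |(k : ℝ)|)))
    (ENNReal.summable (f := fun n : ℕ => (2 : ℝ≥0∞) ^ (-(δ * |((-(n + 1 : ℤ) : ℤ) : ℝ)|)))).hasSum
  rw [h.tsum_eq]
  refine ENNReal.add_ne_top.2 ⟨?_, ?_⟩
  · refine ne_top_of_le_ne_top hgeo (ENNReal.tsum_le_tsum fun n => ?_)
    rw [← ENNReal.rpow_natCast, ← ENNReal.rpow_mul]
    simp
  · refine ne_top_of_le_ne_top hgeo (ENNReal.tsum_le_tsum fun n => ?_)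
    rw [← ENNReal.rpow_natCast, ← ENNReal.rpow_mul]
    refine ENNReal.rpow_le_rpow_of_exponent_le (by norm_num) ?_
    push_cast
    rw [abs_neg, abs_of_nonneg (by positivity)]
    nlinarith

/-- Shifting the index by `⌊v⌋` compares the sum with the two-sided series centred at 0, at the cost
of a factor `2 ^ δ`; this makes the bound uniform in `v`. -/
theorem exists_tsum_two_rpow_le {δ : ℝ} (hδ : 0 < δ) :
    ∃ K : ℝ≥0∞, K ≠ ∞ ∧ ∀ v : ℝ, ∑' n : ℕ, (2 : ℝ≥0∞) ^ (-(δ * |(n : ℝ) - v|)) ≤ K := by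
  refine ⟨2 ^ δ * ∑' k : ℤ, (2 : ℝ≥0∞) ^ (-(δ * |(k : ℝ)|)),
    ENNReal.mul_ne_top (ENNReal.rpow_ne_top_of_nonneg hδ.le (by simp))
      (tsum_int_two_rpow_ne_top hδ), fun v => ?_⟩
  have hinj : Function.Injective fun n : ℕ => (n : ℤ) - ⌊v⌋ := fun m n h => by
    simpa using h
  rw [← ENNReal.tsum_mul_left]
  refine le_trans (ENNReal.tsum_le_tsum fun n => ?_) (ENNReal.tsum_comp_le_tsum_of_injective hinj _)
  rw [← ENNReal.rpow_add _ _ (by simp) (by simp)]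
  refine ENNReal.rpow_le_rpow_of_exponent_le (by norm_num) ?_
  have h1 := Int.floor_le v
  have h2 := Int.lt_floor_add_one v
  have h3 : |(n : ℝ) - ⌊v⌋| ≤ |(n : ℝ) - v| + 1 := by
    calc |(n : ℝ) - ⌊v⌋| = |((n : ℝ) - v) + (v - ⌊v⌋)| := by ring_nf
      _ ≤ |(n : ℝ) - v| + |v - ⌊v⌋| := abs_add_le _ _
      _ ≤ _ := by rw [abs_of_nonneg (by linarith : 0 ≤ v - ⌊v⌋)]; linarith
  push_cast
  nlinarith

/-- The kernel condition of the tree embedding for geometric weights. -/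
theorem exists_kernel_bound_geometric {p p' q σ : ℝ} (hp : p.HolderConjugate p') (hpq : p < q)
    (hσ : 0 < σ) (C : ℝ≥0∞) (hC : C ≠ ∞) :
    ∃ K : ℝ≥0∞, K ≠ ∞ ∧ ∀ t : ℝ≥0∞, t ≠ 0 → t ≠ ∞ →
      ∑' n : ℕ, ((2 : ℝ≥0∞) ^ (-(n * σ)))⁻¹ ^ p' *
        min (C * 2 ^ (-(n * (σ * q)))) t ^ (p' - 1) ≤ K * t ^ (p' - 1 - p' / q) := by
  have hq0 : 0 < q := hp.pos.trans hpq
  have hp'1 : 0 < p' - 1 := by linarith [hp.symm.lt]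
  have hp'0 : 0 < p' := hp.symm.pos
  have hpp : p * (p' - 1) = p' := by have := hp.mul_eq_add; linarith
  have hδ1 : 0 < q * (p' - 1) - p' := by nlinarith
  -- With `t = 2 ^ (-(u * σ * q))` the summand peaks near `n = u`: it grows at rate `σ p'` before
  -- and decays at rate `σ (q (p' - 1) - p')` after. The second rate is positive precisely because
  -- `p < q`.
  set δ := min (σ * p') (σ * (q * (p' - 1) - p')) with hδdef
  have hδ : 0 < δ := lt_min (by positivity) (by positivity)
  obtain ⟨K, hK, hKv⟩ := exists_tsum_two_rpow_le hδ
  refine ⟨max C 1 ^ (p' - 1) * K, ENNReal.mul_ne_top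
    (ENNReal.rpow_ne_top_of_nonneg hp'1.le (by simp [hC])) hK, fun t ht0 ht => ?_⟩
  obtain ⟨u, rfl⟩ : ∃ u : ℝ, t = (2 : ℝ≥0∞) ^ (-(u * (σ * q))) := by
    refine ⟨-(Real.logb 2 t.toReal) / (σ * q), ?_⟩
    rw [div_mul_cancel₀ _ (by positivity), neg_neg]
    rw [show (2 : ℝ≥0∞) = ENNReal.ofReal 2 by simp, ENNReal.ofReal_rpow_of_pos (by norm_num),
      Real.rpow_logb (by norm_num) (by norm_num) (ENNReal.toReal_pos ht0 ht),
      ENNReal.ofReal_toReal ht]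
  have hterm : ∀ n : ℕ, ((2 : ℝ≥0∞) ^ (-(n * σ)))⁻¹ ^ p' *
      min (C * 2 ^ (-(n * (σ * q)))) ((2 : ℝ≥0∞) ^ (-(u * (σ * q)))) ^ (p' - 1) ≤
      max C 1 ^ (p' - 1) * 2 ^ (-(δ * |(n : ℝ) - u|)) *
        ((2 : ℝ≥0∞) ^ (-(u * (σ * q)))) ^ (p' - 1 - p' / q) := by
    intro n
    have h1 : min (C * 2 ^ (-(n * (σ * q)))) ((2 : ℝ≥0∞) ^ (-(u * (σ * q)))) ≤
        max C 1 * 2 ^ (-(max (n : ℝ) u * (σ * q))) := by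
      rcases le_total (n : ℝ) u with h | h
      · rw [max_eq_right h]
        refine (min_le_right _ _).trans ?_
        conv_lhs => rw [← one_mul ((2 : ℝ≥0∞) ^ _)]
        gcongr
        exact le_max_right _ _
      · rw [max_eq_left h]
        refine (min_le_left _ _).trans ?_
        gcongr
        exact le_max_left _ _
    calc _ ≤ ((2 : ℝ≥0∞) ^ (-(n * σ)))⁻¹ ^ p' *
        (max C 1 * 2 ^ (-(max (n : ℝ) u * (σ * q)))) ^ (p' - 1) := by gcongr
      _ = max C 1 ^ (p' - 1) * (2 : ℝ≥0∞) ^ (n * σ * p' +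
            -(max (n : ℝ) u * (σ * q)) * (p' - 1)) := by
          rw [ENNReal.mul_rpow_of_nonneg _ _ hp'1.le, ← ENNReal.rpow_neg, ← ENNReal.rpow_mul,
            ← ENNReal.rpow_mul, mul_left_comm, ← ENNReal.rpow_add _ _ (by simp) (by simp), neg_neg]
      _ ≤ max C 1 ^ (p' - 1) * (2 : ℝ≥0∞) ^ (-(δ * |(n : ℝ) - u|) +
            -(u * (σ * q)) * (p' - 1 - p' / q)) := by
          have e : -(u * (σ * q)) * (p' - 1 - p' / q) = -(u * σ) * (q * (p' - 1) - p') := by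
            field_simp
          rw [e]
          gcongr max C 1 ^ (p' - 1) * ?_
          refine ENNReal.rpow_le_rpow_of_exponent_le (by norm_num) ?_
          rcases le_total (n : ℝ) u with h | h
          · rw [max_eq_right h, abs_of_nonpos (by linarith)]
            have : δ * (u - n) ≤ σ * p' * (u - n) :=
              mul_le_mul_of_nonneg_right (min_le_left _ _) (by linarith)
            nlinarith
          · rw [max_eq_left h, abs_of_nonneg (by linarith)]
            have : δ * (n - u) ≤ σ * (q * (p' - 1) - p') * (n - u) :=
              mul_le_mul_of_nonneg_right (min_le_right _ _) (by linarith)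
            nlinarith
      _ = _ := by
          rw [ENNReal.rpow_add _ _ (by simp) (by simp), ← mul_assoc, ← ENNReal.rpow_mul]
  refine (ENNReal.tsum_le_tsum hterm).trans ?_
  rw [ENNReal.tsum_mul_right, ENNReal.tsum_mul_left]
  gcongr
  exact hKv u

/-- With `T = s ^ (-r)`, about `s` terms are cut off at `T`, and the tail beyond `s` is of the order
`s ^ (1 - r)`; both contributions have the size `s * T = T ^ (1 - 1 / r)`. -/
theorem exists_tsum_min_rpow_le {r : ℝ} (hr : 1 < r) :
    ∃ K : ℝ≥0∞, K ≠ ∞ ∧ ∀ T : ℝ≥0∞, T ≠ 0 → T ≠ ∞ →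
      ∑' n : ℕ, min (((n : ℝ≥0∞) + 1) ^ (-r)) T ≤ K * T ^ (1 - 1 / r) := by
  set h : ℕ → ℝ≥0∞ := fun k => (max (k : ℝ≥0∞) 1) ^ (-r) with hh
  have hZ : ∑' k, h k ≠ ∞ := by
    have h0 : ∀ k : ℕ, h k = ENNReal.ofReal ((max (k : ℝ) 1) ^ (-r)) := by
      intro k
      rw [← ENNReal.ofReal_rpow_of_pos (by positivity), ENNReal.ofReal_max]
      simp [hh]
    simp_rw [h0]
    have hs : Summable fun k : ℕ => (max (k : ℝ) 1) ^ (-r) := by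
      rw [← summable_nat_add_iff 1]
      have := (summable_nat_add_iff 1).2 (Real.summable_nat_rpow (p := -r).2 (by linarith))
      refine this.congr fun k => ?_
      rw [max_eq_left (by push_cast; linarith [(Nat.cast_nonneg k : (0 : ℝ) ≤ k)])]
    exact hs.tsum_ofReal_ne_top
  have hr0 : 0 < r := by linarith
  refine ⟨2 * ∑' k, h k, ENNReal.mul_ne_top (by simp) hZ, fun T hT0 hT => ?_⟩
  obtain ⟨s, hs, rfl⟩ : ∃ s : ℝ, 0 < s ∧ T = ENNReal.ofReal s ^ (-r) := by
    refine ⟨(T ^ (-(1 / r))).toReal, ENNReal.toReal_pos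
      (ENNReal.rpow_pos (pos_iff_ne_zero.2 hT0) hT).ne'
      (ENNReal.rpow_ne_top_of_ne_zero hT0 hT), ?_⟩
    rw [ENNReal.ofReal_toReal (ENNReal.rpow_ne_top_of_ne_zero hT0 hT), ← ENNReal.rpow_mul]
    rw [show -(1 / r) * -r = 1 by field_simp, ENNReal.rpow_one]
  have hs0 : ENNReal.ofReal s ≠ 0 := by simpa using hs
  rw [← ENNReal.rpow_mul, show -r * (1 - 1 / r) = 1 + -r by field_simp; ring,
    ENNReal.rpow_add _ _ hs0 ENNReal.ofReal_ne_top, ENNReal.rpow_one]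
  rcases lt_or_ge s 1 with h1 | h1
  · calc ∑' n : ℕ, min (((n : ℝ≥0∞) + 1) ^ (-r)) (ENNReal.ofReal s ^ (-r))
        ≤ ∑' k, h k := by
          refine ENNReal.tsum_le_tsum fun n => (min_le_left _ _).trans ?_
          refine ennreal_rpow_neg_le_rpow_neg hr0.le (max_le ?_ ?_) <;> simp
      _ ≤ (∑' k, h k) * (2 * (ENNReal.ofReal s * ENNReal.ofReal s ^ (-r))) := by
          conv_lhs => rw [← mul_one (∑' k, h k)]
          gcongr
          have : (1 : ℝ≥0∞) ≤ ENNReal.ofReal s * ENNReal.ofReal s ^ (-r) := by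
            conv_rhs => enter [1]; rw [← ENNReal.rpow_one (ENNReal.ofReal s)]
            rw [← ENNReal.rpow_add _ _ hs0 ENNReal.ofReal_ne_top]
            exact ENNReal.one_le_rpow_of_pos_of_le_one_of_neg (by simpa using hs)
              (by simpa using h1.le) (by linarith)
          calc (1 : ℝ≥0∞) ≤ _ := this
            _ ≤ _ := by rw [two_mul]; exact le_self_add
      _ = _ := by ring
  -- Cutting the indices into blocks of length `M` treats both contributions at once: on the `k`-th
  -- block every term is at most `s ^ (-r) * h k`, where `h 0 = 1` accounts for the truncation.
  · set M := ⌈s⌉₊ with hM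
    have hM0 : 0 < M := Nat.ceil_pos.2 hs
    have : NeZero M := ⟨hM0.ne'⟩
    have hMs : (M : ℝ) ≤ 2 * s := by have := Nat.ceil_lt_add_one hs.le; linarith
    have hsM : s ≤ M := Nat.le_ceil s
    have hb : ∀ n : ℕ, min (((n : ℝ≥0∞) + 1) ^ (-r)) (ENNReal.ofReal s ^ (-r)) ≤
        ENNReal.ofReal s ^ (-r) * h (n / M) := by
      intro n
      rcases Nat.eq_zero_or_pos (n / M) with h0 | h0
      · rw [h0]
        simp [hh]
      · refine (min_le_left _ _).trans ?_
        have hk : max ((n / M : ℕ) : ℝ≥0∞) 1 = ((n / M : ℕ) : ℝ≥0∞) :=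
          max_eq_left (by exact_mod_cast h0)
        simp only [hh]
        rw [hk, ← ENNReal.mul_rpow_of_ne_top (by simp) (by simp)]
        refine ennreal_rpow_neg_le_rpow_neg hr0.le ?_
        calc ENNReal.ofReal s * ((n / M : ℕ) : ℝ≥0∞) ≤ (M : ℝ≥0∞) * ((n / M : ℕ) : ℝ≥0∞) := by
              gcongr
              rw [← ENNReal.ofReal_natCast]
              exact ENNReal.ofReal_le_ofReal hsM
          _ ≤ (n : ℝ≥0∞) := by exact_mod_cast Nat.mul_div_le n M
          _ ≤ _ := le_self_add
    calc _ ≤ ∑' n : ℕ, ENNReal.ofReal s ^ (-r) * h (n / M) := ENNReal.tsum_le_tsum hb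
      _ = ENNReal.ofReal s ^ (-r) * ∑' n : ℕ, h (n / M) := ENNReal.tsum_mul_left
      _ = ENNReal.ofReal s ^ (-r) * (M * ∑' k, h k) := by
          congr 1
          rw [← (Nat.divModEquiv M).symm.tsum_eq, ENNReal.tsum_prod', ← ENNReal.tsum_mul_left]
          refine tsum_congr fun k => ?_
          have : ∀ i : Fin M, (M * k + (i : ℕ)) / M = k := fun i => by
            rw [Nat.mul_add_div hM0, Nat.div_eq_of_lt i.2, add_zero]
          rw [tsum_fintype]
          simp [Nat.divModEquiv, mul_comm k M, this]
      _ ≤ ENNReal.ofReal s ^ (-r) * (ENNReal.ofReal (2 * s) * ∑' k, h k) := by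
          gcongr
          rw [← ENNReal.ofReal_natCast]
          exact ENNReal.ofReal_le_ofReal hMs
      _ = _ := by
          rw [ENNReal.ofReal_mul (by norm_num), ENNReal.ofReal_ofNat]
          ring

/-- The kernel condition of the tree embedding for the logarithmic scale. -/
theorem exists_kernel_bound_log {p p' q : ℝ} (hp : p.HolderConjugate p') (hpq : p < q)
    (C : ℝ≥0∞) (hC : C ≠ ∞) :
    ∃ K : ℝ≥0∞, K ≠ ∞ ∧ ∀ t : ℝ≥0∞, t ≠ 0 → t ≠ ∞ →
      ∑' n : ℕ, (1 : ℝ≥0∞)⁻¹ ^ p' *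
        min (C * ((n : ℝ≥0∞) + 1) ^ (-(q / p'))) t ^ (p' - 1) ≤ K * t ^ (p' - 1 - p' / q) := by
  have hq0 : 0 < q := hp.pos.trans hpq
  have hp'1 : 0 < p' - 1 := by linarith [hp.symm.lt]
  have hp'0 : 0 < p' := hp.symm.pos
  have hpp : p * (p' - 1) = p' := by have := hp.mul_eq_add; linarith
  have hp0 := hp.pos
  -- Raising `(n + 1) ^ (-(q / p'))` to the power `p' - 1` gives `(n + 1) ^ (-(q / p))`, which is
  -- summable because `p < q`.
  obtain ⟨K, hK, hKT⟩ := exists_tsum_min_rpow_le ((one_lt_div hp0).2 hpq)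
  refine ⟨max C 1 ^ (p' - 1) * K, ENNReal.mul_ne_top
    (ENNReal.rpow_ne_top_of_nonneg hp'1.le (by simp [hC])) hK, fun t ht0 ht => ?_⟩
  have hterm : ∀ n : ℕ, (1 : ℝ≥0∞)⁻¹ ^ p' *
      min (C * ((n : ℝ≥0∞) + 1) ^ (-(q / p'))) t ^ (p' - 1) ≤
      max C 1 ^ (p' - 1) * min (((n : ℝ≥0∞) + 1) ^ (-(q / p))) (t ^ (p' - 1)) := by
    intro n
    have e : ((n : ℝ≥0∞) + 1) ^ (-(q / p)) = (((n : ℝ≥0∞) + 1) ^ (-(q / p'))) ^ (p' - 1) := by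
      rw [← ENNReal.rpow_mul]
      congr 1
      field_simp
      linarith
    rw [inv_one, ENNReal.one_rpow, one_mul, e,
      ← (ENNReal.monotone_rpow_of_nonneg hp'1.le).map_min,
      ← ENNReal.mul_rpow_of_nonneg _ _ hp'1.le]
    gcongr
    rw [mul_min]
    gcongr
    · exact le_max_left _ _
    · conv_lhs => rw [← one_mul t]
      gcongr
      exact le_max_right _ _
  refine (ENNReal.tsum_le_tsum hterm).trans ?_
  rw [ENNReal.tsum_mul_left, mul_assoc]
  gcongr max C 1 ^ (p' - 1) * ?_
  refine (hKT _ (ENNReal.rpow_pos (pos_iff_ne_zero.2 ht0) ht).ne'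
    (ENNReal.rpow_ne_top_of_nonneg hp'1.le ht)).trans_eq ?_
  rw [← ENNReal.rpow_mul]
  congr 2
  field_simp
  linarith

/-! ### The sub-mean value property -/

theorem two_pi_mul_enorm_le_lintegral_circle {h : ℂ → ℂ} {w : ℂ} {R r : ℝ} (hr : 0 < r)
    (hrR : r < R) (hh : DifferentiableOn ℂ h (Metric.ball w R)) :
    ENNReal.ofReal (2 * Real.pi) * ‖h w‖ₑ ≤
      ∫⁻ θ in Ioo (-Real.pi) Real.pi, ‖h (circleMap w r θ)‖ₑ := by
  have hd : DiffContOnCl ℂ h (Metric.ball w |r|) := by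
    rw [abs_of_pos hr]
    refine DifferentiableOn.diffContOnCl ?_
    rw [closure_ball _ hr.ne']
    exact hh.mono (Metric.closedBall_subset_ball hrR)
  have h1 := hd.circleAverage
  rw [Real.circleAverage_def] at h1
  have hper : Function.Periodic (fun θ => h (circleMap w r θ)) (2 * Real.pi) := fun θ => by
    simp only
    rw [periodic_circleMap]
  have h2 := hper.intervalIntegral_add_eq 0 (-Real.pi)
  rw [zero_add, show -Real.pi + 2 * Real.pi = Real.pi by ring] at h2
  rw [h2] at h1
  have hpi := Real.pi_pos
  rw [intervalIntegral.integral_of_le (by linarith), integral_Ioc_eq_integral_Ioo] at h1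
  calc ENNReal.ofReal (2 * Real.pi) * ‖h w‖ₑ
      = ‖∫ θ in Ioo (-Real.pi) Real.pi, h (circleMap w r θ)‖ₑ := by
        rw [← h1, enorm_smul, ← mul_assoc, Real.enorm_eq_ofReal (by positivity),
          ← ENNReal.ofReal_mul (by positivity), mul_inv_cancel₀ (by positivity)]
        simp
    _ ≤ _ := enorm_integral_le_lintegral_enorm _

/-- Integration in polar coordinates over a disk. -/
theorem setLIntegral_ball_eq_polar {F : ℂ → ℝ≥0∞} (hF : Measurable F) (w : ℂ) (R : ℝ) :
    ∫⁻ z in Metric.ball w R, F z =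
      ∫⁻ r in Ioo 0 R, ENNReal.ofReal r *
        ∫⁻ θ in Ioo (-Real.pi) Real.pi, F (circleMap w r θ) := by
  have hind : Measurable ((Metric.ball w R).indicator F) := hF.indicator measurableSet_ball
  rw [← lintegral_indicator measurableSet_ball,
    ← lintegral_add_left_eq_self _ w, ← Complex.lintegral_comp_polarCoord_symm,
    polarCoord_target, Measure.volume_eq_prod, ← Measure.prod_restrict]
  have hmeas : Measurable fun p : ℝ × ℝ => ENNReal.ofReal p.1 •
      (Metric.ball w R).indicator F (w + Complex.polarCoord.symm p) := by
    refine (ENNReal.measurable_ofReal.comp measurable_fst).smul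
      (hind.comp (measurable_const.add ?_))
    have : Continuous fun p : ℝ × ℝ => (Complex.polarCoord.symm p : ℂ) := by
      simp only [Complex.polarCoord_symm_apply]
      fun_prop
    exact this.measurable
  rw [lintegral_prod _ hmeas.aemeasurable]
  have key : ∀ r ∈ Ioi (0 : ℝ), ∫⁻ θ in Ioo (-Real.pi) Real.pi, ENNReal.ofReal r •
      (Metric.ball w R).indicator F (w + Complex.polarCoord.symm (r, θ)) =
      (Ioo 0 R).indicator (fun r => ENNReal.ofReal r *
        ∫⁻ θ in Ioo (-Real.pi) Real.pi, F (circleMap w r θ)) r := by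
    intro r hr
    have hr' : (0 : ℝ) < r := hr
    have e : ∀ θ : ℝ, w + Complex.polarCoord.symm (r, θ) = circleMap w r θ := by
      intro θ
      rw [Complex.polarCoord_symm_apply, circleMap, Complex.exp_mul_I]
      push_cast
      rfl
    simp_rw [e, smul_eq_mul]
    by_cases hrR : r < R
    · rw [indicator_of_mem (show r ∈ Ioo 0 R from ⟨hr', hrR⟩), lintegral_const_mul]
      · congr 1
        refine lintegral_congr fun θ => ?_
        rw [indicator_of_mem]
        simp [circleMap, abs_of_pos hr', hrR]
      · exact hind.comp (continuous_circleMap w r).measurable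
    · rw [indicator_of_notMem (fun h => hrR h.2)]
      have : ∀ θ : ℝ, (Metric.ball w R).indicator F (circleMap w r θ) = 0 := by
        intro θ
        rw [indicator_of_notMem]
        simpa [circleMap, abs_of_pos hr'] using hrR
      simp [this]
  rw [setLIntegral_congr_fun measurableSet_Ioi key, lintegral_indicator measurableSet_Ioo,
    Measure.restrict_restrict measurableSet_Ioo, inter_eq_left.2 Ioo_subset_Ioi_self]

theorem lintegral_Ioo_ofReal {R : ℝ} (hR : 0 < R) :
    ∫⁻ r in Ioo 0 R, ENNReal.ofReal r = ENNReal.ofReal (R ^ 2 / 2) := by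
  rw [restrict_Ioo_eq_restrict_Ioc, ← ofReal_integral_eq_lintegral_ofReal,
    ← intervalIntegral.integral_of_le hR.le, integral_id]
  · simp
  · exact (continuous_id.integrableOn_Icc).mono_set Ioc_subset_Icc_self
  · filter_upwards [ae_restrict_mem measurableSet_Ioc] with r hr using hr.1.le

theorem enorm_mul_area_le_lintegral_ball {h : ℂ → ℂ} (hm : Measurable h) {w : ℂ} {R : ℝ}
    (hR : 0 < R) (hh : DifferentiableOn ℂ h (Metric.ball w R)) :
    ENNReal.ofReal (Real.pi * R ^ 2) * ‖h w‖ₑ ≤ ∫⁻ z in Metric.ball w R, ‖h z‖ₑ := by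
  rw [setLIntegral_ball_eq_polar hm.enorm]
  calc ENNReal.ofReal (Real.pi * R ^ 2) * ‖h w‖ₑ
      = ∫⁻ r in Ioo 0 R, ENNReal.ofReal r * (ENNReal.ofReal (2 * Real.pi) * ‖h w‖ₑ) := by
        rw [lintegral_mul_const _ ENNReal.measurable_ofReal, lintegral_Ioo_ofReal hR, ← mul_assoc,
          ← ENNReal.ofReal_mul (by positivity)]
        congr 2
        ring
    _ ≤ _ := by
        refine setLIntegral_mono' measurableSet_Ioo fun r hr => ?_
        gcongr
        exact two_pi_mul_enorm_le_lintegral_circle hr.1 hr.2 hh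

/-- Where `|h|` exceeds `H / 2` it is at most `|h| ^ p (H / 2) ^ (1 - p)`. Insert this into the area
mean value inequality for `|h|`; the part with `|h| ≤ H / 2` contributes at most half of the left
side and is absorbed. -/
theorem submean_of_one_le {p : ℝ} (hp : 1 ≤ p) {h : ℂ → ℂ} (hm : Measurable h) {w : ℂ} {R : ℝ}
    (hR : 0 < R) (hh : DifferentiableOn ℂ h (Metric.ball w R)) :
    ENNReal.ofReal (R ^ 2) * ‖h w‖ₑ ^ p ≤ 2 ^ p * ∫⁻ z in Metric.ball w R, ‖h z‖ₑ ^ p := by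
  set H := ‖h w‖ₑ with hH
  have hp0 : 0 < p := by linarith
  rcases eq_or_ne H 0 with h0 | h0
  · simp [h0, hp0]
  have hHt : H ≠ ∞ := enorm_ne_top
  set V := ENNReal.ofReal (Real.pi * R ^ 2) with hV
  have hV0 : V ≠ 0 := by simp only [hV, ne_eq, ENNReal.ofReal_eq_zero, not_le]; positivity
  have hVt : V ≠ ∞ := ENNReal.ofReal_ne_top
  set I := ∫⁻ z in Metric.ball w R, ‖h z‖ₑ ^ p with hI
  have hL0 : H / 2 ≠ 0 := by simp [h0]
  have hLt : H / 2 ≠ ∞ := ENNReal.div_ne_top hHt (by simp)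
  have hpt : ∀ x : ℝ≥0∞, x ≤ H / 2 + x ^ p * (H / 2) ^ (1 - p) := by
    intro x
    rcases le_or_gt x (H / 2) with hx | hx
    · exact hx.trans le_self_add
    · refine le_trans ?_ le_add_self
      rcases eq_or_ne x ∞ with rfl | hxt
      · rw [ENNReal.top_rpow_of_pos hp0, ENNReal.top_mul]
        exact (ENNReal.rpow_pos (pos_iff_ne_zero.2 hL0) hLt).ne'
      have hx0 : x ≠ 0 := (pos_of_gt hx).ne'
      calc x = x ^ p * x ^ (1 - p) := by
            rw [← ENNReal.rpow_add _ _ hx0 hxt, add_sub_cancel, ENNReal.rpow_one]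
        _ ≤ _ := by
            gcongr x ^ p * ?_
            rw [show 1 - p = -(p - 1) by ring]
            exact ennreal_rpow_neg_le_rpow_neg (by linarith) hx.le
  have h1 : V * (H / 2) + V * (H / 2) ≤ V * (H / 2) + I * (H / 2) ^ (1 - p) := by
    calc V * (H / 2) + V * (H / 2) = V * H := by rw [← mul_add, ENNReal.add_halves]
      _ ≤ ∫⁻ z in Metric.ball w R, ‖h z‖ₑ := enorm_mul_area_le_lintegral_ball hm hR hh
      _ ≤ ∫⁻ z in Metric.ball w R, (H / 2 + ‖h z‖ₑ ^ p * (H / 2) ^ (1 - p)) :=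
          lintegral_mono fun z => hpt _
      _ = _ := by
          rw [lintegral_add_left measurable_const, setLIntegral_const, Complex.volume_ball,
            lintegral_mul_const _ (hm.enorm.pow_const p), mul_comm (H / 2)]
          congr 2
          rw [hV, ENNReal.ofReal_mul Real.pi_pos.le, mul_comm, ENNReal.ofReal_pow hR.le]
          congr 1
          rw [← NNReal.coe_real_pi, ENNReal.ofReal_coe_nnreal]
  have h2 := (ENNReal.add_le_add_iff_left (ENNReal.mul_ne_top hVt hLt)).1 h1
  have h3 : V * (H / 2) ^ p ≤ I := by
    calc V * (H / 2) ^ p = V * (H / 2) * (H / 2) ^ (p - 1) := by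
          rw [mul_assoc]
          congr 1
          conv_rhs => enter [1]; rw [← ENNReal.rpow_one (H / 2)]
          rw [← ENNReal.rpow_add _ _ hL0 hLt, add_sub_cancel]
      _ ≤ I * (H / 2) ^ (1 - p) * (H / 2) ^ (p - 1) := by gcongr
      _ = I := by
          rw [mul_assoc, ← ENNReal.rpow_add _ _ hL0 hLt]
          simp
  calc ENNReal.ofReal (R ^ 2) * H ^ p = ENNReal.ofReal (R ^ 2) * (2 * (H / 2)) ^ p := by
        rw [ENNReal.mul_div_cancel (by simp) (by simp)]
    _ = 2 ^ p * (ENNReal.ofReal (R ^ 2) * (H / 2) ^ p) := by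
        rw [ENNReal.mul_rpow_of_nonneg _ _ hp0.le]
        ring
    _ ≤ 2 ^ p * (V * (H / 2) ^ p) := by
        gcongr
        exact ENNReal.ofReal_le_ofReal (by nlinarith [Real.pi_gt_three, sq_nonneg R])
    _ ≤ _ := by gcongr

/-- A self-improvement argument. Let `M` be the supremum of `|h| ^ p` weighted by the squared
distance to the boundary of a smaller ball. The mean value inequality on balls of half that
distance, with `|h| = |h| ^ p |h| ^ (1 - p)`, gives `M ≤ 4 I ^ p M ^ (1 - p)`, which can be solved
for `M` because `M` is finite. -/
theorem submean_of_lt_one {p : ℝ} (hp0 : 0 < p) (hp1 : p < 1) {h : ℂ → ℂ} (hm : Measurable h)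
    {w : ℂ} {R : ℝ} (hR : 0 < R) (hh : DifferentiableOn ℂ h (Metric.ball w R)) :
    ENNReal.ofReal (R ^ 2) * ‖h w‖ₑ ^ p ≤
      4 * 4 ^ (1 / p) * ∫⁻ z in Metric.ball w R, ‖h z‖ₑ ^ p := by
  set I := ∫⁻ z in Metric.ball w R, ‖h z‖ₑ ^ p with hI
  -- No bound on `h` near the boundary of the large ball is available; on the closed ball of half
  -- the radius `h` is bounded, so `M` is finite.
  set ρ := R / 2 with hρ
  have hρ0 : 0 < ρ := by positivity
  set M := ⨆ z ∈ Metric.ball w ρ, ENNReal.ofReal ((ρ - dist z w) ^ 2) * ‖h z‖ₑ ^ p with hM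
  have hMt : M ≠ ∞ := by
    have hcont : ContinuousOn h (Metric.closedBall w ρ) :=
      hh.continuousOn.mono (Metric.closedBall_subset_ball (by linarith))
    obtain ⟨B, hB⟩ := (isCompact_closedBall w ρ).exists_bound_of_continuousOn hcont
    refine ne_top_of_le_ne_top (b := ENNReal.ofReal (ρ ^ 2) * ENNReal.ofReal B ^ p)
      (ENNReal.mul_ne_top ENNReal.ofReal_ne_top
        (ENNReal.rpow_ne_top_of_nonneg hp0.le ENNReal.ofReal_ne_top)) ?_
    refine iSup₂_le fun z hz => ?_
    have hz' : dist z w < ρ := hz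
    gcongr ENNReal.ofReal (?_ ^ 2) * ?_ ^ p
    · exact sub_le_self _ dist_nonneg
    · rw [← ofReal_norm]
      exact ENNReal.ofReal_le_ofReal (hB z (Metric.ball_subset_closedBall hz))
  have hstep : ∀ z ∈ Metric.ball w ρ, ENNReal.ofReal ((ρ - dist z w) ^ 2) * ‖h z‖ₑ ^ p ≤
      4 * (I ^ p * M ^ (1 - p)) := by
    intro z hz
    have hz' : dist z w < ρ := hz
    set r := (ρ - dist z w) / 2 with hr
    have hr0 : 0 < r := by rw [hr]; linarith
    set s := ENNReal.ofReal (r ^ 2) with hs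
    have hs0 : s ≠ 0 := by simp only [hs, ne_eq, ENNReal.ofReal_eq_zero, not_le]; positivity
    have hst : s ≠ ∞ := ENNReal.ofReal_ne_top
    have hsub : Metric.ball z r ⊆ Metric.ball w R := by
      refine Metric.ball_subset_ball' ?_
      rw [hr]
      linarith [dist_nonneg (x := z) (y := w)]
    have h1 : s * ‖h z‖ₑ ≤ I * (s⁻¹ * M) ^ ((1 - p) / p) := by
      calc s * ‖h z‖ₑ ≤ ENNReal.ofReal (Real.pi * r ^ 2) * ‖h z‖ₑ := by
            gcongr
            exact ENNReal.ofReal_le_ofReal (by nlinarith [Real.pi_gt_three, sq_nonneg r])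
        _ ≤ ∫⁻ u in Metric.ball z r, ‖h u‖ₑ :=
            enorm_mul_area_le_lintegral_ball hm hr0 (hh.mono hsub)
        _ ≤ ∫⁻ u in Metric.ball z r, ‖h u‖ₑ ^ p * (s⁻¹ * M) ^ ((1 - p) / p) := by
            refine setLIntegral_mono' measurableSet_ball fun u hu => ?_
            have hu' : dist u z < r := hu
            have hd : dist u w < ρ - r := by
              have := dist_triangle u z w
              rw [hr] at hu' ⊢
              linarith
            have hle : ‖h u‖ₑ ^ p ≤ s⁻¹ * M := by
              rw [← ENNReal.div_eq_inv_mul, ENNReal.le_div_iff_mul_le (.inl hs0) (.inl hst),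
                mul_comm]
              refine le_trans ?_ (le_iSup₂ (f := fun z _ =>
                ENNReal.ofReal ((ρ - dist z w) ^ 2) * ‖h z‖ₑ ^ p) u
                (by rw [Metric.mem_ball]; linarith))
              gcongr
              exact ENNReal.ofReal_le_ofReal (by gcongr; linarith)
            calc ‖h u‖ₑ = ‖h u‖ₑ ^ p * (‖h u‖ₑ ^ p) ^ ((1 - p) / p) := by
                  rw [← ENNReal.rpow_mul, ← ENNReal.rpow_add_of_nonneg _ _ hp0.le,
                    mul_div_cancel₀ _ hp0.ne', add_sub_cancel, ENNReal.rpow_one]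
                  rw [mul_div_cancel₀ _ hp0.ne']
                  linarith
              _ ≤ _ := by
                  have : 0 ≤ (1 - p) / p := div_nonneg (by linarith) hp0.le
                  gcongr
        _ = (∫⁻ u in Metric.ball z r, ‖h u‖ₑ ^ p) * (s⁻¹ * M) ^ ((1 - p) / p) :=
            lintegral_mul_const _ (hm.enorm.pow_const p)
        _ ≤ _ := by
            gcongr
            exact lintegral_mono_set hsub
    have h2 : s ^ p * ‖h z‖ₑ ^ p ≤ I ^ p * (s⁻¹ ^ (1 - p) * M ^ (1 - p)) := by
      calc s ^ p * ‖h z‖ₑ ^ p = (s * ‖h z‖ₑ) ^ p := (ENNReal.mul_rpow_of_nonneg _ _ hp0.le).symm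
        _ ≤ (I * (s⁻¹ * M) ^ ((1 - p) / p)) ^ p := by gcongr
        _ = _ := by
            rw [ENNReal.mul_rpow_of_nonneg _ _ hp0.le, ← ENNReal.rpow_mul,
              div_mul_cancel₀ _ hp0.ne', ENNReal.mul_rpow_of_nonneg _ _ (by linarith)]
    have hss : s ^ (1 - p) * s⁻¹ ^ (1 - p) = 1 := by
      rw [← ENNReal.mul_rpow_of_nonneg _ _ (by linarith), ENNReal.mul_inv_cancel hs0 hst,
        ENNReal.one_rpow]
    have h3 : s * ‖h z‖ₑ ^ p ≤ I ^ p * M ^ (1 - p) := by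
      calc s * ‖h z‖ₑ ^ p = s ^ (1 - p) * (s ^ p * ‖h z‖ₑ ^ p) := by
            rw [← mul_assoc, ← ENNReal.rpow_add _ _ hs0 hst, sub_add_cancel, ENNReal.rpow_one]
        _ ≤ s ^ (1 - p) * (I ^ p * (s⁻¹ ^ (1 - p) * M ^ (1 - p))) := by gcongr
        _ = (s ^ (1 - p) * s⁻¹ ^ (1 - p)) * (I ^ p * M ^ (1 - p)) := by ring
        _ = _ := by rw [hss, one_mul]
    have h4 : ENNReal.ofReal ((ρ - dist z w) ^ 2) = 4 * s := by
      rw [hs, show (4 : ℝ≥0∞) = ENNReal.ofReal 4 by simp, ← ENNReal.ofReal_mul (by norm_num)]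
      congr 1
      rw [hr]
      ring
    rw [h4, mul_assoc]
    gcongr
  have hMle : M ≤ 4 * (I ^ p * M ^ (1 - p)) := iSup₂_le hstep
  have hMI : M ≤ 4 ^ (1 / p) * I := by
    rcases eq_or_ne M 0 with h0 | h0
    · simp [h0]
    have h5 : M ^ p ≤ 4 * I ^ p := by
      calc M ^ p = M ^ (p - 1) * M := by
            conv_rhs => enter [2]; rw [← ENNReal.rpow_one M]
            rw [← ENNReal.rpow_add _ _ h0 hMt, sub_add_cancel]
        _ ≤ M ^ (p - 1) * (4 * (I ^ p * M ^ (1 - p))) := by gcongr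
        _ = (M ^ (p - 1) * M ^ (1 - p)) * (4 * I ^ p) := by ring
        _ = _ := by
            rw [← ENNReal.rpow_add _ _ h0 hMt]
            simp
    calc M = (M ^ p) ^ (1 / p) := by
          rw [← ENNReal.rpow_mul, mul_one_div_cancel hp0.ne', ENNReal.rpow_one]
      _ ≤ (4 * I ^ p) ^ (1 / p) := by gcongr
      _ = _ := by
          rw [ENNReal.mul_rpow_of_nonneg _ _ (by positivity), ← ENNReal.rpow_mul,
            mul_one_div_cancel hp0.ne', ENNReal.rpow_one]
  have h6 : ENNReal.ofReal (ρ ^ 2) * ‖h w‖ₑ ^ p ≤ M := by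
    have := le_iSup₂ (f := fun z (_ : z ∈ Metric.ball w ρ) =>
      ENNReal.ofReal ((ρ - dist z w) ^ 2) * ‖h z‖ₑ ^ p) w (Metric.mem_ball_self hρ0)
    rwa [dist_self, sub_zero] at this
  calc ENNReal.ofReal (R ^ 2) * ‖h w‖ₑ ^ p = 4 * (ENNReal.ofReal (ρ ^ 2) * ‖h w‖ₑ ^ p) := by
        rw [← mul_assoc, show (4 : ℝ≥0∞) = ENNReal.ofReal 4 by simp,
          ← ENNReal.ofReal_mul (by norm_num)]
        congr 2
        rw [hρ]
        ring
    _ ≤ 4 * (4 ^ (1 / p) * I) := by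
        gcongr 4 * ?_
        exact h6.trans hMI
    _ = _ := by ring

/-- The sub-mean value property of `|h| ^ p`, with a constant. -/
theorem exists_submean {p : ℝ} (hp : 0 < p) :
    ∃ C : ℝ≥0∞, C ≠ ∞ ∧ ∀ h : ℂ → ℂ, Measurable h → ∀ (w : ℂ) (R : ℝ), 0 < R →
      DifferentiableOn ℂ h (Metric.ball w R) →
        ENNReal.ofReal (R ^ 2) * ‖h w‖ₑ ^ p ≤ C * ∫⁻ z in Metric.ball w R, ‖h z‖ₑ ^ p := by
  rcases lt_or_ge p 1 with h1 | h1
  · exact ⟨4 * 4 ^ (1 / p), ENNReal.mul_ne_top (by simp)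
      (ENNReal.rpow_ne_top_of_nonneg (by positivity) (by simp)),
      fun h hm w R hR hh => submean_of_lt_one hp h1 hm hR hh⟩
  · exact ⟨2 ^ p, ENNReal.rpow_ne_top_of_nonneg hp.le (by simp),
      fun h hm w R hR hh => submean_of_one_le h1 hm hR hh⟩

/-! ### The dyadic decomposition of the disk -/

theorem mem_disk {z : ℂ} : z ∈ disk ↔ ‖z‖ < 1 := by simp [disk]

theorem isOpen_disk : IsOpen disk := Metric.isOpen_ball

/-- The argument of `z`, as a fraction of a full turn, in `[0, 1)`. -/
noncomputable def turn (z : ℂ) : ℝ := Int.fract (Complex.arg z / (2 * Real.pi))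

/-- The index of the dyadic arc of generation `n` that contains the direction of `z`. -/
noncomputable def arcIndex (n : ℕ) (z : ℂ) : ℕ := ⌊2 ^ n * turn z⌋₊

/-- The dyadic generation of `1 - ‖z‖`. -/
noncomputable def level (z : ℂ) : ℕ := Nat.log 2 ⌊(1 - ‖z‖)⁻¹⌋₊

theorem measurable_arcIndex (n : ℕ) : Measurable (arcIndex n) :=
  Nat.measurable_floor.comp
    ((measurable_fract.comp (Complex.measurable_arg.div_const _)).const_mul _)

theorem measurable_level : Measurable level :=
  (Measurable.of_discrete (f := Nat.log 2)).comp
    (Nat.measurable_floor.comp (measurable_const.sub measurable_norm).inv)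

/-- The parent of vertex `j` in the dyadic tree is `j / 2`; this is the compatibility `hcc` required
by the truncation argument. -/
theorem arcIndex_succ_div_two (n : ℕ) (z : ℂ) : arcIndex (n + 1) z / 2 = arcIndex n z := by
  unfold arcIndex
  rw [← Nat.floor_div_ofNat]
  congr 1
  rw [pow_succ]
  ring_nf

theorem turn_nonneg (z : ℂ) : 0 ≤ turn z := Int.fract_nonneg _

theorem turn_lt_one (z : ℂ) : turn z < 1 := Int.fract_lt_one _

theorem arcIndex_lt (n : ℕ) (z : ℂ) : arcIndex n z < 2 ^ n := by
  unfold arcIndex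
  rw [Nat.floor_lt (mul_nonneg (by positivity) (turn_nonneg z))]
  push_cast
  have := turn_lt_one z
  have h : (0 : ℝ) < 2 ^ n := by positivity
  nlinarith

theorem arcIndex_le (n : ℕ) (z : ℂ) : (arcIndex n z : ℝ) ≤ 2 ^ n * turn z :=
  Nat.floor_le (mul_nonneg (by positivity) (turn_nonneg z))

theorem lt_arcIndex_add_one (n : ℕ) (z : ℂ) : 2 ^ n * turn z < arcIndex n z + 1 :=
  Nat.lt_floor_add_one _

/-- The point of the unit circle at `t` full turns. -/
noncomputable def circlePoint (t : ℝ) : ℂ := Complex.exp ((2 * Real.pi * t : ℝ) * Complex.I)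

theorem norm_circlePoint (t : ℝ) : ‖circlePoint t‖ = 1 := Complex.norm_exp_ofReal_mul_I _

theorem norm_mul_circlePoint_turn (z : ℂ) : (‖z‖ : ℂ) * circlePoint (turn z) = z := by
  have h : circlePoint (turn z) = Complex.exp (Complex.arg z * Complex.I) := by
    unfold circlePoint turn
    rw [Complex.exp_eq_exp_iff_exists_int]
    refine ⟨-⌊Complex.arg z / (2 * Real.pi)⌋, ?_⟩
    rw [Int.fract]
    have : (Real.pi : ℂ) ≠ 0 := by exact_mod_cast Real.pi_ne_zero
    push_cast
    field_simp
    ring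
  rw [h, Complex.norm_mul_exp_arg_mul_I]

/-- Membership in the disk matters: elsewhere `(1 - ‖z‖)⁻¹` is at most 0, its floor is 0, and
`level` takes the default value 0. -/
theorem le_level_iff {z : ℂ} (hz : z ∈ disk) (n : ℕ) :
    n ≤ level z ↔ 1 - ‖z‖ ≤ (1 / 2) ^ n := by
  have h0 : 0 < 1 - ‖z‖ := by linarith [mem_disk.1 hz]
  have h1 : 1 ≤ (1 - ‖z‖)⁻¹ := (one_le_inv₀ h0).2 (by linarith [norm_nonneg z])
  rw [level, Nat.le_log_iff_pow_le (by norm_num) (Nat.floor_pos.2 h1).ne',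
    Nat.le_floor_iff (by positivity)]
  push_cast
  rw [le_inv_comm₀ (by positivity) h0, one_div, inv_pow]

theorem isArc_dyadic (n j : ℕ) :
    IsArc (circlePoint '' Ico ((j : ℝ) / 2 ^ n) ((j + 1) / 2 ^ n)) ((1 / 2) ^ n) := by
  have hpi := Real.pi_pos
  have h2 : (0 : ℝ) < 2 ^ n := by positivity
  have h21 : (1 : ℝ) ≤ 2 ^ n := one_le_pow₀ (by norm_num)
  refine ⟨2 * Real.pi * (j / 2 ^ n), 2 * Real.pi * ((j + 1) / 2 ^ n),
    Ico (2 * Real.pi * (j / 2 ^ n)) (2 * Real.pi * ((j + 1) / 2 ^ n)), ?_, ?_,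
    Ioo_subset_Ico_self, Ico_subset_Icc_self, ?_, ?_⟩
  · gcongr
    linarith
  · rw [← sub_le_iff_le_add', ← mul_sub, ← sub_div]
    have : (((j : ℝ) + 1 - j) / 2 ^ n) ≤ 1 := by rw [div_le_one h2]; linarith
    nlinarith
  · ext ζ
    constructor
    · rintro ⟨t, ht, rfl⟩
      refine ⟨2 * Real.pi * t, ⟨?_, ?_⟩, rfl⟩
      · have := ht.1
        gcongr
      · have := ht.2
        gcongr
    · rintro ⟨s, hs, rfl⟩
      refine ⟨s / (2 * Real.pi), ⟨?_, ?_⟩, ?_⟩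
      · rw [le_div_iff₀ (by positivity)]
        linarith [hs.1]
      · rw [div_lt_iff₀ (by positivity)]
        linarith [hs.2]
      · simp only [circlePoint]
        rw [mul_div_cancel₀ _ (by positivity)]
  · rw [one_div, inv_pow]
    field_simp
    ring

theorem branchCell_inter_disk_subset (n j : ℕ) :
    branchCell arcIndex level n j ∩ disk ⊆
      carlesonSquare (circlePoint '' Ico ((j : ℝ) / 2 ^ n) ((j + 1) / 2 ^ n)) ((1 / 2) ^ n) := by
  rintro z ⟨⟨hn, hj⟩, hz⟩
  rw [le_level_iff hz] at hn
  have h2 : (0 : ℝ) < 2 ^ n := by positivity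
  refine ⟨‖z‖, circlePoint (turn z), ⟨turn z, ⟨?_, ?_⟩, rfl⟩, by linarith, mem_disk.1 hz,
    (norm_mul_circlePoint_turn z).symm⟩
  · rw [div_le_iff₀ h2, ← hj, mul_comm]
    exact arcIndex_le n z
  · rw [lt_div_iff₀ h2, ← hj, mul_comm]
    exact lt_arcIndex_add_one n z

/-! ### Dyadic boxes and the jumps of a holomorphic function -/

/-- The dyadic box under the `j`-th dyadic arc of generation `n`. -/
def dyadicBox (n j : ℕ) : Set ℂ :=
  {z | ∃ r t : ℝ, 1 - (1 / 2) ^ n ≤ r ∧ r ≤ 1 - (1 / 2) ^ (n + 1) ∧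
    (j : ℝ) ≤ 2 ^ n * t ∧ 2 ^ n * t ≤ j + 1 ∧ z = r * circlePoint t}

theorem norm_of_mem_dyadicBox {n j : ℕ} {z : ℂ} (hz : z ∈ dyadicBox n j) :
    1 - (1 / 2) ^ n ≤ ‖z‖ ∧ ‖z‖ ≤ 1 - (1 / 2) ^ (n + 1) := by
  obtain ⟨r, t, h1, h2, -, -, rfl⟩ := hz
  have : (1 / 2 : ℝ) ^ n ≤ 1 := pow_le_one₀ (by norm_num) (by norm_num)
  rw [norm_mul, norm_circlePoint, mul_one, Complex.norm_real, Real.norm_of_nonneg (by linarith)]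
  exact ⟨h1, h2⟩

theorem mem_disk_of_mem_dyadicBox {n j : ℕ} {z : ℂ} (hz : z ∈ dyadicBox n j) : z ∈ disk := by
  rw [mem_disk]
  have : (0 : ℝ) < (1 / 2) ^ (n + 1) := by positivity
  linarith [(norm_of_mem_dyadicBox hz).2]

/-- The supremum of `|f'|` over the dyadic box `(n, j)`, scaled by the size of the box. -/
noncomputable def boxJump (f : ℂ → ℂ) (n j : ℕ) : ℝ≥0∞ :=
  if j < 2 ^ n then ENNReal.ofReal ((1 / 2) ^ n) * ⨆ z ∈ dyadicBox n j, ‖deriv f z‖ₑ else 0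

/-- The boxes of generation `n` lie in a compact disk inside the open one. Finiteness is needed
because the truncation uses `toReal` of the partial sums. -/
theorem boxJump_ne_top {f : ℂ → ℂ} (hf : DifferentiableOn ℂ f disk) (n j : ℕ) :
    boxJump f n j ≠ ∞ := by
  unfold boxJump
  split_ifs
  · refine ENNReal.mul_ne_top ENNReal.ofReal_ne_top ?_
    have hcont : ContinuousOn (deriv f) (Metric.closedBall 0 (1 - (1 / 2) ^ (n + 1))) :=
      ((hf.deriv isOpen_disk).continuousOn).mono
        (Metric.closedBall_subset_ball (by linarith [pow_pos (one_half_pos (α := ℝ)) (n + 1)]))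
    obtain ⟨B, hB⟩ := (isCompact_closedBall _ _).exists_bound_of_continuousOn hcont
    refine ne_top_of_le_ne_top (b := ENNReal.ofReal B) ENNReal.ofReal_ne_top ?_
    refine iSup₂_le fun z hz => ?_
    rw [← ofReal_norm]
    exact ENNReal.ofReal_le_ofReal (hB z (by simpa using (norm_of_mem_dyadicBox hz).2))
  · simp

/-- The mean value inequality on a radial segment of the box, which is convex and has length at most
`2 ^ (-n)`. -/
theorem enorm_sub_le_boxJump {f : ℂ → ℂ} (hf : DifferentiableOn ℂ f disk) {n j : ℕ}
    (hj : j < 2 ^ n) {r s t : ℝ} (hr : r ∈ Icc (1 - (1 / 2) ^ n : ℝ) (1 - (1 / 2) ^ (n + 1)))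
    (hs : s ∈ Icc (1 - (1 / 2) ^ n : ℝ) (1 - (1 / 2) ^ (n + 1)))
    (ht : (j : ℝ) ≤ 2 ^ n * t) (ht' : 2 ^ n * t ≤ j + 1) :
    ‖f (s * circlePoint t) - f (r * circlePoint t)‖ₑ ≤ boxJump f n j := by
  have hfin := boxJump_ne_top hf n j
  rw [boxJump, if_pos hj] at hfin ⊢
  set S := ⨆ z ∈ dyadicBox n j, ‖deriv f z‖ₑ with hS
  have hpos : (0 : ℝ) < (1 / 2) ^ n := by positivity
  have hSfin : S ≠ ∞ := by
    intro h
    rw [h, ENNReal.mul_top (by simp)] at hfin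
    exact hfin rfl
  set L : ℝ →ₗ[ℝ] ℂ := LinearMap.toSpanSingleton ℝ ℂ (circlePoint t)
  have hL : ∀ x : ℝ, L x = x * circlePoint t := fun x => by simp [L]
  have hconv : Convex ℝ (L '' Icc (1 - (1 / 2) ^ n : ℝ) (1 - (1 / 2) ^ (n + 1))) :=
    (convex_Icc _ _).linear_image L
  have hbox : ∀ z ∈ L '' Icc (1 - (1 / 2) ^ n : ℝ) (1 - (1 / 2) ^ (n + 1)),
      z ∈ dyadicBox n j := by
    rintro _ ⟨x, hx, rfl⟩
    exact ⟨x, t, hx.1, hx.2, ht, ht', hL x⟩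
  have h1 := hconv.norm_image_sub_le_of_norm_deriv_le (𝕜 := ℂ) (f := f) (C := S.toReal)
    (fun z hz => (hf z (mem_disk_of_mem_dyadicBox (hbox z hz))).differentiableAt
      (isOpen_disk.mem_nhds (mem_disk_of_mem_dyadicBox (hbox z hz))))
    (fun z hz => by
      rw [← toReal_enorm]
      exact ENNReal.toReal_mono hSfin (le_iSup₂ (f := fun z _ => ‖deriv f z‖ₑ) z (hbox z hz)))
    (mem_image_of_mem L hr) (mem_image_of_mem L hs)
  rw [hL, hL] at h1
  have h2 : ‖(s : ℂ) * circlePoint t - r * circlePoint t‖ ≤ (1 / 2) ^ n := by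
    rw [← sub_mul, norm_mul, norm_circlePoint, mul_one, ← Complex.ofReal_sub, Complex.norm_real,
      Real.norm_eq_abs, abs_le]
    have : (0 : ℝ) < (1 / 2) ^ (n + 1) := by positivity
    constructor <;> linarith [hr.1, hr.2, hs.1, hs.2]
  rw [← ofReal_norm, ← ENNReal.ofReal_toReal hSfin, ← ENNReal.ofReal_mul hpos.le,
    mul_comm (_ ^ n)]
  exact ENNReal.ofReal_le_ofReal (h1.trans (by gcongr))

/-- The pointwise bound of a holomorphic function by the jumps along a branch. -/
theorem enorm_le_branchSum {f : ℂ → ℂ} (hf : DifferentiableOn ℂ f disk) {z : ℂ} (hz : z ∈ disk) :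
    ‖f z‖ₑ ≤ ‖f 0‖ₑ + branchSum arcIndex level (boxJump f) z := by
  have key : ∀ n : ℕ, ∀ r ∈ Icc (1 - (1 / 2) ^ n : ℝ) (1 - (1 / 2) ^ (n + 1)),
      ‖f (r * circlePoint (turn z))‖ₑ ≤
        ‖f 0‖ₑ + ∑ k ∈ Finset.range (n + 1), boxJump f k (arcIndex k z) := by
    have step : ∀ n : ℕ, ∀ r ∈ Icc (1 - (1 / 2) ^ n : ℝ) (1 - (1 / 2) ^ (n + 1)),
        ‖f (r * circlePoint (turn z))‖ₑ ≤
          ‖f ((1 - (1 / 2) ^ n : ℝ) * circlePoint (turn z))‖ₑ + boxJump f n (arcIndex n z) := by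
      intro n r hr
      have h0 : (1 / 2 : ℝ) ^ (n + 1) ≤ (1 / 2) ^ n :=
        pow_le_pow_of_le_one (by norm_num) (by norm_num) (Nat.le_succ n)
      have := enorm_sub_le_boxJump hf (arcIndex_lt n z)
        (r := 1 - (1 / 2) ^ n) (s := r) (t := turn z) ⟨le_rfl, by linarith⟩ hr
        (arcIndex_le n z) (lt_arcIndex_add_one n z).le
      calc ‖f (r * circlePoint (turn z))‖ₑ = ‖f ((1 - (1 / 2) ^ n : ℝ) * circlePoint (turn z)) +
            (f (r * circlePoint (turn z)) -
              f ((1 - (1 / 2) ^ n : ℝ) * circlePoint (turn z)))‖ₑ := by rw [add_sub_cancel]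
        _ ≤ _ := (enorm_add_le _ _).trans (by gcongr)
    intro n
    induction n with
    | zero =>
      intro r hr
      refine (step 0 r hr).trans_eq ?_
      simp
    | succ n ih =>
      intro r hr
      refine (step (n + 1) r hr).trans ?_
      rw [Finset.sum_range_succ, ← add_assoc]
      gcongr
      refine ih _ ⟨?_, le_rfl⟩
      have h0 : (1 / 2 : ℝ) ^ (n + 1) ≤ (1 / 2) ^ n :=
        pow_le_pow_of_le_one (by norm_num) (by norm_num) (Nat.le_succ n)
      linarith
  -- By maximality of `level z`, the modulus of `z` lies in the radial range of the boxes of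
  -- generation `level z`.
  have h1 := (le_level_iff hz _).1 le_rfl
  have h2 := (le_level_iff hz (level z + 1)).not.1 (by omega)
  have := key (level z) ‖z‖ ⟨by linarith, by linarith⟩
  rwa [norm_mul_circlePoint_turn] at this

/-- The integral part of the Dirichlet norm. -/
noncomputable def energy (p α : ℝ) (f : ℂ → ℂ) : ℝ≥0∞ :=
  ∫⁻ z, ‖deriv f z‖ₑ ^ p * ENNReal.ofReal ((1 - ‖z‖ ^ 2) ^ α) ∂areaMeasure

theorem ofReal_pi_mul_lintegral_areaMeasure (F : ℂ → ℝ≥0∞) :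
    ENNReal.ofReal Real.pi * ∫⁻ z, F z ∂areaMeasure = ∫⁻ z in disk, F z := by
  rw [areaMeasure, lintegral_smul_measure, smul_eq_mul, ← mul_assoc,
    ← ENNReal.ofReal_mul Real.pi_pos.le, mul_one_div_cancel Real.pi_ne_zero, ENNReal.ofReal_one,
    one_mul]

theorem norm_circlePoint_sub (s t : ℝ) :
    ‖circlePoint s - circlePoint t‖ = 2 * |Real.sin (Real.pi * (s - t))| := by
  have h : circlePoint s - circlePoint t =
      circlePoint t * (Complex.exp (Complex.I * ((2 * Real.pi * (s - t) : ℝ) : ℂ)) - 1) := by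
    rw [mul_sub, mul_one, circlePoint, circlePoint, ← Complex.exp_add]
    congr 2
    push_cast
    ring
  rw [h, norm_mul, norm_circlePoint, one_mul, Complex.norm_exp_I_mul_ofReal_sub_one, norm_mul,
    Real.norm_eq_abs, Real.norm_eq_abs, abs_of_pos (two_pos : (0 : ℝ) < 2)]
  congr 3
  ring

theorem norm_circlePoint_sub_le (s t : ℝ) :
    ‖circlePoint s - circlePoint t‖ ≤ 8 * |s - t| := by
  rw [norm_circlePoint_sub]
  have h1 : |Real.sin (Real.pi * (s - t))| ≤ |Real.pi * (s - t)| := Real.abs_sin_le_abs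
  rw [abs_mul, abs_of_pos Real.pi_pos] at h1
  nlinarith [Real.pi_lt_four, abs_nonneg (s - t)]

/-- Dyadic points of generation `n` on the circle are separated. -/
theorem le_norm_circlePoint_sub {n i j : ℕ} (hi : i < 2 ^ n) (hij : j < i) :
    4 * (1 / 2) ^ n ≤ ‖circlePoint (i / 2 ^ n) - circlePoint (j / 2 ^ n)‖ := by
  have h2 : (0 : ℝ) < 2 ^ n := by positivity
  have hpi := Real.pi_pos
  set x : ℝ := (i / 2 ^ n - j / 2 ^ n) with hx
  have hx1 : 1 / 2 ^ n ≤ x := by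
    rw [hx, ← sub_div]
    gcongr
    have : (j : ℝ) + 1 ≤ i := by exact_mod_cast hij
    linarith
  have hx2 : x ≤ 1 - 1 / 2 ^ n := by
    have h3 : (i : ℝ) / 2 ^ n ≤ 1 - 1 / 2 ^ n := by
      rw [le_sub_iff_add_le, ← add_div, div_le_one h2]
      exact_mod_cast hi
    have : 0 ≤ (j : ℝ) / 2 ^ n := by positivity
    linarith
  have hsin : ∀ y : ℝ, 0 ≤ y → y ≤ 1 / 2 → 2 * y ≤ Real.sin (Real.pi * y) := by
    intro y hy hy'
    have := Real.mul_le_sin (x := Real.pi * y) (by positivity) (by nlinarith)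
    calc 2 * y = 2 / Real.pi * (Real.pi * y) := by field_simp
      _ ≤ _ := this
  have hpos : 0 < 1 / (2 : ℝ) ^ n := by positivity
  have key : 2 * (1 / 2 ^ n) ≤ Real.sin (Real.pi * x) := by
    rcases le_total x (1 / 2) with h | h
    · exact (by linarith : 2 * (1 / 2 ^ n) ≤ 2 * x).trans (hsin x (by linarith) h)
    · have := hsin (1 - x) (by linarith) (by linarith)
      rw [show Real.pi * (1 - x) = Real.pi - Real.pi * x by ring, Real.sin_pi_sub] at this
      linarith
  rw [norm_circlePoint_sub, ← hx]
  have := le_abs_self (Real.sin (Real.pi * x))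
  rw [one_div_pow]
  linarith

/-- A neighbourhood of the dyadic box `(n, j)`. -/
def boxNhd (n j : ℕ) : Set ℂ :=
  {u | (1 / 2) ^ (n + 2) ≤ 1 - ‖u‖ ∧ 1 - ‖u‖ ≤ 2 * (1 / 2) ^ n ∧
    dist u (circlePoint (j / 2 ^ n)) < 10 * (1 / 2) ^ n}

theorem measurableSet_boxNhd (n j : ℕ) : MeasurableSet (boxNhd n j) :=
  (measurableSet_le measurable_const (measurable_const.sub measurable_norm)).inter
    ((measurableSet_le (measurable_const.sub measurable_norm) measurable_const).inter
      (measurableSet_lt (measurable_id.dist measurable_const) measurable_const))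

theorem ball_subset_boxNhd {n j : ℕ} {w : ℂ} (hw : w ∈ dyadicBox n j) :
    Metric.ball w ((1 / 2) ^ (n + 2)) ⊆ boxNhd n j := by
  intro u hu
  rw [Metric.mem_ball, dist_eq_norm] at hu
  have hn := norm_of_mem_dyadicBox hw
  obtain ⟨r, t, hr1, hr2, ht1, ht2, rfl⟩ := hw
  set w := (r : ℂ) * circlePoint t
  set d : ℝ := (1 / 2) ^ n with hd
  have hd1 : (1 / 2 : ℝ) ^ (n + 1) = d / 2 := by rw [pow_succ]; ring
  have hd2 : (1 / 2 : ℝ) ^ (n + 2) = d / 4 := by rw [pow_add]; norm_num; ring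
  have hd0 : 0 < d := by positivity
  rw [hd1] at hr2 hn
  rw [hd2] at hu
  have h1 := abs_le.1 (abs_norm_sub_norm_le u w)
  have h2 : ‖w - circlePoint t‖ ≤ d := by
    have : w - circlePoint t = ((r - 1 : ℝ) : ℂ) * circlePoint t := by
      simp only [w]
      push_cast
      ring
    rw [this, norm_mul, norm_circlePoint, mul_one, Complex.norm_real, Real.norm_eq_abs, abs_le]
    constructor <;> linarith
  have h3 : ‖circlePoint t - circlePoint (j / 2 ^ n)‖ ≤ 8 * |t - j / 2 ^ n| :=
    norm_circlePoint_sub_le _ _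
  have h4 : |t - j / 2 ^ n| ≤ d := by
    have e : d = 1 / 2 ^ n := by rw [hd, one_div_pow]
    have h20 : (0 : ℝ) < 2 ^ n := by positivity
    rw [abs_le, e]
    constructor
    · have : (j : ℝ) / 2 ^ n ≤ t := by rw [div_le_iff₀ h20]; linarith
      have : 0 < 1 / (2 : ℝ) ^ n := by positivity
      linarith
    · rw [sub_le_iff_le_add, ← add_div, le_div_iff₀ h20]
      linarith
  have h8 : ‖w - circlePoint (j / 2 ^ n)‖ ≤ d + 8 * |t - j / 2 ^ n| :=
    (norm_sub_le_norm_sub_add_norm_sub _ (circlePoint t) _).trans (by linarith)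
  -- The distances from `u` to `w`, to the circle point over `w`, and on to the corner of the arc
  -- add up to at most `(1/4 + 1 + 8) d < 10 d`.
  have hdist := norm_sub_le_norm_sub_add_norm_sub u w (circlePoint (j / 2 ^ n))
  refine ⟨by rw [hd2]; linarith [h1.2, hn.2], by linarith [h1.1, hn.1], ?_⟩
  rw [dist_eq_norm]
  linarith

/-- A packing argument: the points are `4 d` apart, so the balls of radius `2 d` about them are
disjoint, and they lie in a ball of radius `12 d`. The area ratio is 36. -/
theorem card_le_of_forall_dist_lt {n : ℕ} {u : ℂ} (S : Finset ℕ)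
    (hS : ∀ j ∈ S, j < 2 ^ n ∧ dist u (circlePoint (j / 2 ^ n)) < 10 * (1 / 2) ^ n) :
    (S.card : ℝ≥0∞) ≤ 36 := by
  set d : ℝ := (1 / 2) ^ n with hd
  have hd0 : 0 < d := by positivity
  have hdisj : (S : Set ℕ).PairwiseDisjoint
      fun j => Metric.ball (circlePoint (j / 2 ^ n)) (2 * d) := by
    have key : ∀ i j : ℕ, i < 2 ^ n → j < i →
        Disjoint (Metric.ball (circlePoint (i / 2 ^ n)) (2 * d))
          (Metric.ball (circlePoint (j / 2 ^ n)) (2 * d)) := by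
      intro i j hi hij
      apply Metric.ball_disjoint_ball
      rw [dist_eq_norm]
      have := le_norm_circlePoint_sub hi hij
      linarith
    intro i hi j hj hij
    rcases lt_or_gt_of_ne hij with h | h
    · exact (key j i (hS j hj).1 h).symm
    · exact key i j (hS i hi).1 h
  have hsub : ⋃ j ∈ S, Metric.ball (circlePoint (j / 2 ^ n)) (2 * d) ⊆
      Metric.ball u (12 * d) := by
    refine iUnion₂_subset fun j hj => Metric.ball_subset_ball' ?_
    rw [dist_comm]
    linarith [(hS j hj).2]
  have h1 := measure_mono (μ := volume) hsub
  rw [measure_biUnion_finset hdisj fun j _ => measurableSet_ball] at h1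
  simp_rw [Complex.volume_ball] at h1
  rw [Finset.sum_const, nsmul_eq_mul, ← mul_assoc] at h1
  have h2 := (ENNReal.mul_le_mul_iff_left (by simp [NNReal.pi_ne_zero]) (by simp)).1 h1
  rw [show 12 * d = 6 * (2 * d) by ring, ENNReal.ofReal_mul (p := 6) (by norm_num),
    mul_pow (ENNReal.ofReal 6)] at h2
  have h3 := (ENNReal.mul_le_mul_iff_left
    (pow_ne_zero 2 (ENNReal.ofReal_pos.2 (by positivity : 0 < 2 * d)).ne')
    (ENNReal.pow_ne_top ENNReal.ofReal_ne_top)).1 h2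
  refine h3.trans_eq ?_
  rw [ENNReal.ofReal_ofNat]
  norm_num

/-- The neighbourhoods have bounded overlap: a point meets at most four generations, and at most 36
neighbourhoods in each. -/
theorem tsum_indicator_boxNhd_le (u : ℂ) :
    ∑' n, ∑' j, (if j < 2 ^ n then (boxNhd n j).indicator 1 u else 0) ≤ (144 : ℝ≥0∞) := by
  classical
  set P : ℕ → Prop := fun n => (1 / 2) ^ (n + 2) ≤ 1 - ‖u‖ ∧ 1 - ‖u‖ ≤ 2 * (1 / 2) ^ n with hP
  have hinner : ∀ n, ∑' j, (if j < 2 ^ n then (boxNhd n j).indicator 1 u else 0) ≤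
      if P n then (36 : ℝ≥0∞) else 0 := by
    intro n
    by_cases hn : P n
    · rw [if_pos hn]
      set S := (Finset.range (2 ^ n)).filter fun j : ℕ =>
        dist u (circlePoint ((j : ℝ) / 2 ^ n)) < 10 * (1 / 2) ^ n with hS
      rw [tsum_eq_sum (s := S)]
      · refine le_trans ?_ (card_le_of_forall_dist_lt (n := n) (u := u) S fun j hj => by
          simpa [hS] using hj)
        rw [Finset.card_eq_sum_ones, Nat.cast_sum]
        refine Finset.sum_le_sum fun j hj => ?_
        split_ifs
        · simpa using indicator_le_self' (s := boxNhd n j) (f := (1 : ℂ → ℝ≥0∞)) (by simp) u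
        · simp
      · intro j hj
        split_ifs with h
        · refine indicator_of_notMem (fun hu => hj ?_) _
          simp only [hS, Finset.mem_filter, Finset.mem_range]
          exact ⟨h, hu.2.2⟩
        · rfl
    · rw [if_neg hn, nonpos_iff_eq_zero, ENNReal.tsum_eq_zero]
      intro j
      split_ifs
      · exact indicator_of_notMem (fun hu => hn ⟨hu.1, hu.2.1⟩) _
      · rfl
  refine (ENNReal.tsum_le_tsum hinner).trans ?_
  by_cases hex : ∃ n, P n
  · set k := Nat.find hex with hk
    have hkP : P k := Nat.find_spec hex
    -- If `P k` and `P n` hold, then `2 ^ (-(k + 2)) ≤ 2 * 2 ^ (-n)`, that is, `n ≤ k + 3`.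
    rw [tsum_eq_sum (s := Finset.Ico k (k + 4))]
    · calc ∑ n ∈ Finset.Ico k (k + 4), (if P n then (36 : ℝ≥0∞) else 0)
          ≤ ∑ n ∈ Finset.Ico k (k + 4), (36 : ℝ≥0∞) :=
            Finset.sum_le_sum fun n _ => by split_ifs <;> simp
        _ = 144 := by
            rw [Finset.sum_const]
            simp
            norm_num
    · intro n hn
      refine if_neg fun hPn => hn ?_
      rw [Finset.mem_Ico]
      refine ⟨Nat.find_min' hex hPn, ?_⟩
      by_contra hlt
      have h1 : (1 / 2 : ℝ) ^ n ≤ (1 / 2) ^ (k + 4) :=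
        pow_le_pow_of_le_one (by norm_num) (by norm_num) (by omega)
      have h2 : (0 : ℝ) < (1 / 2) ^ k := by positivity
      have h3 := hkP.1
      have h4 := hPn.2
      rw [pow_add] at h1 h3
      norm_num at h1 h3
      linarith
  · push Not at hex
    simp [hex]

theorem two_rpow_neg_mul (n : ℕ) (σ : ℝ) :
    (2 : ℝ≥0∞) ^ (-(n * σ)) = ENNReal.ofReal ((1 / 2) ^ n) ^ σ := by
  rw [neg_mul_eq_neg_mul, ENNReal.rpow_mul, ENNReal.rpow_neg, ENNReal.rpow_natCast, one_div,
    ENNReal.ofReal_pow (by norm_num), ENNReal.ofReal_inv_of_pos (by norm_num), ENNReal.inv_pow]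
  simp

theorem rpow_le_four_rpow_abs_mul {x y α : ℝ} (hx : 0 < x) (hy : 0 < y) (h1 : x ≤ 4 * y)
    (h2 : y ≤ 4 * x) : x ^ α ≤ 4 ^ |α| * y ^ α := by
  rcases le_total 0 α with h | h
  · rw [abs_of_nonneg h, ← Real.mul_rpow (by norm_num) hy.le]
    exact Real.rpow_le_rpow hx.le h1 h
  · rw [abs_of_nonpos h, Real.rpow_neg (by norm_num), ← Real.inv_rpow (by norm_num),
      ← Real.mul_rpow (by norm_num) hy.le]
    exact Real.rpow_le_rpow_of_nonpos (by positivity) (by linarith) h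

/-- The jumps of a function are controlled by its Dirichlet energy. -/
theorem exists_tsum_boxJump_le {p : ℝ} (hp : 0 < p) (α : ℝ) :
    ∃ C : ℝ≥0∞, C ≠ ∞ ∧ ∀ f : ℂ → ℂ, DifferentiableOn ℂ f disk →
      ∑' n : ℕ, ∑' j : ℕ, (boxJump f n j * (2 : ℝ≥0∞) ^ (-(n * ((α + 2 - p) / p)))) ^ p ≤
        C * energy p α f := by
  obtain ⟨C, hC, hsub⟩ := exists_submean hp
  -- The 16 comes from balls of radius a quarter of the box size, `4 ^ |α|` from comparing the
  -- weight with a power of that size, and `π` from the normalisation of area.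
  set B : ℝ≥0∞ := 16 * C * ENNReal.ofReal (4 ^ |α|) * ENNReal.ofReal Real.pi with hB
  have hBt : B ≠ ∞ := by
    simp only [hB]
    exact ENNReal.mul_ne_top (ENNReal.mul_ne_top (ENNReal.mul_ne_top (by simp) hC)
      ENNReal.ofReal_ne_top) ENNReal.ofReal_ne_top
  refine ⟨B * 144, ENNReal.mul_ne_top hBt (by simp), fun f hf => ?_⟩
  set φ : ℂ → ℝ≥0∞ := fun z => ‖deriv f z‖ₑ ^ p * ENNReal.ofReal ((1 - ‖z‖ ^ 2) ^ α) with hφ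
  have hφm : Measurable φ := by
    refine ((measurable_deriv f).enorm.pow_const p).mul (ENNReal.measurable_ofReal.comp ?_)
    exact (measurable_const.sub (measurable_norm.pow_const 2)).pow_const α
  have hbox : ∀ n j : ℕ, (boxJump f n j * (2 : ℝ≥0∞) ^ (-(n * ((α + 2 - p) / p)))) ^ p ≤
      ∫⁻ u, B * ((if j < 2 ^ n then (boxNhd n j).indicator 1 u else 0) * φ u) ∂areaMeasure := by
    intro n j
    unfold boxJump
    by_cases hj : j < 2 ^ n
    swap
    · simp [hj, hp]
    simp only [hj, if_true]
    set d : ℝ := (1 / 2) ^ n with hd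
    have hd0 : 0 < d := by positivity
    have hd2 : (1 / 2 : ℝ) ^ (n + 2) = d / 4 := by rw [pow_add]; norm_num; ring
    set D := ENNReal.ofReal d with hD
    have hD0 : D ≠ 0 := by simpa [hD] using hd0
    have hDt : D ≠ ∞ := ENNReal.ofReal_ne_top
    have hind : ∀ u, B * ((boxNhd n j).indicator 1 u * φ u) =
        (boxNhd n j).indicator (fun u => B * φ u) u := by
      intro u
      by_cases hu : u ∈ boxNhd n j <;> simp [hu]
    simp_rw [hind]
    rw [lintegral_indicator (measurableSet_boxNhd n j), lintegral_const_mul _ hφm]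
    set J := ∫⁻ u in boxNhd n j, φ u ∂areaMeasure with hJ
    -- The factor `2 ^ (-n (α + 2 - p) / p)` is chosen so that the weighted jump to the power `p` is
    -- `D ^ (α + 2) sup |f'| ^ p`: two powers of `D` are the area of the box and `α` powers are the
    -- weight.
    have hpoint : ∀ w ∈ dyadicBox n j, D ^ (α + 2) * ‖deriv f w‖ₑ ^ p ≤ B * J := by
      intro w hw
      have hball : Metric.ball w ((1 / 2) ^ (n + 2)) ⊆ boxNhd n j := ball_subset_boxNhd hw
      have hdisk : boxNhd n j ⊆ disk := fun u hu => by
        rw [mem_disk]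
        have := hu.1
        rw [hd2] at this
        linarith
      have h1 := hsub (deriv f) (measurable_deriv f) w ((1 / 2) ^ (n + 2)) (by positivity)
        ((hf.deriv isOpen_disk).mono (hball.trans hdisk))
      calc D ^ (α + 2) * ‖deriv f w‖ₑ ^ p
          = 16 * D ^ α * (ENNReal.ofReal (((1 / 2) ^ (n + 2)) ^ 2) * ‖deriv f w‖ₑ ^ p) := by
            rw [ENNReal.rpow_add _ _ hD0 hDt, ENNReal.rpow_two, hD, ← ENNReal.ofReal_pow hd0.le,
              show d ^ 2 = 16 * ((1 / 2) ^ (n + 2)) ^ 2 by rw [hd2]; ring,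
              ENNReal.ofReal_mul (by norm_num), ENNReal.ofReal_ofNat]
            ring
        _ ≤ 16 * D ^ α * (C * ∫⁻ u in boxNhd n j, ‖deriv f u‖ₑ ^ p) := by
            gcongr 16 * D ^ α * ?_
            exact h1.trans (by gcongr)
        _ = 16 * C * ∫⁻ u in boxNhd n j, D ^ α * ‖deriv f u‖ₑ ^ p := by
            rw [lintegral_const_mul _ ((measurable_deriv f).enorm.pow_const p)]
            ring
        _ ≤ 16 * C * ∫⁻ u in boxNhd n j, ENNReal.ofReal (4 ^ |α|) * φ u := by
            gcongr 16 * C * ?_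
            refine setLIntegral_mono' (measurableSet_boxNhd n j) fun u hu => ?_
            have hu1 := hu.1
            have hu2 := hu.2.1
            rw [hd2] at hu1
            have hn := norm_nonneg u
            have hlow : d ≤ 4 * (1 - ‖u‖ ^ 2) := by nlinarith
            have hupp : 1 - ‖u‖ ^ 2 ≤ 4 * d := by nlinarith
            have h2 : D ^ α ≤ ENNReal.ofReal (4 ^ |α|) * ENNReal.ofReal ((1 - ‖u‖ ^ 2) ^ α) := by
              rw [hD, ENNReal.ofReal_rpow_of_pos hd0, ← ENNReal.ofReal_mul (by positivity)]
              exact ENNReal.ofReal_le_ofReal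
                (rpow_le_four_rpow_abs_mul hd0 (by linarith) hlow hupp)
            calc D ^ α * ‖deriv f u‖ₑ ^ p ≤ ENNReal.ofReal (4 ^ |α|) *
                ENNReal.ofReal ((1 - ‖u‖ ^ 2) ^ α) * ‖deriv f u‖ₑ ^ p := by gcongr
              _ = _ := by simp only [hφ]; ring
        _ = 16 * C * ENNReal.ofReal (4 ^ |α|) * ∫⁻ u in boxNhd n j, φ u := by
            rw [lintegral_const_mul _ hφm]
            ring
        _ = B * J := by
            have : ∫⁻ u in boxNhd n j, φ u = ENNReal.ofReal Real.pi * J := by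
              rw [hJ, ← lintegral_indicator (measurableSet_boxNhd n j) (μ := areaMeasure),
                ofReal_pi_mul_lintegral_areaMeasure, lintegral_indicator (measurableSet_boxNhd n j),
                Measure.restrict_restrict (measurableSet_boxNhd n j), inter_eq_left.2 hdisk]
            rw [this, hB]
            ring
    have hDα : D ^ (α + 2) ≠ 0 := (ENNReal.rpow_pos (pos_iff_ne_zero.2 hD0) hDt).ne'
    have hDα' : D ^ (α + 2) ≠ ∞ := ENNReal.rpow_ne_top_of_ne_zero hD0 hDt
    have hS : ⨆ z ∈ dyadicBox n j, ‖deriv f z‖ₑ ≤ (B * J / D ^ (α + 2)) ^ (1 / p) := by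
      refine iSup₂_le fun w hw => ?_
      rw [one_div, ENNReal.le_rpow_inv_iff hp, ENNReal.le_div_iff_mul_le (.inl hDα) (.inl hDα'),
        mul_comm]
      exact hpoint w hw
    calc (D * (⨆ z ∈ dyadicBox n j, ‖deriv f z‖ₑ) *
          (2 : ℝ≥0∞) ^ (-(n * ((α + 2 - p) / p)))) ^ p
        ≤ (D * (B * J / D ^ (α + 2)) ^ (1 / p) * D ^ ((α + 2 - p) / p)) ^ p := by
          rw [two_rpow_neg_mul]
          gcongr
      _ = D ^ p * (B * J / D ^ (α + 2)) * D ^ (α + 2 - p) := by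
          rw [ENNReal.mul_rpow_of_nonneg _ _ hp.le, ENNReal.mul_rpow_of_nonneg _ _ hp.le,
            ← ENNReal.rpow_mul, ← ENNReal.rpow_mul, one_div_mul_cancel hp.ne',
            ENNReal.rpow_one, div_mul_cancel₀ _ hp.ne']
      _ = D ^ (α + 2) * (B * J / D ^ (α + 2)) := by
          rw [mul_right_comm, ← ENNReal.rpow_add _ _ hD0 hDt]
          congr 2
          ring
      _ = B * J := ENNReal.mul_div_cancel hDα hDα'
  have hindm : ∀ n j : ℕ, Measurable fun u =>
      (if j < 2 ^ n then (boxNhd n j).indicator (1 : ℂ → ℝ≥0∞) u else 0) := by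
    intro n j
    split_ifs
    · exact measurable_one.indicator (measurableSet_boxNhd n j)
    · exact measurable_const
  calc _ ≤ ∑' n : ℕ, ∑' j : ℕ, ∫⁻ u, B *
        ((if j < 2 ^ n then (boxNhd n j).indicator 1 u else 0) * φ u) ∂areaMeasure :=
        ENNReal.tsum_le_tsum fun n => ENNReal.tsum_le_tsum fun j => hbox n j
    _ = ∫⁻ u, B * ((∑' n : ℕ, ∑' j : ℕ,
          (if j < 2 ^ n then (boxNhd n j).indicator 1 u else 0)) * φ u) ∂areaMeasure := by
        have hm2 : ∀ n j : ℕ, Measurable fun u => B *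
            ((if j < 2 ^ n then (boxNhd n j).indicator (1 : ℂ → ℝ≥0∞) u else 0) * φ u) :=
          fun n j => ((hindm n j).mul hφm).const_mul _
        simp_rw [← lintegral_tsum fun j => (hm2 _ j).aemeasurable]
        rw [← lintegral_tsum fun n => (Measurable.tsum fun j => hm2 n j).aemeasurable]
        refine lintegral_congr fun u => ?_
        simp_rw [ENNReal.tsum_mul_left, ENNReal.tsum_mul_right]
    _ ≤ ∫⁻ u, B * (144 * φ u) ∂areaMeasure := by
        refine lintegral_mono fun u => ?_
        gcongr
        exact tsum_indicator_boxNhd_le u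
    _ = B * 144 * energy p α f := by
        rw [lintegral_const_mul _ (hφm.const_mul _), lintegral_const_mul _ hφm, energy]
        ring

/-! ### Pointwise bounds -/

theorem one_sub_norm_sq_pos {z : ℂ} (hz : z ∈ disk) : 0 < 1 - ‖z‖ ^ 2 := by
  have := mem_disk.1 hz
  nlinarith [norm_nonneg z]

theorem ofReal_weight_rpow {z : ℂ} (hz : z ∈ disk) (α : ℝ) :
    ENNReal.ofReal ((1 - ‖z‖ ^ 2) ^ α) = ENNReal.ofReal (1 - ‖z‖ ^ 2) ^ α :=
  (ENNReal.ofReal_rpow_of_pos (one_sub_norm_sq_pos hz)).symm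

theorem ae_mem_disk : ∀ᵐ z ∂areaMeasure, z ∈ disk :=
  Measure.ae_smul_measure (ae_restrict_mem isOpen_disk.measurableSet) _

instance : IsFiniteMeasure areaMeasure := by
  unfold areaMeasure
  have : IsFiniteMeasure ((volume : Measure ℂ).restrict disk) :=
    ⟨by rw [Measure.restrict_apply_univ]; exact measure_ball_lt_top⟩
  exact Measure.smul_finite _ ENNReal.ofReal_ne_top

theorem measurable_weight (α : ℝ) :
    Measurable fun z : ℂ => ENNReal.ofReal ((1 - ‖z‖ ^ 2) ^ α) :=
  ENNReal.measurable_ofReal.comp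
    ((measurable_const.sub (measurable_norm.pow_const 2)).pow_const α)

theorem measurable_energyDensity (p α : ℝ) (f : ℂ → ℂ) :
    Measurable fun z : ℂ => ‖deriv f z‖ₑ ^ p * ENNReal.ofReal ((1 - ‖z‖ ^ 2) ^ α) :=
  ((measurable_deriv f).enorm.pow_const p).mul (measurable_weight α)

theorem add_rpow_le_two_rpow_mul {q : ℝ} (hq : 0 < q) (a b : ℝ≥0∞) :
    (a + b) ^ q ≤ 2 ^ q * (a ^ q + b ^ q) := by
  calc (a + b) ^ q ≤ (2 * max a b) ^ q := by
        gcongr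
        rw [two_mul]
        exact add_le_add (le_max_left _ _) (le_max_right _ _)
    _ = 2 ^ q * max a b ^ q := ENNReal.mul_rpow_of_nonneg _ _ hq.le
    _ ≤ _ := by
        gcongr
        rcases max_choice a b with h | h <;> rw [h]
        · exact le_self_add
        · exact le_add_self

theorem enorm_apply_zero_le_dirichletNorm {p : ℝ} (hp : 0 < p) (α : ℝ) (f : ℂ → ℂ) :
    ‖f 0‖ₑ ≤ dirichletNorm p α f := by
  rw [dirichletNorm, one_div, ENNReal.le_rpow_inv_iff hp]
  exact le_self_add

theorem energy_le_dirichletNorm_rpow {p : ℝ} (hp : 0 < p) (α : ℝ) (f : ℂ → ℂ) :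
    energy p α f ≤ dirichletNorm p α f ^ p := by
  rw [dirichletNorm, ← ENNReal.rpow_mul, one_div_mul_cancel hp.ne', ENNReal.rpow_one]
  exact le_add_self

theorem energy_rpow_le_dirichletNorm_rpow {p q : ℝ} (hp : 0 < p) (hq : 0 ≤ q) (α : ℝ)
    (f : ℂ → ℂ) : energy p α f ^ (q / p) ≤ dirichletNorm p α f ^ q := by
  calc energy p α f ^ (q / p) ≤ (dirichletNorm p α f ^ p) ^ (q / p) := by
        have : 0 ≤ q / p := div_nonneg hq hp.le
        gcongr
        exact energy_le_dirichletNorm_rpow hp α f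
    _ = _ := by rw [← ENNReal.rpow_mul, mul_div_cancel₀ _ hp.ne']

/-- The growth of the derivative of a function of finite Dirichlet energy. -/
theorem exists_deriv_growth {p : ℝ} (hp : 0 < p) (α : ℝ) :
    ∃ C : ℝ≥0∞, C ≠ ∞ ∧ ∀ f : ℂ → ℂ, DifferentiableOn ℂ f disk → ∀ z ∈ disk,
      ENNReal.ofReal (1 - ‖z‖ ^ 2) ^ (2 + α) * ‖deriv f z‖ₑ ^ p ≤ C * energy p α f := by
  obtain ⟨C, hC, hsub⟩ := exists_submean hp
  refine ⟨16 * C * ENNReal.ofReal (4 ^ |α|) * ENNReal.ofReal Real.pi,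
    ENNReal.mul_ne_top (ENNReal.mul_ne_top (ENNReal.mul_ne_top (by simp) hC)
      ENNReal.ofReal_ne_top) ENNReal.ofReal_ne_top, fun f hf z hz => ?_⟩
  have hz1 := mem_disk.1 hz
  -- With this radius `1 - ‖u‖` stays in `[R, 3R]` on the ball, so the weight is comparable to its
  -- value at the centre.
  set R : ℝ := (1 - ‖z‖) / 2 with hR
  have hR0 : 0 < R := by rw [hR]; linarith
  have hx0 := one_sub_norm_sq_pos hz
  set X := ENNReal.ofReal (1 - ‖z‖ ^ 2) with hX
  have hX0 : X ≠ 0 := by simpa [hX] using hx0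
  have hXt : X ≠ ∞ := ENNReal.ofReal_ne_top
  have hn := norm_nonneg z
  have hballu : ∀ u ∈ Metric.ball z R, R ≤ 1 - ‖u‖ ∧ 1 - ‖u‖ ≤ 3 * R := by
    intro u hu
    rw [Metric.mem_ball, dist_eq_norm] at hu
    have h1 := abs_le.1 (abs_norm_sub_norm_le u z)
    constructor <;> linarith [h1.1, h1.2]
  have hball : Metric.ball z R ⊆ disk := fun u hu => by
    rw [mem_disk]
    linarith [(hballu u hu).1]
  set φ : ℂ → ℝ≥0∞ := fun z => ‖deriv f z‖ₑ ^ p * ENNReal.ofReal ((1 - ‖z‖ ^ 2) ^ α) with hφ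
  have hφm : Measurable φ := measurable_energyDensity p α f
  have h1 := hsub (deriv f) (measurable_deriv f) z R hR0 ((hf.deriv isOpen_disk).mono hball)
  calc X ^ (2 + α) * ‖deriv f z‖ₑ ^ p
      ≤ X ^ α * (16 * (ENNReal.ofReal (R ^ 2) * ‖deriv f z‖ₑ ^ p)) := by
        rw [add_comm, ENNReal.rpow_add _ _ hX0 hXt, ENNReal.rpow_two, mul_assoc,
          ← mul_assoc 16]
        gcongr X ^ α * (?_ * _)
        rw [hX, ← ENNReal.ofReal_pow hx0.le, ← ENNReal.ofReal_ofNat 16,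
          ← ENNReal.ofReal_mul (by norm_num)]
        apply ENNReal.ofReal_le_ofReal
        have : 1 - ‖z‖ ^ 2 ≤ 4 * R := by rw [hR]; nlinarith
        nlinarith
    _ ≤ X ^ α * (16 * (C * ∫⁻ u in Metric.ball z R, ‖deriv f u‖ₑ ^ p)) := by
        gcongr X ^ α * (16 * ?_)
    _ = 16 * C * ∫⁻ u in Metric.ball z R, X ^ α * ‖deriv f u‖ₑ ^ p := by
        rw [lintegral_const_mul _ ((measurable_deriv f).enorm.pow_const p)]
        ring
    _ ≤ 16 * C * ∫⁻ u in Metric.ball z R, ENNReal.ofReal (4 ^ |α|) * φ u := by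
        gcongr 16 * C * ?_
        refine setLIntegral_mono' measurableSet_ball fun u hu => ?_
        obtain ⟨hu1, hu2⟩ := hballu u hu
        have hnu := norm_nonneg u
        have hu0 := one_sub_norm_sq_pos (hball hu)
        have h2 : X ^ α ≤ ENNReal.ofReal (4 ^ |α|) * ENNReal.ofReal ((1 - ‖u‖ ^ 2) ^ α) := by
          rw [hX, ENNReal.ofReal_rpow_of_pos hx0, ← ENNReal.ofReal_mul (by positivity)]
          refine ENNReal.ofReal_le_ofReal (rpow_le_four_rpow_abs_mul hx0 hu0 ?_ ?_)
          · nlinarith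
          · nlinarith
        calc X ^ α * ‖deriv f u‖ₑ ^ p ≤ ENNReal.ofReal (4 ^ |α|) *
            ENNReal.ofReal ((1 - ‖u‖ ^ 2) ^ α) * ‖deriv f u‖ₑ ^ p := by gcongr
          _ = _ := by simp only [hφ]; ring
    _ = 16 * C * ENNReal.ofReal (4 ^ |α|) * ∫⁻ u in Metric.ball z R, φ u := by
        rw [lintegral_const_mul _ hφm]
        ring
    _ ≤ 16 * C * ENNReal.ofReal (4 ^ |α|) * ∫⁻ u in disk, φ u := by
        gcongr
    _ = _ := by
        rw [← ofReal_pi_mul_lintegral_areaMeasure, energy]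
        ring

/-- The asymptotic bound holds only in an annulus near the circle; on the remaining compact disk it
follows from continuity of `g`. -/
theorem GrowthBigO.exists_bound {g : ℂ → ℂ} {γ : ℝ} (h : GrowthBigO g γ)
    (hg : DifferentiableOn ℂ g disk) :
    ∃ M : ℝ, 0 ≤ M ∧ ∀ z ∈ disk, ‖g z‖ ≤ M * (1 - ‖z‖ ^ 2) ^ γ := by
  obtain ⟨M, hM⟩ := h.bound
  rw [eventually_comap, eventually_nhdsWithin_iff, Metric.eventually_nhds_iff] at hM
  obtain ⟨ε, hε, hM⟩ := hM
  set ρ := 1 - min (ε / 2) 1 with hρ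
  have hm1 := min_le_left (ε / 2) 1
  have hm2 : 0 < min (ε / 2) 1 := lt_min (by linarith) one_pos
  have hcont : ContinuousOn (fun z => ‖g z‖ * (1 - ‖z‖ ^ 2) ^ (-γ)) (Metric.closedBall 0 ρ) := by
    have hsub : Metric.closedBall (0 : ℂ) ρ ⊆ disk :=
      Metric.closedBall_subset_ball (by linarith)
    refine ((hg.continuousOn.mono hsub).norm).mul ?_
    refine ContinuousOn.rpow_const (by fun_prop) fun z hz => .inl ?_
    exact (one_sub_norm_sq_pos (hsub hz)).ne'
  obtain ⟨B, hB⟩ := (isCompact_closedBall _ _).exists_bound_of_continuousOn hcont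
  refine ⟨max (max M B) 0, le_max_right _ _, fun z hz => ?_⟩
  have hx0 := one_sub_norm_sq_pos hz
  have hxγ : 0 < (1 - ‖z‖ ^ 2) ^ γ := Real.rpow_pos_of_pos hx0 γ
  rcases le_or_gt ‖z‖ ρ with hle | hgt
  · have h1 := (le_abs_self _).trans (hB z (by simpa using hle))
    rw [Real.rpow_neg hx0.le, ← div_eq_mul_inv, div_le_iff₀ hxγ] at h1
    refine h1.trans ?_
    gcongr
    exact (le_max_right _ _).trans (le_max_left _ _)
  · have hz1 := mem_disk.1 hz
    have h1 := hM (y := ‖z‖) (by rw [Real.dist_eq, abs_lt]; constructor <;> linarith) hz1 z rfl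
    rw [Real.norm_of_nonneg hxγ.le] at h1
    refine h1.trans ?_
    gcongr
    exact (le_max_left _ _).trans (le_max_left _ _)

theorem growthBigO_of_bound {g : ℂ → ℂ} {γ M : ℝ}
    (h : ∀ z ∈ disk, ‖g z‖ ≤ M * (1 - ‖z‖ ^ 2) ^ γ) : GrowthBigO g γ := by
  refine IsBigO.of_bound M ?_
  rw [eventually_comap]
  filter_upwards [self_mem_nhdsWithin] with r hr z hz
  have hzd : z ∈ disk := mem_disk.2 (hz ▸ hr)
  rw [Real.norm_of_nonneg (Real.rpow_nonneg (one_sub_norm_sq_pos hzd).le γ)]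
  exact h z hzd

/-- The part `g f'` of the derivative of the product. -/
theorem exists_lintegral_mul_deriv_le {p q α β : ℝ} (hp : 0 < p) (hpq : p < q) {g : ℂ → ℂ}
    {M : ℝ} (hM0 : 0 ≤ M)
    (hM : ∀ z ∈ disk, ‖g z‖ ≤ M * (1 - ‖z‖ ^ 2) ^ ((2 + α) / p - (2 + β) / q)) :
    ∃ C : ℝ≥0∞, C ≠ ∞ ∧ ∀ f : ℂ → ℂ, DifferentiableOn ℂ f disk →
      ∫⁻ z, ‖g z * deriv f z‖ₑ ^ q * ENNReal.ofReal ((1 - ‖z‖ ^ 2) ^ β) ∂areaMeasure ≤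
        C * energy p α f ^ (q / p) := by
  obtain ⟨C, hC, hgrow⟩ := exists_deriv_growth hp α
  have hq : 0 < q := hp.trans hpq
  have hr : 0 ≤ (q - p) / p := div_nonneg (by linarith) hp.le
  refine ⟨ENNReal.ofReal M ^ q * C ^ ((q - p) / p), ENNReal.mul_ne_top
    (ENNReal.rpow_ne_top_of_nonneg hq.le ENNReal.ofReal_ne_top)
    (ENNReal.rpow_ne_top_of_nonneg hr hC), fun f hf => ?_⟩
  set E := energy p α f with hE
  set γ := (2 + α) / p - (2 + β) / q with hγ
  have hpt : ∀ z ∈ disk, ‖g z * deriv f z‖ₑ ^ q * ENNReal.ofReal ((1 - ‖z‖ ^ 2) ^ β) ≤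
      ENNReal.ofReal M ^ q * (C * E) ^ ((q - p) / p) *
        (‖deriv f z‖ₑ ^ p * ENNReal.ofReal ((1 - ‖z‖ ^ 2) ^ α)) := by
    intro z hz
    rw [ofReal_weight_rpow hz, ofReal_weight_rpow hz]
    have hx0 := one_sub_norm_sq_pos hz
    set X := ENNReal.ofReal (1 - ‖z‖ ^ 2) with hX
    have hX0 : X ≠ 0 := by simpa [hX] using hx0
    have hXt : X ≠ ∞ := ENNReal.ofReal_ne_top
    have hgz : ‖g z‖ₑ ≤ ENNReal.ofReal M * X ^ γ := by
      rw [← ofReal_norm, hX, ← ofReal_weight_rpow hz, ← ENNReal.ofReal_mul hM0]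
      exact ENNReal.ofReal_le_ofReal (hM z hz)
    have hX2 : X ^ (2 + α) ≠ 0 := (ENNReal.rpow_pos (pos_iff_ne_zero.2 hX0) hXt).ne'
    have hX2t : X ^ (2 + α) ≠ ∞ := ENNReal.rpow_ne_top_of_ne_zero hX0 hXt
    have hf1 : ‖deriv f z‖ₑ ^ p ≤ C * E * X ^ (-(2 + α)) := by
      rw [ENNReal.rpow_neg, ← div_eq_mul_inv, ENNReal.le_div_iff_mul_le (.inl hX2) (.inl hX2t),
        mul_comm]
      exact hgrow f hf z hz
    have hf2 : ‖deriv f z‖ₑ ^ q ≤ ‖deriv f z‖ₑ ^ p *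
        ((C * E) ^ ((q - p) / p) * X ^ (-(2 + α) * ((q - p) / p))) := by
      calc ‖deriv f z‖ₑ ^ q = ‖deriv f z‖ₑ ^ p * (‖deriv f z‖ₑ ^ p) ^ ((q - p) / p) := by
            rw [← ENNReal.rpow_mul, mul_div_cancel₀ _ hp.ne',
              ← ENNReal.rpow_add_of_nonneg _ _ hp.le (by linarith), add_sub_cancel]
        _ ≤ ‖deriv f z‖ₑ ^ p * (C * E * X ^ (-(2 + α))) ^ ((q - p) / p) := by gcongr
        _ = _ := by rw [ENNReal.mul_rpow_of_nonneg _ _ hr, ← ENNReal.rpow_mul]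
    -- This identity determines the exponent of the growth condition: the powers of `1 - |z|²`
    -- combine to the weight of the `(p, α)` energy.
    have hexp : γ * q + -(2 + α) * ((q - p) / p) + β = α := by
      rw [hγ]
      field_simp
      ring
    calc ‖g z * deriv f z‖ₑ ^ q * X ^ β = ‖g z‖ₑ ^ q * ‖deriv f z‖ₑ ^ q * X ^ β := by
          rw [enorm_mul, ENNReal.mul_rpow_of_nonneg _ _ hq.le]
      _ ≤ (ENNReal.ofReal M * X ^ γ) ^ q * (‖deriv f z‖ₑ ^ p *
          ((C * E) ^ ((q - p) / p) * X ^ (-(2 + α) * ((q - p) / p)))) * X ^ β := by gcongr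
      _ = ENNReal.ofReal M ^ q * (C * E) ^ ((q - p) / p) * (‖deriv f z‖ₑ ^ p *
          (X ^ (γ * q) * X ^ (-(2 + α) * ((q - p) / p)) * X ^ β)) := by
          rw [ENNReal.mul_rpow_of_nonneg _ _ hq.le, ← ENNReal.rpow_mul]
          ring
      _ = _ := by
          rw [← ENNReal.rpow_add _ _ hX0 hXt, ← ENNReal.rpow_add _ _ hX0 hXt, hexp]
  calc _ ≤ ∫⁻ z, ENNReal.ofReal M ^ q * (C * E) ^ ((q - p) / p) *
        (‖deriv f z‖ₑ ^ p * ENNReal.ofReal ((1 - ‖z‖ ^ 2) ^ α)) ∂areaMeasure := by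
        refine lintegral_mono_ae ?_
        filter_upwards [ae_mem_disk] with z hz using hpt z hz
    _ = ENNReal.ofReal M ^ q * (C * E) ^ ((q - p) / p) * E := by
        rw [lintegral_const_mul _ (measurable_energyDensity p α f), hE, energy]
    _ = ENNReal.ofReal M ^ q * C ^ ((q - p) / p) * (E ^ ((q - p) / p) * E ^ (1 : ℝ)) := by
        rw [ENNReal.mul_rpow_of_nonneg _ _ hr, ENNReal.rpow_one]
        ring
    _ = _ := by
        rw [← ENNReal.rpow_add_of_nonneg _ _ hr zero_le_one]
        congr 2
        field_simp
        ring

/-! ### Embeddings of the Dirichlet spaces into `L ^ q (μ)` -/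

/-- The `(p, α)`-Dirichlet space embeds continuously into `L ^ q (μ)`. -/
def EmbedsInto (p α q : ℝ) (μ : Measure ℂ) : Prop :=
  ∃ C : ℝ≥0∞, C ≠ ∞ ∧ ∀ f : ℂ → ℂ, DifferentiableOn ℂ f disk →
    ∫⁻ z, ‖f z‖ₑ ^ q ∂μ ≤ C * dirichletNorm p α f ^ q

/-- Reduces the embedding to the tree: the term `|f(0)|` contributes only the total mass of `μ`. -/
theorem embedsInto_of_branchSum {p α q : ℝ} (hp : 0 < p) (hq : 0 < q) {μ : Measure ℂ}
    [IsFiniteMeasure μ] (hμ : ∀ᵐ z ∂μ, z ∈ disk) {C : ℝ≥0∞} (hC : C ≠ ∞)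
    (h : ∀ f : ℂ → ℂ, DifferentiableOn ℂ f disk →
      ∫⁻ z, branchSum arcIndex level (boxJump f) z ^ q ∂μ ≤ C * energy p α f ^ (q / p)) :
    EmbedsInto p α q μ := by
  refine ⟨2 ^ q * (μ univ + C), ENNReal.mul_ne_top (ENNReal.rpow_ne_top_of_nonneg hq.le (by simp))
    (ENNReal.add_ne_top.2 ⟨measure_ne_top μ _, hC⟩), fun f hf => ?_⟩
  set F := branchSum arcIndex level (boxJump f)
  have hF : Measurable F := measurable_branchSum measurable_arcIndex measurable_level _
  calc ∫⁻ z, ‖f z‖ₑ ^ q ∂μ ≤ ∫⁻ z, 2 ^ q * (‖f 0‖ₑ ^ q + F z ^ q) ∂μ := by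
        refine lintegral_mono_ae ?_
        filter_upwards [hμ] with z hz
        refine le_trans ?_ (add_rpow_le_two_rpow_mul hq _ _)
        gcongr
        exact enorm_le_branchSum hf hz
    _ = 2 ^ q * (‖f 0‖ₑ ^ q * μ univ + ∫⁻ z, F z ^ q ∂μ) := by
        rw [lintegral_const_mul _ (show Measurable fun z => ‖f 0‖ₑ ^ q + F z ^ q from
            measurable_const.add (hF.pow_const q)),
          lintegral_add_left measurable_const, lintegral_const]
    _ ≤ 2 ^ q * (dirichletNorm p α f ^ q * μ univ + C * dirichletNorm p α f ^ q) := by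
        gcongr
        · exact enorm_apply_zero_le_dirichletNorm hp α f
        · exact (h f hf).trans (by gcongr; exact energy_rpow_le_dirichletNorm_rpow hp hq.le α f)
    _ = _ := by ring

theorem tsum_tsum_rpow_le {r : ℝ} (hr : 1 ≤ r) (F : ℕ → ℕ → ℝ≥0∞) :
    ∑' n, ∑' j, F n j ^ r ≤ (∑' n, ∑' j, F n j) ^ r :=
  (ENNReal.tsum_le_tsum fun _ => tsum_rpow_le_rpow_tsum hr _).trans (tsum_rpow_le_rpow_tsum hr _)

theorem tsum_tsum_rpow_le_of_le {p r : ℝ} (hp : 0 < p) (hr : p ≤ r) (F : ℕ → ℕ → ℝ≥0∞) :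
    ∑' n, ∑' j, F n j ^ r ≤ (∑' n, ∑' j, F n j ^ p) ^ (r / p) := by
  refine le_trans (le_of_eq ?_) (tsum_tsum_rpow_le ((one_le_div hp).2 hr) _)
  simp_rw [← ENNReal.rpow_mul, mul_div_cancel₀ _ hp.ne']

theorem branchSum_rpow_le {q : ℝ} (hq0 : 0 < q) (hq1 : q ≤ 1) (b : ℕ → ℕ → ℝ≥0∞) (z : ℂ) :
    branchSum arcIndex level b z ^ q ≤ branchSum arcIndex level (fun n j => b n j ^ q) z :=
  Finset.le_sum_of_subadditive (fun x : ℝ≥0∞ => x ^ q) (ENNReal.zero_rpow_of_pos hq0).le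
    (fun _ _ => ENNReal.rpow_add_le_add_rpow _ _ hq0.le hq1) _ _

/-- The embedding for `p < α + 2`, when the cells have the mass allowed by the Carleson
condition. -/
theorem embedsInto_of_geometric {p α q : ℝ} (hp : 0 < p) (hpq : p < q) (hα : p < α + 2)
    {μ : Measure ℂ} [IsFiniteMeasure μ] (hμ : ∀ᵐ z ∂μ, z ∈ disk) {C : ℝ≥0∞} (hC : C ≠ ∞)
    (h : ∀ n j : ℕ, μ (branchCell arcIndex level n j) ≤
      C * 2 ^ (-((n : ℝ) * ((α + 2 - p) / p * q)))) :
    EmbedsInto p α q μ := by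
  have hq : 0 < q := hp.trans hpq
  obtain ⟨C₁, hC₁, hjump⟩ := exists_tsum_boxJump_le hp α
  set σ := (α + 2 - p) / p with hσ
  have hσ0 : 0 < σ := div_pos (by linarith) hp
  have hqp : 0 ≤ q / p := (div_pos hq hp).le
  -- For `q ≤ 1` the power `x ^ q` is subadditive, so the branch sum can be integrated term by term
  -- without Hölder.
  rcases le_or_gt q 1 with hq1 | hq1
  · refine embedsInto_of_branchSum hp hq hμ (C := C * C₁ ^ (q / p))
      (ENNReal.mul_ne_top hC (ENNReal.rpow_ne_top_of_nonneg hqp hC₁)) fun f hf => ?_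
    calc ∫⁻ z, branchSum arcIndex level (boxJump f) z ^ q ∂μ
        ≤ ∫⁻ z, branchSum arcIndex level (fun n j => boxJump f n j ^ q) z ∂μ :=
          lintegral_mono fun z => branchSum_rpow_le hq hq1 _ z
      _ = ∑' n, ∑' j, boxJump f n j ^ q * μ (branchCell arcIndex level n j) :=
          lintegral_branchSum measurable_arcIndex measurable_level _ _
      _ ≤ ∑' n : ℕ, ∑' j : ℕ, C * (boxJump f n j * 2 ^ (-(n * σ))) ^ q := by
          refine ENNReal.tsum_le_tsum fun n => ENNReal.tsum_le_tsum fun j => ?_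
          calc _ ≤ boxJump f n j ^ q * (C * 2 ^ (-((n : ℝ) * (σ * q)))) := by
                gcongr
                exact h n j
            _ = _ := by
                rw [ENNReal.mul_rpow_of_nonneg _ _ hq.le, ← ENNReal.rpow_mul,
                  show -((n : ℝ) * σ) * q = -(n * (σ * q)) by ring]
                ring
      _ = C * ∑' n : ℕ, ∑' j : ℕ, (boxJump f n j * 2 ^ (-(n * σ))) ^ q := by
          simp_rw [ENNReal.tsum_mul_left]
      _ ≤ C * (C₁ * energy p α f) ^ (q / p) := by
          gcongr C * ?_
          refine (tsum_tsum_rpow_le_of_le hp hpq.le _).trans ?_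
          gcongr
          exact hjump f hf
      _ = _ := by rw [ENNReal.mul_rpow_of_nonneg _ _ hqp, mul_assoc]
  -- Since `p ≤ 1` is allowed and Hölder needs an exponent above 1, the tree inequality is used with
  -- some `s` satisfying `p ≤ s`, `1 < s < q`; passing from `ℓ^p` to `ℓ^s` costs nothing.
  · set s := max p ((1 + q) / 2) with hs
    have hs1 : 1 < s := lt_max_of_lt_right (by linarith)
    have hs0 : 0 < s := by linarith
    have hsq : s < q := max_lt hpq (by linarith)
    have hconj := Real.HolderConjugate.conjExponent hs1
    obtain ⟨K, hK, hKt⟩ := exists_kernel_bound_geometric hconj hsq hσ0 C hC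
    have hqs' : 0 ≤ q / s.conjExponent := (div_pos hq hconj.symm.pos).le
    have hqs : 0 ≤ q / s := (div_pos hq hs0).le
    refine embedsInto_of_branchSum hp hq hμ (C := 4 ^ q * K ^ (q / s.conjExponent) * C₁ ^ (q / p))
      (ENNReal.mul_ne_top (ENNReal.mul_ne_top (ENNReal.rpow_ne_top_of_nonneg hq.le (by simp))
        (ENNReal.rpow_ne_top_of_nonneg hqs' hK)) (ENNReal.rpow_ne_top_of_nonneg hqp hC₁))
      fun f hf => ?_
    refine (branchSum_strong_type measurable_arcIndex measurable_level arcIndex_succ_div_two hconj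
      hsq.le (w := fun n => 2 ^ (-((n : ℝ) * σ)))
      (fun n => (ENNReal.rpow_pos (by simp) (by simp)).ne')
      (fun n => ENNReal.rpow_ne_top_of_ne_zero (by simp) (by simp)) h hKt (boxJump f)
      (boxJump_ne_top hf)).trans ?_
    rw [mul_assoc _ (C₁ ^ _)]
    gcongr _ * ?_
    calc _ ≤ ((C₁ * energy p α f) ^ (s / p)) ^ (q / s) := by
          gcongr
          refine (tsum_tsum_rpow_le_of_le hp (le_max_left _ _) _).trans ?_
          have : 0 ≤ s / p := (div_pos hs0 hp).le
          gcongr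
          exact hjump f hf
      _ = _ := by
          rw [← ENNReal.rpow_mul, ← ENNReal.mul_rpow_of_nonneg _ _ hqp]
          congr 1
          field_simp

/-- The embedding for `p = α + 2`, under the logarithmic mass condition. -/
theorem embedsInto_of_log {p q : ℝ} (hp : 1 < p) (hpq : p < q)
    {μ : Measure ℂ} [IsFiniteMeasure μ] (hμ : ∀ᵐ z ∂μ, z ∈ disk) {C : ℝ≥0∞} (hC : C ≠ ∞)
    (h : ∀ n j : ℕ, μ (branchCell arcIndex level n j) ≤
      C * ((n : ℝ≥0∞) + 1) ^ ((1 / p - 1) * q)) :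
    EmbedsInto p (p - 2) q μ := by
  have hp0 : 0 < p := by linarith
  have hq : 0 < q := hp0.trans hpq
  obtain ⟨C₁, hC₁, hjump⟩ := exists_tsum_boxJump_le hp0 (p - 2)
  have hqp : 0 ≤ q / p := (div_pos hq hp0).le
  have hconj := Real.HolderConjugate.conjExponent hp
  obtain ⟨K, hK, hKt⟩ := exists_kernel_bound_log hconj hpq C hC
  have hqs' : 0 ≤ q / p.conjExponent := (div_pos hq hconj.symm.pos).le
  have hexp : (1 / p - 1) * q = -(q / p.conjExponent) := by
    have := hconj.inv_add_inv_eq_one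
    rw [div_eq_mul_inv q, one_div, show p⁻¹ - 1 = -(p.conjExponent)⁻¹ by linarith]
    ring
  rw [hexp] at h
  refine embedsInto_of_branchSum hp0 hq hμ (C := 4 ^ q * K ^ (q / p.conjExponent) * C₁ ^ (q / p))
    (ENNReal.mul_ne_top (ENNReal.mul_ne_top (ENNReal.rpow_ne_top_of_nonneg hq.le (by simp))
      (ENNReal.rpow_ne_top_of_nonneg hqs' hK)) (ENNReal.rpow_ne_top_of_nonneg hqp hC₁))
    fun f hf => ?_
  -- Here `α + 2 - p = 0`, so the weights on the jumps are identically 1.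
  refine (branchSum_strong_type measurable_arcIndex measurable_level arcIndex_succ_div_two hconj
    hpq.le (w := fun _ => 1) (by simp) (by simp) h hKt (boxJump f) (boxJump_ne_top hf)).trans ?_
  rw [mul_assoc _ (C₁ ^ _), ← ENNReal.mul_rpow_of_nonneg _ _ hqp]
  gcongr _ * ?_ ^ _
  simpa using hjump f hf

/-- The embedding for `p > α + 2`. -/
theorem embedsInto_of_lt {p α q : ℝ} (hp : 0 < p) (hq : 0 < q) (hα : α + 2 < p)
    {μ : Measure ℂ} [IsFiniteMeasure μ] (hμ : ∀ᵐ z ∂μ, z ∈ disk) : EmbedsInto p α q μ := by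
  obtain ⟨C₁, hC₁, hjump⟩ := exists_tsum_boxJump_le hp α
  set σ := (α + 2 - p) / p with hσ
  have hσ0 : σ < 0 := div_neg_of_neg_of_pos (by linarith) hp
  have hqp : 0 ≤ q / p := (div_pos hq hp).le
  set G := ∑' n : ℕ, ((2 : ℝ≥0∞) ^ σ) ^ n with hG
  have hGt : G ≠ ∞ := by
    have hr : (2 : ℝ≥0∞) ^ σ < 1 := ENNReal.rpow_lt_one_of_one_lt_of_neg (by norm_num) hσ0
    rw [hG, ENNReal.tsum_geometric]
    exact ENNReal.inv_ne_top.2 (tsub_pos_of_lt hr).ne'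
  refine embedsInto_of_branchSum hp hq hμ (C := G ^ q * C₁ ^ (q / p) * μ univ)
    (ENNReal.mul_ne_top (ENNReal.mul_ne_top (ENNReal.rpow_ne_top_of_nonneg hq.le hGt)
      (ENNReal.rpow_ne_top_of_nonneg hqp hC₁)) (measure_ne_top μ _)) fun f hf => ?_
  -- Dropping all but one term of the jump estimate gives geometric decay, since `σ < 0`; hence the
  -- branch sums are uniformly bounded.
  have hb : ∀ n j : ℕ, boxJump f n j ≤ ((2 : ℝ≥0∞) ^ σ) ^ n * (C₁ * energy p α f) ^ (1 / p) := by
    intro n j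
    have h1 : (boxJump f n j * (2 : ℝ≥0∞) ^ (-(n * σ))) ^ p ≤ C₁ * energy p α f :=
      (ENNReal.le_tsum j).trans ((ENNReal.le_tsum n).trans (hjump f hf))
    rw [← ENNReal.le_rpow_inv_iff hp, ← one_div] at h1
    calc boxJump f n j = ((2 : ℝ≥0∞) ^ σ) ^ n * (boxJump f n j * (2 : ℝ≥0∞) ^ (-(n * σ))) := by
          rw [mul_left_comm, ← ENNReal.rpow_natCast, ← ENNReal.rpow_mul,
            ← ENNReal.rpow_add _ _ (by simp) (by simp), mul_comm σ, add_neg_cancel,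
            ENNReal.rpow_zero, mul_one]
      _ ≤ _ := by gcongr
  have hF : ∀ z, branchSum arcIndex level (boxJump f) z ≤ G * (C₁ * energy p α f) ^ (1 / p) := by
    intro z
    calc branchSum arcIndex level (boxJump f) z
        ≤ ∑ n ∈ Finset.range (level z + 1),
            ((2 : ℝ≥0∞) ^ σ) ^ n * (C₁ * energy p α f) ^ (1 / p) :=
          Finset.sum_le_sum fun n _ => hb n _
      _ ≤ _ := by
          rw [← Finset.sum_mul]
          gcongr
          exact ENNReal.sum_le_tsum _
  calc ∫⁻ z, branchSum arcIndex level (boxJump f) z ^ q ∂μ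
      ≤ ∫⁻ _, (G * (C₁ * energy p α f) ^ (1 / p)) ^ q ∂μ :=
        lintegral_mono fun z => by
          have := hF z
          gcongr
    _ = G ^ q * C₁ ^ (q / p) * μ univ * energy p α f ^ (q / p) := by
        rw [lintegral_const, ENNReal.mul_rpow_of_nonneg _ _ hq.le, ← ENNReal.rpow_mul,
          one_div_mul_eq_div, ENNReal.mul_rpow_of_nonneg _ _ hqp]
        ring

/-! ### Sufficiency -/

theorem measurable_symbolDensity (g : ℂ → ℂ) (q β : ℝ) :
    Measurable fun z : ℂ => ENNReal.ofReal ((1 - ‖z‖ ^ 2) ^ β) * ‖deriv g z‖ₑ ^ q :=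
  (measurable_weight β).mul ((measurable_deriv g).enorm.pow_const q)

theorem ae_symbolMeasure_mem_disk (g : ℂ → ℂ) (q β : ℝ) :
    ∀ᵐ z ∂symbolMeasure g q β, z ∈ disk :=
  (withDensity_absolutelyContinuous _ _).ae_le ae_mem_disk

theorem symbolMeasure_univ (g : ℂ → ℂ) (q β : ℝ) :
    symbolMeasure g q β univ = energy q β g := by
  rw [symbolMeasure, withDensity_apply _ MeasurableSet.univ, Measure.restrict_univ, energy]
  simp_rw [mul_comm]

theorem isFiniteMeasure_symbolMeasure_iff (g : ℂ → ℂ) (q β : ℝ) :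
    IsFiniteMeasure (symbolMeasure g q β) ↔ energy q β g < ∞ := by
  rw [← symbolMeasure_univ]
  exact ⟨fun h => h.measure_univ_lt_top, fun h => ⟨h⟩⟩

theorem mem_dirichletSpace_iff {q β : ℝ} (hq : 0 < q) {g : ℂ → ℂ}
    (hg : DifferentiableOn ℂ g disk) : g ∈ dirichletSpace q β ↔ energy q β g < ∞ := by
  have h1 : ‖g 0‖ₑ ^ q < ∞ := ENNReal.rpow_lt_top_of_nonneg hq.le enorm_ne_top
  have h2 : dirichletNorm q β g = (‖g 0‖ₑ ^ q + energy q β g) ^ (1 / q) := rfl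
  simp only [dirichletSpace, mem_ofPred_eq, hg, true_and, h2]
  rw [ENNReal.rpow_lt_top_iff_of_pos (by positivity), ENNReal.add_lt_top]
  exact and_iff_right h1

theorem aemeasurable_of_differentiableOn {f : ℂ → ℂ} (hf : DifferentiableOn ℂ f disk) :
    AEMeasurable f areaMeasure :=
  (hf.continuousOn.aemeasurable isOpen_disk.measurableSet).smul_measure _

theorem lintegral_symbolMeasure {f : ℂ → ℂ} (hf : DifferentiableOn ℂ f disk) (g : ℂ → ℂ)
    (q β : ℝ) : ∫⁻ z, ‖f z‖ₑ ^ q ∂symbolMeasure g q β =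
      ∫⁻ z, ‖deriv g z * f z‖ₑ ^ q * ENNReal.ofReal ((1 - ‖z‖ ^ 2) ^ β) ∂areaMeasure := by
  rw [symbolMeasure, lintegral_withDensity_eq_lintegral_mul₀
    (measurable_symbolDensity g q β).aemeasurable
    ((aemeasurable_of_differentiableOn hf).enorm.pow_const q)]
  refine lintegral_congr fun z => ?_
  rw [Pi.mul_apply, enorm_mul, ENNReal.mul_rpow_of_ne_top enorm_ne_top enorm_ne_top]
  ring

theorem deriv_mulOp {f g : ℂ → ℂ} (hf : DifferentiableOn ℂ f disk)
    (hg : DifferentiableOn ℂ g disk) {z : ℂ} (hz : z ∈ disk) :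
    deriv (mulOp g f) z = deriv g z * f z + g z * deriv f z :=
  deriv_fun_mul (hg.differentiableAt (isOpen_disk.mem_nhds hz))
    (hf.differentiableAt (isOpen_disk.mem_nhds hz))

/-- In `(g f)' = g' f + g f'` the embedding controls the first term and the growth condition the
second. -/
theorem isBoundedOp_of_embedsInto {p q α β : ℝ} (hp : 0 < p) (hpq : p < q) {g : ℂ → ℂ}
    (hg : DifferentiableOn ℂ g disk) (hgrow : GrowthBigO g ((2 + α) / p - (2 + β) / q))
    (hemb : EmbedsInto p α q (symbolMeasure g q β)) : IsBoundedOp p α q β (mulOp g) := by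
  have hq : 0 < q := hp.trans hpq
  obtain ⟨M, hM0, hM⟩ := hgrow.exists_bound hg
  obtain ⟨C₁, hC₁, h1⟩ := exists_lintegral_mul_deriv_le hp hpq hM0 hM
  obtain ⟨C₂, hC₂, h2⟩ := hemb
  set C : ℝ≥0∞ := ‖g 0‖ₑ ^ q + 2 ^ q * (C₂ + C₁) with hC
  have hCt : C ≠ ∞ := ENNReal.add_ne_top.2 ⟨ENNReal.rpow_ne_top_of_nonneg hq.le enorm_ne_top,
    ENNReal.mul_ne_top (ENNReal.rpow_ne_top_of_nonneg hq.le (by simp))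
      (ENNReal.add_ne_top.2 ⟨hC₂, hC₁⟩)⟩
  have hCt' : C ^ (1 / q) ≠ ∞ := ENNReal.rpow_ne_top_of_nonneg (by positivity) hCt
  have key : ∀ f ∈ dirichletSpace p α,
      dirichletNorm q β (mulOp g f) ≤ C ^ (1 / q) * dirichletNorm p α f := by
    rintro f ⟨hf, -⟩
    set N := dirichletNorm p α f
    have hen : energy q β (mulOp g f) ≤ 2 ^ q * (C₂ + C₁) * N ^ q := by
      have hm : AEMeasurable (fun z => ‖deriv g z * f z‖ₑ ^ q *
          ENNReal.ofReal ((1 - ‖z‖ ^ 2) ^ β)) areaMeasure :=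
        (((measurable_deriv g).aemeasurable.mul
          (aemeasurable_of_differentiableOn hf)).enorm.pow_const q).mul
          (measurable_weight β).aemeasurable
      calc energy q β (mulOp g f)
          ≤ ∫⁻ z, 2 ^ q * (‖deriv g z * f z‖ₑ ^ q * ENNReal.ofReal ((1 - ‖z‖ ^ 2) ^ β) +
              ‖g z * deriv f z‖ₑ ^ q * ENNReal.ofReal ((1 - ‖z‖ ^ 2) ^ β)) ∂areaMeasure := by
            refine lintegral_mono_ae ?_
            filter_upwards [ae_mem_disk] with z hz
            rw [deriv_mulOp hf hg hz, ← add_mul, ← mul_assoc]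
            gcongr
            refine le_trans ?_ (add_rpow_le_two_rpow_mul hq _ _)
            gcongr
            exact enorm_add_le _ _
        _ = 2 ^ q * (∫⁻ z, ‖f z‖ₑ ^ q ∂symbolMeasure g q β +
              ∫⁻ z, ‖g z * deriv f z‖ₑ ^ q * ENNReal.ofReal ((1 - ‖z‖ ^ 2) ^ β) ∂areaMeasure) := by
            rw [lintegral_const_mul' _ _ (ENNReal.rpow_ne_top_of_nonneg hq.le (by simp)),
              lintegral_add_left' hm, lintegral_symbolMeasure hf]
        _ ≤ 2 ^ q * (C₂ * N ^ q + C₁ * N ^ q) := by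
            gcongr
            · exact h2 f hf
            · exact (h1 f hf).trans (by gcongr; exact energy_rpow_le_dirichletNorm_rpow hp hq.le α f)
        _ = _ := by ring
    have hdef : dirichletNorm q β (mulOp g f) =
        (‖mulOp g f 0‖ₑ ^ q + energy q β (mulOp g f)) ^ (1 / q) := rfl
    calc dirichletNorm q β (mulOp g f)
        ≤ (‖g 0‖ₑ ^ q * N ^ q + 2 ^ q * (C₂ + C₁) * N ^ q) ^ (1 / q) := by
          rw [hdef]
          gcongr
          rw [mulOp, enorm_mul, ENNReal.mul_rpow_of_nonneg _ _ hq.le]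
          gcongr
          exact enorm_apply_zero_le_dirichletNorm hp α f
      _ = C ^ (1 / q) * N := by
          rw [← add_mul, ENNReal.mul_rpow_of_nonneg _ _ (by positivity), ← ENNReal.rpow_mul,
            mul_one_div_cancel hq.ne', ENNReal.rpow_one]
  refine ⟨(C ^ (1 / q)).toNNReal, fun f hf => ⟨⟨hg.mul hf.1, ?_⟩, ?_⟩⟩
  · exact (key f hf).trans_lt (ENNReal.mul_lt_top hCt'.lt_top hf.2)
  · rw [ENNReal.coe_toNNReal hCt']
    exact key f hf

/-- The comparison holds only almost everywhere, because branch cells may extend outside the disk.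
-/
theorem measure_branchCell_le {μ : Measure ℂ} (hμ : ∀ᵐ z ∂μ, z ∈ disk) (n j : ℕ) :
    μ (branchCell arcIndex level n j) ≤ μ (carlesonSquare
      (circlePoint '' Ico ((j : ℝ) / 2 ^ n) ((j + 1) / 2 ^ n)) ((1 / 2) ^ n)) := by
  refine measure_mono_ae ?_
  filter_upwards [hμ] with z hz hzc
  exact branchCell_inter_disk_subset n j ⟨hzc, hz⟩

theorem branchCell_zero_zero : branchCell arcIndex level 0 0 = univ := by
  ext z
  simp [branchCell, Nat.lt_one_iff.1 (arcIndex_lt 0 z)]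

theorem IsCarleson.embedsInto {p α q : ℝ} (hp : 0 < p) (hpq : p < q) (hα : p < α + 2)
    {μ : Measure ℂ} (hμ : ∀ᵐ z ∂μ, z ∈ disk) (h : IsCarleson (q * (α + 2 - p) / p) μ) :
    EmbedsInto p α q μ := by
  obtain ⟨C, hC0, hC⟩ := h
  have hcell : ∀ n j : ℕ, μ (branchCell arcIndex level n j) ≤
      ENNReal.ofReal C * 2 ^ (-((n : ℝ) * ((α + 2 - p) / p * q))) := by
    intro n j
    refine (measure_branchCell_le hμ n j).trans ((hC _ _ (isArc_dyadic n j)).trans_eq ?_)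
    rw [two_rpow_neg_mul, ENNReal.ofReal_mul hC0.le, ENNReal.ofReal_rpow_of_pos (by positivity)]
    congr 3
    ring
  -- The root cell is the whole plane, so the Carleson condition for a full arc bounds the total
  -- mass.
  have : IsFiniteMeasure μ := ⟨by
    rw [← branchCell_zero_zero]
    refine (hcell 0 0).trans_lt (ENNReal.mul_lt_top ENNReal.ofReal_lt_top ?_)
    simp⟩
  exact embedsInto_of_geometric hp hpq hα hμ ENNReal.ofReal_ne_top hcell

/-- For negative `t` the full arc gives no information. Instead, the squares over the two half
circles cover `|z| ≥ 1/2`, and on the compact disk `|z| ≤ 1/2` the density is bounded. -/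
theorem IsLogCarleson.isFiniteMeasure {t : ℝ} {g : ℂ → ℂ} (hg : DifferentiableOn ℂ g disk)
    {q β : ℝ} (hq : 0 < q) (h : IsLogCarleson t (symbolMeasure g q β)) :
    IsFiniteMeasure (symbolMeasure g q β) := by
  set μ := symbolMeasure g q β with hμ
  have hμd := ae_symbolMeasure_mem_disk g q β
  obtain ⟨C, hC0, hC⟩ := h
  have hcell : ∀ j : ℕ, μ (branchCell arcIndex level 1 j) < ∞ := by
    intro j
    refine ((measure_branchCell_le hμd 1 j).trans (hC _ _ (isArc_dyadic 1 j))).trans_lt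
      (ENNReal.mul_lt_top ENNReal.ofReal_lt_top
        (ENNReal.rpow_ne_top_of_ne_zero ?_ ENNReal.ofReal_ne_top).lt_top)
    simpa using Real.log_pos (by norm_num : (1 : ℝ) < 2)
  have hball : μ (Metric.closedBall 0 (1 / 2)) < ∞ := by
    have hsub : Metric.closedBall (0 : ℂ) (1 / 2) ⊆ disk :=
      Metric.closedBall_subset_ball (by norm_num)
    have hcont : ContinuousOn (fun z => (1 - ‖z‖ ^ 2) ^ β * ‖deriv g z‖ ^ q)
        (Metric.closedBall 0 (1 / 2)) := by
      refine ContinuousOn.mul (ContinuousOn.rpow_const (by fun_prop) fun z hz => .inl ?_)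
        (ContinuousOn.rpow_const ?_ fun z hz => .inr hq.le)
      · exact (one_sub_norm_sq_pos (hsub hz)).ne'
      · exact ((hg.deriv isOpen_disk).continuousOn.mono hsub).norm
    obtain ⟨B, hB⟩ := (isCompact_closedBall _ _).exists_bound_of_continuousOn hcont
    rw [hμ, symbolMeasure, withDensity_apply _ measurableSet_closedBall]
    calc _ ≤ ∫⁻ _ in Metric.closedBall (0 : ℂ) (1 / 2), ENNReal.ofReal B ∂areaMeasure := by
          refine setLIntegral_mono' measurableSet_closedBall fun z hz => ?_
          rw [← ofReal_norm, ENNReal.ofReal_rpow_of_nonneg (norm_nonneg _) hq.le,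
            ← ENNReal.ofReal_mul (Real.rpow_nonneg (one_sub_norm_sq_pos (hsub hz)).le _)]
          exact ENNReal.ofReal_le_ofReal ((le_abs_self _).trans (hB z hz))
      _ < ∞ := by
          rw [setLIntegral_const]
          exact ENNReal.mul_lt_top ENNReal.ofReal_lt_top (measure_lt_top _ _)
  refine ⟨?_⟩
  have hcover : ∀ᵐ z ∂μ, z ∈ (univ : Set ℂ) → z ∈ Metric.closedBall (0 : ℂ) (1 / 2) ∪
      (branchCell arcIndex level 1 0 ∪ branchCell arcIndex level 1 1) := by
    filter_upwards [hμd] with z hz _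
    rcases le_or_gt ‖z‖ (1 / 2) with h1 | h1
    · left
      simpa using h1
    · right
      have hl : 1 ≤ level z := (le_level_iff hz 1).2 (by norm_num; linarith)
      have ha := arcIndex_lt 1 z
      rcases (by omega : arcIndex 1 z = 0 ∨ arcIndex 1 z = 1) with h2 | h2
      · exact .inl ⟨hl, h2⟩
      · exact .inr ⟨hl, h2⟩
  refine (measure_mono_ae hcover).trans_lt ((measure_union_le _ _).trans_lt ?_)
  exact ENNReal.add_lt_top.2 ⟨hball, (measure_union_le _ _).trans_lt
    (ENNReal.add_lt_top.2 ⟨hcell 0, hcell 1⟩)⟩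

theorem IsLogCarleson.embedsInto {p q : ℝ} (hp : 1 < p) (hpq : p < q)
    {μ : Measure ℂ} [IsFiniteMeasure μ] (hμ : ∀ᵐ z ∂μ, z ∈ disk)
    (h : IsLogCarleson ((1 / p - 1) * q) μ) : EmbedsInto p (p - 2) q μ := by
  obtain ⟨C, hC0, hC⟩ := h
  have hlog := Real.log_pos (by norm_num : (1 : ℝ) < 2)
  obtain ⟨r, hr0, hr⟩ : ∃ r, 0 ≤ r ∧ (1 / p - 1) * q = -r := by
    refine ⟨(1 - 1 / p) * q, mul_nonneg ?_ (by linarith), by ring⟩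
    rw [sub_nonneg, div_le_one (by linarith)]
    exact hp.le
  set L := ENNReal.ofReal (Real.log 2 / 2) with hL
  have hL0 : L ≠ 0 := by simpa [hL] using hlog
  refine embedsInto_of_log (C := max (μ univ) (ENNReal.ofReal C * L ^ (-r))) hp hpq hμ
    (max_lt (measure_lt_top μ _) (ENNReal.mul_lt_top ENNReal.ofReal_lt_top
      (ENNReal.rpow_ne_top_of_ne_zero hL0 ENNReal.ofReal_ne_top).lt_top)).ne fun n j => ?_
  rw [hr] at hC ⊢
  -- The root has `log (1 / l) = 0`, so its cell is bounded by the total mass; for `n ≥ 1` one uses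
  -- `n log 2 ≥ (n + 1) (log 2) / 2`.
  rcases Nat.eq_zero_or_pos n with rfl | hn
  · simp only [Nat.cast_zero, zero_add, ENNReal.one_rpow, mul_one]
    exact (measure_mono (subset_univ _)).trans (le_max_left _ _)
  · have hn1 : (1 : ℝ) ≤ n := by exact_mod_cast hn
    refine (measure_branchCell_le hμ n j).trans ((hC _ _ (isArc_dyadic n j)).trans ?_)
    calc ENNReal.ofReal C * ENNReal.ofReal (Real.log (1 / (1 / 2) ^ n)) ^ (-r)
        ≤ ENNReal.ofReal C * (L * ((n : ℝ≥0∞) + 1)) ^ (-r) := by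
          gcongr ENNReal.ofReal C * ?_
          refine ennreal_rpow_neg_le_rpow_neg hr0 ?_
          rw [hL, ← ENNReal.ofReal_natCast, ← ENNReal.ofReal_one, ← ENNReal.ofReal_add
            (by positivity) (by norm_num), ← ENNReal.ofReal_mul (by positivity)]
          apply ENNReal.ofReal_le_ofReal
          rw [one_div_pow, one_div_one_div, Real.log_pow]
          nlinarith
      _ = ENNReal.ofReal C * L ^ (-r) * ((n : ℝ≥0∞) + 1) ^ (-r) := by
          rw [ENNReal.mul_rpow_of_ne_top ENNReal.ofReal_ne_top (by simp), mul_assoc]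
      _ ≤ _ := by
          gcongr
          exact le_max_right _ _

/-! ### Integrals of powers of the Szegő kernel -/

/-- Change of variables under an injective holomorphic map. -/
theorem lintegral_image_eq_lintegral_deriv_sq_mul {F F' : ℂ → ℂ} {s : Set ℂ}
    (hs : MeasurableSet s) (hF : ∀ z ∈ s, HasDerivAt F (F' z) z) (hinj : InjOn F s)
    (G : ℂ → ℝ≥0∞) :
    ∫⁻ w in F '' s, G w = ∫⁻ z in s, ENNReal.ofReal (‖F' z‖ ^ 2) * G (F z) := by
  rw [lintegral_image_eq_lintegral_abs_det_fderiv_mul volume hs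
    (fun z hz => ((hF z hz).hasFDerivAt.restrictScalars ℝ).hasFDerivWithinAt) hinj]
  refine lintegral_congr fun z => ?_
  congr 2
  simp [ContinuousLinearMap.det, LinearMap.det_restrictScalars, Algebra.norm_complex_eq,
    Complex.normSq_eq_norm_sq]

theorem lintegral_weight_lt_top {α : ℝ} (hα : -1 < α) :
    ∫⁻ z in disk, ENNReal.ofReal ((1 - ‖z‖ ^ 2) ^ α) < ∞ := by
  rw [disk, setLIntegral_ball_eq_polar (measurable_weight α)]
  have hint : IntegrableOn (fun r : ℝ => 2 ^ |α| * (1 - r) ^ α) (Ioo 0 1) := by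
    have h1 : IntervalIntegrable (fun r : ℝ => (1 - r) ^ α) volume 0 1 := by
      have := (intervalIntegral.intervalIntegrable_rpow' (a := 0) (b := 1) hα).comp_sub_left 1
      simpa using this.symm
    rw [intervalIntegrable_iff_integrableOn_Ioo_of_le zero_le_one] at h1
    exact h1.const_mul _
  calc _ ≤ ∫⁻ r in Ioo (0 : ℝ) 1, ENNReal.ofReal (2 ^ |α| * (1 - r) ^ α) *
        ENNReal.ofReal (2 * Real.pi) := by
        refine setLIntegral_mono' measurableSet_Ioo fun r hr => ?_
        have hr1 : 0 < 1 - r := by linarith [hr.2]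
        have hn : ∀ θ : ℝ, ‖circleMap 0 r θ‖ = r := fun θ => by
          rw [norm_circleMap_zero, abs_of_pos hr.1]
        simp_rw [hn]
        rw [setLIntegral_const, Real.volume_Ioo, ← mul_assoc,
          show Real.pi - -Real.pi = 2 * Real.pi by ring, ← ENNReal.ofReal_mul hr.1.le]
        refine mul_le_mul' (ENNReal.ofReal_le_ofReal ?_) le_rfl
        have h2 : (1 - r ^ 2) ^ α ≤ 2 ^ |α| * (1 - r) ^ α := by
          rw [show 1 - r ^ 2 = (1 + r) * (1 - r) by ring,
            Real.mul_rpow (by linarith [hr.1]) hr1.le]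
          gcongr
          calc (1 + r) ^ α ≤ (1 + r) ^ |α| :=
                Real.rpow_le_rpow_of_exponent_le (by linarith [hr.1]) (le_abs_self α)
            _ ≤ 2 ^ |α| := Real.rpow_le_rpow (by linarith [hr.1]) (by linarith [hr.2])
                (abs_nonneg α)
        have h3 : 0 ≤ (1 - r ^ 2) ^ α := Real.rpow_nonneg (by nlinarith [hr.1, hr.2]) _
        nlinarith [hr.1, hr.2]
    _ < ∞ := by
        rw [lintegral_mul_const' _ _ ENNReal.ofReal_ne_top]
        exact ENNReal.mul_lt_top hint.lintegral_lt_top ENNReal.ofReal_lt_top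

theorem norm_one_sub_conj_mul_sq_sub (a z : ℂ) :
    ‖1 - conj a * z‖ ^ 2 - ‖a - z‖ ^ 2 = (1 - ‖a‖ ^ 2) * (1 - ‖z‖ ^ 2) := by
  simp only [Complex.sq_norm, Complex.normSq_apply, Complex.sub_re, Complex.sub_im, Complex.mul_re,
    Complex.mul_im, Complex.conj_re, Complex.conj_im, Complex.one_re, Complex.one_im]
  ring

theorem one_sub_norm_le_norm_one_sub_conj_mul (a : ℂ) {z : ℂ} (hz : z ∈ disk) :
    1 - ‖a‖ ≤ ‖1 - conj a * z‖ := by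
  have h1 := norm_sub_norm_le (1 : ℂ) (conj a * z)
  rw [norm_one, norm_mul, RCLike.norm_conj] at h1
  nlinarith [norm_nonneg a, mem_disk.1 hz]

theorem norm_one_sub_conj_mul_pos {a z : ℂ} (ha : a ∈ disk) (hz : z ∈ disk) :
    0 < ‖1 - conj a * z‖ :=
  lt_of_lt_of_le (by linarith [mem_disk.1 ha]) (one_sub_norm_le_norm_one_sub_conj_mul a hz)

theorem one_sub_conj_mul_ne_zero {a z : ℂ} (ha : a ∈ disk) (hz : z ∈ disk) :
    1 - conj a * z ≠ 0 := norm_pos_iff.1 (norm_one_sub_conj_mul_pos ha hz)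

theorem hasDerivAt_moebius {a z : ℂ} (ha : a ∈ disk) (hz : z ∈ disk) :
    HasDerivAt (fun z => (a - z) / (1 - conj a * z))
      (-(1 - conj a * a) / (1 - conj a * z) ^ 2) z := by
  have h1 : HasDerivAt (fun z => a - z) (-1) z := (hasDerivAt_id z).const_sub a
  have h2 : HasDerivAt (fun z => 1 - conj a * z) (-(conj a * 1)) z :=
    ((hasDerivAt_id z).const_mul (conj a)).const_sub 1
  rw [show -(1 - conj a * a) = -1 * (1 - conj a * z) - (a - z) * -(conj a * 1) by ring]
  exact h1.div h2 (one_sub_conj_mul_ne_zero ha hz)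

theorem injOn_moebius {a : ℂ} (ha : a ∈ disk) :
    InjOn (fun z => (a - z) / (1 - conj a * z)) disk := by
  intro z hz w hw h
  simp only at h
  rw [div_eq_div_iff (one_sub_conj_mul_ne_zero ha hz) (one_sub_conj_mul_ne_zero ha hw)] at h
  have h1 : (z - w) * (1 - conj a * a) = 0 := by linear_combination -h
  rcases mul_eq_zero.1 h1 with h2 | h2
  · exact sub_eq_zero.1 h2
  · exact absurd h2 (one_sub_conj_mul_ne_zero ha ha)

theorem one_sub_norm_moebius_sq {a z : ℂ} (ha : a ∈ disk) (hz : z ∈ disk) :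
    1 - ‖(a - z) / (1 - conj a * z)‖ ^ 2 =
      (1 - ‖a‖ ^ 2) * (1 - ‖z‖ ^ 2) / ‖1 - conj a * z‖ ^ 2 := by
  have := (norm_one_sub_conj_mul_pos ha hz).ne'
  rw [norm_div, div_pow, ← norm_one_sub_conj_mul_sq_sub, sub_div, div_self (pow_ne_zero 2 this)]

theorem norm_one_sub_conj_mul_self {a : ℂ} (ha : a ∈ disk) :
    ‖1 - conj a * a‖ = 1 - ‖a‖ ^ 2 := by
  rw [Complex.conj_mul', ← Complex.ofReal_pow, ← Complex.ofReal_one, ← Complex.ofReal_sub,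
    Complex.norm_real, Real.norm_of_nonneg (one_sub_norm_sq_pos ha).le]

/-- The integral of a large power of the Szegő kernel. -/
theorem exists_lintegral_kernel_le {α c : ℝ} (hα : -1 < α) (hc : 2 * (2 + α) ≤ c) :
    ∃ C : ℝ≥0∞, C ≠ ∞ ∧ ∀ a ∈ disk,
      ∫⁻ z, ENNReal.ofReal ‖1 - conj a * z‖ ^ (-c) * ENNReal.ofReal ((1 - ‖z‖ ^ 2) ^ α)
        ∂areaMeasure ≤ C * ENNReal.ofReal (1 - ‖a‖ ^ 2) ^ (2 + α - c) := by
  set I := ∫⁻ z in disk, ENNReal.ofReal ((1 - ‖z‖ ^ 2) ^ α) with hI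
  have hIt : I ≠ ∞ := (lintegral_weight_lt_top hα).ne
  set e := c - 2 * (2 + α) with he
  have he0 : 0 ≤ e := by rw [he]; linarith
  refine ⟨ENNReal.ofReal (1 / Real.pi) * ENNReal.ofReal (2 ^ e) * I,
    ENNReal.mul_ne_top (ENNReal.mul_ne_top ENNReal.ofReal_ne_top ENNReal.ofReal_ne_top) hIt,
    fun a ha => ?_⟩
  have hA0 := one_sub_norm_sq_pos ha
  set A := 1 - ‖a‖ ^ 2 with hA
  -- Under the Möbius involution the measure `(1 - |w|²) ^ α dA(w)` pulls back to `A ^ (2 + α) |1 -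
  -- āz| ^ (-2 (2 + α)) (1 - |z|²) ^ α dA(z)`. The excess power `e = c - 2 (2 + α) ≥ 0` of the
  -- kernel is bounded using `|1 - āz| ≥ A / 2`.
  have hpt : ∀ z ∈ disk, ENNReal.ofReal ‖1 - conj a * z‖ ^ (-c) *
      ENNReal.ofReal ((1 - ‖z‖ ^ 2) ^ α) ≤ ENNReal.ofReal (2 ^ e * A ^ (2 + α - c)) *
        (ENNReal.ofReal (‖-(1 - conj a * a) / (1 - conj a * z) ^ 2‖ ^ 2) *
          ENNReal.ofReal ((1 - ‖(a - z) / (1 - conj a * z)‖ ^ 2) ^ α)) := by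
    intro z hz
    have hx0 := norm_one_sub_conj_mul_pos ha hz
    have hz0 := one_sub_norm_sq_pos hz
    have hxA : A / 2 ≤ ‖1 - conj a * z‖ := by
      refine le_trans ?_ (one_sub_norm_le_norm_one_sub_conj_mul a hz)
      rw [hA]
      nlinarith [norm_nonneg a, mem_disk.1 ha]
    rw [one_sub_norm_moebius_sq ha hz, norm_div, norm_neg, norm_one_sub_conj_mul_self ha, norm_pow]
    set x := ‖1 - conj a * z‖
    set y := 1 - ‖z‖ ^ 2
    rw [← hA, ENNReal.ofReal_rpow_of_pos hx0, ← ENNReal.ofReal_mul (by positivity),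
      ← ENNReal.ofReal_mul (by positivity), ← ENNReal.ofReal_mul (by positivity)]
    apply ENNReal.ofReal_le_ofReal
    have h1 : x ^ (-e) ≤ 2 ^ e * A ^ (-e) := by
      calc x ^ (-e) ≤ (A / 2) ^ (-e) :=
            Real.rpow_le_rpow_of_nonpos (by positivity) hxA (by linarith)
        _ = _ := by
            rw [Real.div_rpow hA0.le (by norm_num), Real.rpow_neg (by norm_num : (0 : ℝ) ≤ 2) e,
              div_inv_eq_mul, mul_comm]
    have h2 : (A / x ^ 2) ^ 2 * (A * y / x ^ 2) ^ α = A ^ (2 + α) * x ^ (-(2 * (2 + α))) * y ^ α := by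
      rw [Real.div_rpow (by positivity) (by positivity), Real.mul_rpow hA0.le hz0.le, div_pow,
        Real.rpow_add hA0, Real.rpow_neg hx0.le, Real.rpow_mul hx0.le, Real.rpow_add (by positivity)]
      norm_cast
      have : 0 < x ^ 2 := by positivity
      have : 0 < (x ^ 2) ^ α := by positivity
      field_simp
    rw [h2]
    have h3 : x ^ (-c) = x ^ (-e) * x ^ (-(2 * (2 + α))) := by
      rw [← Real.rpow_add hx0]
      congr 1
      rw [he]
      ring
    have h4 : A ^ (2 + α - c) * A ^ (2 + α) = A ^ (-e) := by
      rw [← Real.rpow_add hA0]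
      congr 1
      rw [he]
      ring
    calc x ^ (-c) * y ^ α = x ^ (-e) * (x ^ (-(2 * (2 + α))) * y ^ α) := by rw [h3]; ring
      _ ≤ 2 ^ e * A ^ (-e) * (x ^ (-(2 * (2 + α))) * y ^ α) := by gcongr
      _ = _ := by rw [← h4]; ring
  have hmaps : (fun z => (a - z) / (1 - conj a * z)) '' disk ⊆ disk := by
    rintro _ ⟨z, hz, rfl⟩
    have h1 := one_sub_norm_moebius_sq ha hz
    have h2 : 0 < (1 - ‖a‖ ^ 2) * (1 - ‖z‖ ^ 2) / ‖1 - conj a * z‖ ^ 2 :=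
      div_pos (mul_pos hA0 (one_sub_norm_sq_pos hz))
        (pow_pos (norm_one_sub_conj_mul_pos ha hz) 2)
    rw [mem_disk]
    simp only
    nlinarith [norm_nonneg ((a - z) / (1 - conj a * z))]
  rw [areaMeasure, lintegral_smul_measure, smul_eq_mul, mul_assoc, mul_assoc]
  gcongr ENNReal.ofReal (1 / Real.pi) * ?_
  calc _ ≤ ∫⁻ z in disk, ENNReal.ofReal (2 ^ e * A ^ (2 + α - c)) *
        (ENNReal.ofReal (‖-(1 - conj a * a) / (1 - conj a * z) ^ 2‖ ^ 2) *
          ENNReal.ofReal ((1 - ‖(a - z) / (1 - conj a * z)‖ ^ 2) ^ α)) :=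
        setLIntegral_mono' isOpen_disk.measurableSet hpt
    _ = ENNReal.ofReal (2 ^ e * A ^ (2 + α - c)) *
          ∫⁻ w in (fun z => (a - z) / (1 - conj a * z)) '' disk,
            ENNReal.ofReal ((1 - ‖w‖ ^ 2) ^ α) := by
        rw [lintegral_const_mul' _ _ ENNReal.ofReal_ne_top,
          lintegral_image_eq_lintegral_deriv_sq_mul isOpen_disk.measurableSet
            (fun z hz => hasDerivAt_moebius ha hz) (injOn_moebius ha)]
    _ ≤ ENNReal.ofReal (2 ^ e * A ^ (2 + α - c)) * I := by
        gcongr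
        exact lintegral_mono_set hmaps
    _ = _ := by
        rw [ENNReal.ofReal_mul (by positivity), ENNReal.ofReal_rpow_of_pos hA0]
        ring

/-- The logarithmic growth of the integral of the critical power of the Szegő kernel. -/
theorem exists_lintegral_kernel_le_log {p : ℝ} (hp : 1 < p) :
    ∃ C : ℝ≥0∞, C ≠ ∞ ∧ ∀ ζ : ℂ, ‖ζ‖ = 1 → ∀ K : ℕ,
      ∫⁻ z, ENNReal.ofReal ‖1 - conj ((1 - (1 / 2) ^ K : ℝ) * ζ) * z‖ ^ (-p) *
        ENNReal.ofReal ((1 - ‖z‖ ^ 2) ^ (p - 2)) ∂areaMeasure ≤ C * ((K : ℝ≥0∞) + 1) := by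
  obtain ⟨C, hC, hker⟩ := exists_lintegral_kernel_le (α := p - 2) (c := 2 * p) (by linarith)
    (by linarith)
  have hp0 : 0 < p := by linarith
  refine ⟨9 ^ p * C, ENNReal.mul_ne_top (ENNReal.rpow_ne_top_of_nonneg hp0.le (by simp)) hC,
    fun ζ hζ K => ?_⟩
  set a : ℂ := (1 - (1 / 2) ^ K : ℝ) * ζ with ha
  -- The exponent `p` is too small for the previous estimate. On the region `|1 - āz| ≈ 2 ^ (-k)`
  -- the kernel is dominated by `2 ^ (-k p) |1 - b̄_k z| ^ (-2 p)`, whose exponent is admissible;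
  -- each of the `K + 1` scales then contributes a bounded amount.
  set b : ℕ → ℂ := fun k => (1 - (1 / 2) ^ k : ℝ) * a with hb
  set D : ℕ → ℝ≥0∞ := fun k => ENNReal.ofReal ((1 / 2) ^ k) with hD
  have hD0 : ∀ k, D k ≠ 0 := fun k => by simp [hD]
  have hDt : ∀ k, D k ≠ ∞ := fun k => ENNReal.ofReal_ne_top
  have hpow0 : ∀ k : ℕ, (0 : ℝ) < (1 / 2) ^ k := fun k => by positivity
  have hpow1 : ∀ k : ℕ, (1 / 2 : ℝ) ^ k ≤ 1 := fun k => pow_le_one₀ (by norm_num) (by norm_num)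
  have hna : ‖a‖ = 1 - (1 / 2) ^ K := by
    rw [ha, norm_mul, hζ, mul_one, Complex.norm_real, Real.norm_of_nonneg (by linarith [hpow1 K])]
  have hnb : ∀ k, ‖b k‖ ≤ 1 - (1 / 2) ^ k := by
    intro k
    simp only [hb]
    rw [norm_mul, Complex.norm_real, Real.norm_of_nonneg (by linarith [hpow1 k]), hna]
    nlinarith [hpow0 K, hpow1 k]
  have hbd : ∀ k, b k ∈ disk := fun k => mem_disk.2 (by linarith [hnb k, hpow0 k])
  have hpt : ∀ z ∈ disk, ENNReal.ofReal ‖1 - conj a * z‖ ^ (-p) ≤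
      9 ^ p * ∑ k ∈ Finset.range (K + 1), D k ^ p *
        ENNReal.ofReal ‖1 - conj (b k) * z‖ ^ (-(2 * p)) := by
    intro z hz
    have hz1 := mem_disk.1 hz
    have hxK : (1 / 2) ^ K ≤ ‖1 - conj a * z‖ := by
      have := one_sub_norm_le_norm_one_sub_conj_mul a hz
      rw [hna] at this
      linarith
    have hx2 : ‖1 - conj a * z‖ ≤ 2 := by
      refine (norm_sub_le _ _).trans ?_
      rw [norm_one, norm_mul, RCLike.norm_conj]
      nlinarith [norm_nonneg a, norm_nonneg z, hpow0 K]
    have hex : ∃ k : ℕ, (1 / 2 : ℝ) ^ k ≤ ‖1 - conj a * z‖ := ⟨K, hxK⟩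
    set k := Nat.find hex with hk
    have hk1 : (1 / 2 : ℝ) ^ k ≤ ‖1 - conj a * z‖ := Nat.find_spec hex
    have hkK : k ≤ K := Nat.find_min' hex hxK
    have hk2 : ‖1 - conj a * z‖ ≤ 2 * (1 / 2) ^ k := by
      rcases Nat.eq_zero_or_pos k with h0 | h0
      · rw [h0]
        simpa using hx2
      · have := Nat.find_min hex (m := k - 1) (by omega)
        rw [not_le] at this
        have e : (1 / 2 : ℝ) ^ k = (1 / 2) ^ (k - 1) * (1 / 2) := by
          rw [← pow_succ]
          congr 1
          omega
        rw [e]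
        linarith
    -- Moving `a` to `b k` changes the denominator by at most `2 ^ (-k)`. The resulting 3, raised to
    -- the power `2 p`, is the constant `9 ^ p`.
    have hbk : ‖1 - conj (b k) * z‖ ≤ 3 * (1 / 2) ^ k := by
      have e : 1 - conj (b k) * z = (1 - conj a * z) + ((1 / 2 : ℝ) ^ k : ℝ) * (conj a * z) := by
        simp only [hb, map_mul, Complex.conj_ofReal]
        push_cast
        ring
      rw [e]
      refine (norm_add_le _ _).trans ?_
      rw [norm_mul, Complex.norm_real, Real.norm_of_nonneg (hpow0 k).le, norm_mul,
        RCLike.norm_conj, hna]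
      have h1 : (1 - (1 / 2) ^ K) * ‖z‖ ≤ 1 := by
        nlinarith [hpow0 K, hpow1 K, norm_nonneg z]
      nlinarith [hpow0 k]
    calc ENNReal.ofReal ‖1 - conj a * z‖ ^ (-p) ≤ D k ^ (-p) :=
          ennreal_rpow_neg_le_rpow_neg hp0.le (ENNReal.ofReal_le_ofReal hk1)
      _ = 9 ^ p * (D k ^ p * (3 * D k) ^ (-(2 * p))) := by
          have h9 : (9 : ℝ≥0∞) ^ p = 3 ^ (2 * p) := by
            rw [ENNReal.rpow_mul]
            norm_num
          rw [ENNReal.mul_rpow_of_ne_top (by simp) (hDt k), h9, mul_left_comm (D k ^ p),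
            ← mul_assoc, ← ENNReal.rpow_add _ _ (by simp) (by simp), add_neg_cancel,
            ENNReal.rpow_zero, one_mul, ← ENNReal.rpow_add _ _ (hD0 k) (hDt k)]
          congr 1
          ring
      _ ≤ 9 ^ p * (D k ^ p * ENNReal.ofReal ‖1 - conj (b k) * z‖ ^ (-(2 * p))) := by
          gcongr 9 ^ p * (D k ^ p * ?_)
          refine ennreal_rpow_neg_le_rpow_neg (by positivity) ?_
          rw [hD, ← ENNReal.ofReal_ofNat 3, ← ENNReal.ofReal_mul (by norm_num)]
          exact ENNReal.ofReal_le_ofReal hbk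
      _ ≤ _ := by
          gcongr
          exact Finset.single_le_sum (f := fun k => D k ^ p *
            ENNReal.ofReal ‖1 - conj (b k) * z‖ ^ (-(2 * p))) (fun _ _ => zero_le)
            (Finset.mem_range.2 (by omega))
  have hmeas : ∀ k, Measurable fun z : ℂ => ENNReal.ofReal ‖1 - conj (b k) * z‖ ^ (-(2 * p)) *
      ENNReal.ofReal ((1 - ‖z‖ ^ 2) ^ (p - 2)) := fun k =>
    ((ENNReal.measurable_ofReal.comp
      (measurable_const.sub (measurable_id.const_mul _)).norm).pow_const _).mul
        (measurable_weight _)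
  calc _ ≤ ∫⁻ z, 9 ^ p * ∑ k ∈ Finset.range (K + 1), D k ^ p *
        (ENNReal.ofReal ‖1 - conj (b k) * z‖ ^ (-(2 * p)) *
          ENNReal.ofReal ((1 - ‖z‖ ^ 2) ^ (p - 2))) ∂areaMeasure := by
        refine lintegral_mono_ae ?_
        filter_upwards [ae_mem_disk] with z hz
        simp_rw [← mul_assoc, ← Finset.sum_mul]
        rw [← mul_assoc]
        gcongr
        exact hpt z hz
    _ = 9 ^ p * ∑ k ∈ Finset.range (K + 1), D k ^ p *
        ∫⁻ z, ENNReal.ofReal ‖1 - conj (b k) * z‖ ^ (-(2 * p)) *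
          ENNReal.ofReal ((1 - ‖z‖ ^ 2) ^ (p - 2)) ∂areaMeasure := by
        rw [lintegral_const_mul _ (Finset.measurable_fun_sum _ fun k _ => (hmeas k).const_mul _),
          lintegral_finsetSum _ fun k _ => (hmeas k).const_mul _]
        congr 1
        exact Finset.sum_congr rfl fun k _ => lintegral_const_mul _ (hmeas k)
    _ ≤ 9 ^ p * ∑ k ∈ Finset.range (K + 1), C := by
        gcongr 9 ^ p * ?_
        refine Finset.sum_le_sum fun k _ => ?_
        calc _ ≤ D k ^ p * (C * D k ^ (-p)) := by
              gcongr D k ^ p * ?_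
              refine (hker (b k) (hbd k)).trans ?_
              gcongr C * ?_
              rw [show 2 + (p - 2) - 2 * p = -p by ring]
              refine ennreal_rpow_neg_le_rpow_neg hp0.le (ENNReal.ofReal_le_ofReal ?_)
              nlinarith [hnb k, norm_nonneg (b k), hpow0 k]
          _ = C := by
              rw [mul_left_comm, ← ENNReal.rpow_add _ _ (hD0 k) (hDt k)]
              simp
    _ = _ := by
        rw [Finset.sum_const, Finset.card_range, nsmul_eq_mul]
        push_cast
        ring

/-! ### Necessity -/

theorem IsArc.length_pos {I : Set ℂ} {l : ℝ} (h : IsArc I l) : 0 < l := by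
  obtain ⟨a, b, J, hab, -, -, -, -, rfl⟩ := h
  have := Real.pi_pos
  exact div_pos (by linarith) (by positivity)

theorem IsArc.length_le_one {I : Set ℂ} {l : ℝ} (h : IsArc I l) : l ≤ 1 := by
  obtain ⟨a, b, J, -, hba, -, -, -, rfl⟩ := h
  have := Real.pi_pos
  rw [div_le_one (by positivity)]
  linarith

theorem IsArc.carlesonSquare_subset_disk {I : Set ℂ} {l : ℝ} (h : IsArc I l) :
    carlesonSquare I l ⊆ disk := by
  have hl := h.length_le_one
  obtain ⟨a, b, J, -, -, -, -, rfl, -⟩ := h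
  rintro _ ⟨r, _, ⟨θ, -, rfl⟩, hr1, hr2, rfl⟩
  rw [mem_disk, norm_mul, Complex.norm_exp_ofReal_mul_I, mul_one, Complex.norm_real,
    Real.norm_of_nonneg (by linarith)]
  exact hr2

/-- The Carleson square over an arc is close to points over the midpoint of the arc. -/
theorem IsArc.exists_norm_le {I : Set ℂ} {l : ℝ} (h : IsArc I l) :
    ∃ ζ : ℂ, ‖ζ‖ = 1 ∧ ∀ δ : ℝ, l ≤ δ → δ ≤ 1 → ∀ z ∈ carlesonSquare I l,
      ‖1 - conj ((1 - δ : ℝ) * ζ) * z‖ ≤ 6 * δ := by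
  have hl0 := h.length_pos
  have hl1 := h.length_le_one
  obtain ⟨a, b, J, hab, -, -, hJ, rfl, hl⟩ := h
  have hpi := Real.pi_pos
  refine ⟨Complex.exp (((a + b) / 2 : ℝ) * Complex.I), Complex.norm_exp_ofReal_mul_I _,
    fun δ hlδ hδ1 => ?_⟩
  rintro _ ⟨r, _, ⟨θ, hθ, rfl⟩, hr1, hr2, rfl⟩
  have hθ' := hJ hθ
  set φ := θ - (a + b) / 2 with hφ
  have e : conj (((1 - δ : ℝ) : ℂ) * Complex.exp (((a + b) / 2 : ℝ) * Complex.I)) *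
      (r * Complex.exp (θ * Complex.I)) =
      (((1 - δ) * r : ℝ) : ℂ) * Complex.exp (Complex.I * φ) := by
    rw [map_mul, Complex.conj_ofReal, ← Complex.exp_conj, map_mul, Complex.conj_I,
      Complex.conj_ofReal, mul_mul_mul_comm, ← Complex.exp_add, hφ]
    push_cast
    congr 2
    ring
  have e2 : 1 - (((1 - δ) * r : ℝ) : ℂ) * Complex.exp (Complex.I * φ) =
      ((1 - (1 - δ) * r : ℝ) : ℂ) -
        (((1 - δ) * r : ℝ) : ℂ) * (Complex.exp (Complex.I * φ) - 1) := by
    push_cast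
    ring
  have hr0 : 0 ≤ r := by linarith
  have hρ0 : 0 ≤ (1 - δ) * r := mul_nonneg (by linarith) hr0
  have hρ1 : (1 - δ) * r ≤ 1 := by nlinarith
  rw [e, e2]
  refine (norm_sub_le _ _).trans ?_
  rw [norm_mul, Complex.norm_real, Complex.norm_real, Real.norm_of_nonneg hρ0,
    Real.norm_of_nonneg (by linarith)]
  have h1 : ‖Complex.exp (Complex.I * φ) - 1‖ ≤ |φ| := by
    simpa using Real.norm_exp_I_mul_ofReal_sub_one_le (x := φ)
  have h2 : |φ| ≤ Real.pi * l := by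
    have : Real.pi * l = (b - a) / 2 := by
      rw [hl]
      field_simp
    rw [this, abs_le, hφ]
    constructor <;> linarith [hθ'.1, hθ'.2]
  -- The 6 is 4 from the angular deviation, at most half the arc, plus 2 from the radial one.
  have h3 : Real.pi * l ≤ 4 * δ := by nlinarith [Real.pi_lt_four]
  have h4 : 1 - (1 - δ) * r ≤ 2 * δ := by nlinarith
  nlinarith [norm_nonneg (Complex.exp (Complex.I * φ) - 1)]

theorem dirichletNorm_rpow {p : ℝ} (α q : ℝ) (f : ℂ → ℂ) :
    dirichletNorm p α f ^ q = (‖f 0‖ₑ ^ p + energy p α f) ^ (q / p) := by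
  rw [dirichletNorm, ← ENNReal.rpow_mul, one_div_mul_eq_div, energy]

theorem IsBoundedOp.exists_energy_le {p q α β : ℝ} (hq : 0 < q) {g : ℂ → ℂ}
    (h : IsBoundedOp p α q β (mulOp g)) :
    ∃ C : ℝ≥0∞, C ≠ ∞ ∧ ∀ f ∈ dirichletSpace p α,
      energy q β (mulOp g f) ≤ C * dirichletNorm p α f ^ q := by
  obtain ⟨C, hC⟩ := h
  refine ⟨(C : ℝ≥0∞) ^ q, ENNReal.rpow_ne_top_of_nonneg hq.le (by simp), fun f hf => ?_⟩
  refine (energy_le_dirichletNorm_rpow hq β _).trans ?_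
  rw [← ENNReal.mul_rpow_of_nonneg _ _ hq.le]
  gcongr
  exact (hC f hf).2

theorem hasDerivAt_kernel_pow {a z : ℂ} (ha : a ∈ disk) (hz : z ∈ disk) (m : ℕ) :
    HasDerivAt (fun z => (1 - conj a * z)⁻¹ ^ (m + 1))
      ((m + 1) * conj a * (1 - conj a * z)⁻¹ ^ (m + 2)) z := by
  have h2 : HasDerivAt (fun z => 1 - conj a * z) (-(conj a * 1)) z :=
    ((hasDerivAt_id z).const_mul (conj a)).const_sub 1
  have hne := one_sub_conj_mul_ne_zero ha hz
  refine ((h2.fun_inv hne).fun_pow (m + 1)).congr_deriv ?_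
  rw [Nat.add_sub_cancel, pow_add _ m 2]
  push_cast
  generalize (1 - conj a * z)⁻¹ ^ m = u
  field_simp

/-- A uniform norm bound for all test functions whose derivative is dominated by the `n`-th power of
the kernel at `a`. -/
theorem exists_dirichletNorm_rpow_le {p α q : ℝ} (hp : 0 < p) (hq : 0 < q) (hα : -1 < α) {n : ℕ}
    (hn : 2 * (2 + α) ≤ n * p) (B : ℝ) :
    ∃ C : ℝ≥0∞, C ≠ ∞ ∧ ∀ a ∈ disk, ∀ f : ℂ → ℂ, ‖f 0‖ ≤ 1 →
      (∀ z ∈ disk, ‖deriv f z‖ ≤ B * ‖1 - conj a * z‖⁻¹ ^ n) →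
        dirichletNorm p α f < ∞ ∧ dirichletNorm p α f ^ q ≤
          C * ENNReal.ofReal (1 - ‖a‖ ^ 2) ^ ((2 + α - n * p) * (q / p)) := by
  obtain ⟨C, hC, hker⟩ := exists_lintegral_kernel_le hα hn
  have hqp : 0 ≤ q / p := (div_pos hq hp).le
  set D : ℝ≥0∞ := 1 + ENNReal.ofReal B ^ p * C with hD
  have hDt : D ≠ ∞ := ENNReal.add_ne_top.2 ⟨by simp, ENNReal.mul_ne_top
    (ENNReal.rpow_ne_top_of_nonneg hp.le ENNReal.ofReal_ne_top) hC⟩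
  refine ⟨D ^ (q / p), ENNReal.rpow_ne_top_of_nonneg hqp hDt, fun a ha f hf0 hf => ?_⟩
  have hA0 := one_sub_norm_sq_pos ha
  set A := ENNReal.ofReal (1 - ‖a‖ ^ 2) with hA
  have hA0' : A ≠ 0 := by simpa [hA] using hA0
  have hAt : A ≠ ∞ := ENNReal.ofReal_ne_top
  have hA1 : A ≤ 1 := by
    rw [hA, ENNReal.ofReal_le_one]
    nlinarith [norm_nonneg a]
  have hen : energy p α f ≤ ENNReal.ofReal B ^ p * C * A ^ (2 + α - n * p) := by
    calc energy p α f ≤ ∫⁻ z, ENNReal.ofReal B ^ p * (ENNReal.ofReal ‖1 - conj a * z‖ ^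
          (-(n * p)) * ENNReal.ofReal ((1 - ‖z‖ ^ 2) ^ α)) ∂areaMeasure := by
          refine lintegral_mono_ae ?_
          filter_upwards [ae_mem_disk] with z hz
          rw [← mul_assoc]
          gcongr
          have hx := norm_one_sub_conj_mul_pos ha hz
          have hB : 0 ≤ B := by
            have := (norm_nonneg _).trans (hf z hz)
            exact nonneg_of_mul_nonneg_left this (by positivity)
          calc ‖deriv f z‖ₑ ^ p ≤ (ENNReal.ofReal B *
              ENNReal.ofReal ‖1 - conj a * z‖ ^ (-(n : ℝ))) ^ p := by
                gcongr
                rw [← ofReal_norm, ENNReal.ofReal_rpow_of_pos hx, ← ENNReal.ofReal_mul hB,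
                  Real.rpow_neg hx.le, Real.rpow_natCast, ← inv_pow]
                exact ENNReal.ofReal_le_ofReal (hf z hz)
            _ = _ := by
                rw [ENNReal.mul_rpow_of_nonneg _ _ hp.le, ← ENNReal.rpow_mul, neg_mul]
      _ ≤ ENNReal.ofReal B ^ p * (C * A ^ (2 + α - n * p)) := by
          rw [lintegral_const_mul' _ _
            (ENNReal.rpow_ne_top_of_nonneg hp.le ENNReal.ofReal_ne_top)]
          gcongr
          exact hker a ha
      _ = _ := by ring
  -- The exponent is not positive, so the bounded value `f 0` is absorbed by this power.
  have hA2 : 1 ≤ A ^ (2 + α - n * p) := by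
    rw [show 2 + α - n * p = -(n * p - (2 + α)) by ring]
    calc (1 : ℝ≥0∞) = 1 ^ (-(n * p - (2 + α))) := (ENNReal.one_rpow _).symm
      _ ≤ _ := ennreal_rpow_neg_le_rpow_neg (by linarith) hA1
  have hsum : ‖f 0‖ₑ ^ p + energy p α f ≤ D * A ^ (2 + α - n * p) := by
    rw [hD, add_mul, one_mul]
    refine add_le_add (le_trans ?_ hA2) hen
    refine ENNReal.rpow_le_one ?_ hp.le
    rw [← ofReal_norm]
    exact ENNReal.ofReal_le_one.2 hf0
  have hAe : A ^ (2 + α - n * p) ≠ ∞ := ENNReal.rpow_ne_top_of_ne_zero hA0' hAt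
  refine ⟨?_, ?_⟩
  · have h1 := dirichletNorm_rpow (p := p) α 1 f
    rw [ENNReal.rpow_one] at h1
    rw [h1]
    exact ENNReal.rpow_lt_top_of_nonneg (by positivity)
      (ne_top_of_le_ne_top (ENNReal.mul_ne_top hDt hAe) hsum)
  · rw [dirichletNorm_rpow, ENNReal.rpow_mul, ← ENNReal.mul_rpow_of_nonneg _ _ hqp]
    gcongr

/-- The test function vanishes at `a`, so `g'(a)` drops out and `(g f)'(a)` is `g(a)` times a power
of `1 - |a|²`. Comparing with the derivative growth in the target space gives the bound, and `m`
cancels from the exponents. -/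
theorem IsBoundedOp.growthBigO {p q α β : ℝ} (hp : 0 < p) (hq : 0 < q) (hα : -1 < α) {g : ℂ → ℂ}
    (hg : DifferentiableOn ℂ g disk) (h : IsBoundedOp p α q β (mulOp g)) :
    GrowthBigO g ((2 + α) / p - (2 + β) / q) := by
  obtain ⟨C₁, hC₁, h1⟩ := h.exists_energy_le hq
  obtain ⟨C₂, hC₂, h2⟩ := exists_deriv_growth hq β
  obtain ⟨m, hm⟩ := exists_nat_ge (2 * (2 + α) / p)
  have hmp : 2 * (2 + α) ≤ ((m + 1 : ℕ) : ℝ) * p := by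
    rw [div_le_iff₀ hp] at hm
    push_cast
    linarith
  obtain ⟨C₃, hC₃, h3⟩ := exists_dirichletNorm_rpow_le hp hq hα hmp (m + 2)
  set γ := (2 + α) / p - (2 + β) / q with hγ
  set C := C₂ * (C₁ * C₃) with hC
  have hCt : C ^ (1 / q) ≠ ∞ := ENNReal.rpow_ne_top_of_nonneg (by positivity)
    (ENNReal.mul_ne_top hC₂ (ENNReal.mul_ne_top hC₁ hC₃))
  refine growthBigO_of_bound (M := (C ^ (1 / q)).toReal) fun a ha => ?_
  set f : ℂ → ℂ := fun z => (z - a) * (1 - conj a * z)⁻¹ ^ (m + 1) with hf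
  have hfd : ∀ z ∈ disk, HasDerivAt f (1 * (1 - conj a * z)⁻¹ ^ (m + 1) +
      (z - a) * ((m + 1) * conj a * (1 - conj a * z)⁻¹ ^ (m + 2))) z := fun z hz =>
    ((hasDerivAt_id z).sub_const a).mul (hasDerivAt_kernel_pow ha hz m)
  have hfdiff : DifferentiableOn ℂ f disk := fun z hz =>
    (hfd z hz).differentiableAt.differentiableWithinAt
  have ha1 := (mem_disk.1 ha).le
  have hA0 := one_sub_norm_sq_pos ha
  obtain ⟨hfin, hnorm⟩ := h3 a ha f (by simpa [hf] using ha1) fun z hz => by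
    rw [(hfd z hz).deriv]
    have hx := norm_one_sub_conj_mul_pos ha hz
    -- The factor `z - a` cancels one power of the kernel, so both terms of `f'` are of order `|1 -
    -- āz| ^ (-(m + 1))`.
    have hza : ‖z - a‖ ≤ ‖1 - conj a * z‖ := by
      have e := norm_one_sub_conj_mul_sq_sub a z
      have : 0 < (1 - ‖a‖ ^ 2) * (1 - ‖z‖ ^ 2) := mul_pos hA0 (one_sub_norm_sq_pos hz)
      rw [norm_sub_rev]
      exact le_of_sq_le_sq (by linarith) hx.le
    have hm1 : ‖((m : ℂ) + 1)‖ = m + 1 := by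
      rw [← Nat.cast_succ, Complex.norm_natCast, Nat.cast_succ]
    set x := ‖1 - conj a * z‖
    refine (norm_add_le _ _).trans ?_
    rw [one_mul, norm_mul, norm_mul, norm_mul, norm_pow, norm_pow, norm_inv, RCLike.norm_conj, hm1]
    have hxx : x * x⁻¹ = 1 := mul_inv_cancel₀ hx.ne'
    calc x⁻¹ ^ (m + 1) + ‖z - a‖ * ((m + 1) * ‖a‖ * x⁻¹ ^ (m + 2))
        ≤ x⁻¹ ^ (m + 1) + x * ((m + 1) * 1 * x⁻¹ ^ (m + 2)) := by gcongr
      _ = x⁻¹ ^ (m + 1) + (x * x⁻¹) * ((m + 1) * x⁻¹ ^ (m + 1)) := by ring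
      _ = _ := by rw [hxx]; ring
  have hgf : deriv (mulOp g f) a = g a * (1 - conj a * a)⁻¹ ^ (m + 1) := by
    rw [deriv_mulOp hfdiff hg ha, (hfd a ha).deriv]
    simp [hf]
  have h4 := h2 (mulOp g f) (hg.mul hfdiff) a ha
  set A := ENNReal.ofReal (1 - ‖a‖ ^ 2) with hA
  have hA0' : A ≠ 0 := by simpa [hA] using hA0
  have hAt : A ≠ ∞ := ENNReal.ofReal_ne_top
  have hker : ‖(1 - conj a * a)⁻¹ ^ (m + 1)‖ₑ = A ^ (-((m + 1 : ℕ) : ℝ)) := by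
    rw [← ofReal_norm, norm_pow, norm_inv, norm_one_sub_conj_mul_self ha, hA,
      ENNReal.ofReal_rpow_of_pos hA0, Real.rpow_neg hA0.le, Real.rpow_natCast, inv_pow]
  rw [hgf, enorm_mul, hker, ENNReal.mul_rpow_of_nonneg _ _ hq.le, ← ENNReal.rpow_mul] at h4
  have h5 : ‖g a‖ₑ ^ q ≤ C * A ^ (γ * q) := by
    set s : ℝ := ((m + 1 : ℕ) : ℝ)
    calc ‖g a‖ₑ ^ q = A ^ (-(2 + β) + s * q) * (A ^ (2 + β) * (‖g a‖ₑ ^ q * A ^ (-s * q))) := by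
          rw [mul_left_comm (A ^ (2 + β)), mul_left_comm, ← ENNReal.rpow_add _ _ hA0' hAt,
            ← ENNReal.rpow_add _ _ hA0' hAt,
            show -(2 + β) + s * q + (2 + β + -s * q) = 0 by ring, ENNReal.rpow_zero, mul_one]
      _ ≤ A ^ (-(2 + β) + s * q) * (C₂ * (C₁ * (C₃ * A ^ ((2 + α - s * p) * (q / p))))) := by
          gcongr A ^ (-(2 + β) + s * q) * ?_
          refine h4.trans ?_
          gcongr C₂ * ?_
          refine (h1 f ⟨hfdiff, hfin⟩).trans ?_
          gcongr
      _ = C * (A ^ (-(2 + β) + s * q) * A ^ ((2 + α - s * p) * (q / p))) := by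
          rw [hC]
          ring
      _ = C * A ^ (γ * q) := by
          rw [← ENNReal.rpow_add _ _ hA0' hAt]
          congr 2
          rw [hγ]
          field_simp
          ring
  have h6 : ‖g a‖ₑ ≤ C ^ (1 / q) * A ^ γ := by
    calc ‖g a‖ₑ = (‖g a‖ₑ ^ q) ^ (1 / q) := by
          rw [← ENNReal.rpow_mul, mul_one_div_cancel hq.ne', ENNReal.rpow_one]
      _ ≤ (C * A ^ (γ * q)) ^ (1 / q) := by gcongr
      _ = _ := by
          rw [ENNReal.mul_rpow_of_nonneg _ _ (by positivity), ← ENNReal.rpow_mul, mul_assoc,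
            mul_one_div_cancel hq.ne', mul_one]
  have h7 := ENNReal.toReal_mono
    (ENNReal.mul_ne_top hCt (ENNReal.rpow_ne_top_of_ne_zero hA0' hAt)) h6
  rwa [toReal_enorm, ENNReal.toReal_mul, hA, ENNReal.ofReal_rpow_of_pos hA0,
    ENNReal.toReal_ofReal (Real.rpow_nonneg hA0.le _)] at h7

/-- Boundedness of multiplication implies the embedding of the Dirichlet space. -/
theorem IsBoundedOp.exists_lintegral_le {p q α β : ℝ} (hp : 0 < p) (hpq : p < q) (hα : -1 < α)
    {g : ℂ → ℂ} (hg : DifferentiableOn ℂ g disk) (h : IsBoundedOp p α q β (mulOp g)) :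
    ∃ C : ℝ≥0∞, C ≠ ∞ ∧ ∀ f ∈ dirichletSpace p α,
      ∫⁻ z, ‖f z‖ₑ ^ q ∂symbolMeasure g q β ≤ C * dirichletNorm p α f ^ q := by
  have hq : 0 < q := hp.trans hpq
  -- The growth condition, already known to be necessary, controls `g f'`; hence `g' f = (g f)' - g
  -- f'` is controlled as well.
  obtain ⟨M, hM0, hM⟩ := (h.growthBigO hp hq hα hg).exists_bound hg
  obtain ⟨C₁, hC₁, h1⟩ := exists_lintegral_mul_deriv_le hp hpq hM0 hM
  obtain ⟨C₂, hC₂, h2⟩ := h.exists_energy_le hq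
  refine ⟨2 ^ q * (C₂ + C₁), ENNReal.mul_ne_top (ENNReal.rpow_ne_top_of_nonneg hq.le (by simp))
    (ENNReal.add_ne_top.2 ⟨hC₂, hC₁⟩), fun f hf => ?_⟩
  rw [lintegral_symbolMeasure hf.1]
  have hm : Measurable fun z => ‖deriv (mulOp g f) z‖ₑ ^ q *
      ENNReal.ofReal ((1 - ‖z‖ ^ 2) ^ β) := measurable_energyDensity q β _
  calc _ ≤ ∫⁻ z, 2 ^ q * (‖deriv (mulOp g f) z‖ₑ ^ q * ENNReal.ofReal ((1 - ‖z‖ ^ 2) ^ β) +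
        ‖g z * deriv f z‖ₑ ^ q * ENNReal.ofReal ((1 - ‖z‖ ^ 2) ^ β)) ∂areaMeasure := by
        refine lintegral_mono_ae ?_
        filter_upwards [ae_mem_disk] with z hz
        rw [← add_mul, ← mul_assoc]
        gcongr
        refine le_trans ?_ (add_rpow_le_two_rpow_mul hq _ _)
        gcongr
        rw [show deriv g z * f z = deriv (mulOp g f) z - g z * deriv f z by
          rw [deriv_mulOp hf.1 hg hz]; ring]
        exact enorm_sub_le
    _ = 2 ^ q * (energy q β (mulOp g f) +
          ∫⁻ z, ‖g z * deriv f z‖ₑ ^ q * ENNReal.ofReal ((1 - ‖z‖ ^ 2) ^ β) ∂areaMeasure) := by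
        rw [lintegral_const_mul' _ _ (ENNReal.rpow_ne_top_of_nonneg hq.le (by simp)),
          lintegral_add_left hm, energy]
    _ ≤ 2 ^ q * (C₂ * dirichletNorm p α f ^ q + C₁ * dirichletNorm p α f ^ q) := by
        gcongr
        · exact h2 f hf
        · exact (h1 f hf.1).trans (by gcongr; exact energy_rpow_le_dirichletNorm_rpow hp hq.le α f)
    _ = _ := by ring

/-- The kernel power centred at depth `l` over the midpoint of the arc is at least `(6 l) ^ (-s)` on
the Carleson square. Chebyshev's inequality and the norm bound give the estimate, in which the
auxiliary power `m` cancels. -/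
theorem IsBoundedOp.isCarleson {p q α β : ℝ} (hp : 0 < p) (hpq : p < q) (hα : -1 < α)
    {g : ℂ → ℂ} (hg : DifferentiableOn ℂ g disk) (h : IsBoundedOp p α q β (mulOp g)) :
    IsCarleson (q * (α + 2 - p) / p) (symbolMeasure g q β) := by
  have hq : 0 < q := hp.trans hpq
  obtain ⟨C₁, hC₁, h1⟩ := h.exists_lintegral_le hp hpq hα hg
  obtain ⟨m, hm⟩ := exists_nat_ge (2 * (2 + α) / p)
  have hmp : 2 * (2 + α) ≤ ((m + 2 : ℕ) : ℝ) * p := by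
    rw [div_le_iff₀ hp] at hm
    push_cast
    linarith
  obtain ⟨C₂, hC₂, h2⟩ := exists_dirichletNorm_rpow_le hp hq hα hmp (m + 1)
  set s : ℝ := ((m + 1 : ℕ) : ℝ) with hs
  have hs0 : 0 ≤ s := Nat.cast_nonneg _
  set C : ℝ≥0∞ := 6 ^ (s * q) * (C₁ * C₂) with hC
  have hCt : C ≠ ∞ := ENNReal.mul_ne_top (ENNReal.rpow_ne_top_of_nonneg (by positivity) (by simp))
    (ENNReal.mul_ne_top hC₁ hC₂)
  refine ⟨C.toReal + 1, by positivity, fun I l hI => ?_⟩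
  have hl0 := hI.length_pos
  have hl1 := hI.length_le_one
  obtain ⟨ζ, hζ, hS⟩ := hI.exists_norm_le
  have hSl := hS l le_rfl hl1
  set a : ℂ := (1 - l : ℝ) * ζ with ha'
  have hna : ‖a‖ = 1 - l := by
    rw [ha', norm_mul, hζ, mul_one, Complex.norm_real, Real.norm_of_nonneg (by linarith)]
  have ha : a ∈ disk := mem_disk.2 (by linarith)
  set f : ℂ → ℂ := fun z => (1 - conj a * z)⁻¹ ^ (m + 1) with hf
  have hfd : ∀ z ∈ disk, HasDerivAt f ((m + 1) * conj a * (1 - conj a * z)⁻¹ ^ (m + 2)) z :=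
    fun z hz => hasDerivAt_kernel_pow ha hz m
  have hfdiff : DifferentiableOn ℂ f disk := fun z hz =>
    (hfd z hz).differentiableAt.differentiableWithinAt
  obtain ⟨hfin, hnorm⟩ := h2 a ha f (by simp [hf]) fun z hz => by
    have hx := norm_one_sub_conj_mul_pos ha hz
    have hm1 : ‖((m : ℂ) + 1)‖ = m + 1 := by
      rw [← Nat.cast_succ, Complex.norm_natCast, Nat.cast_succ]
    rw [(hfd z hz).deriv, norm_mul, norm_mul, norm_pow, norm_inv, RCLike.norm_conj, hm1]
    gcongr
    nlinarith [mem_disk.1 ha]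
  set L := ENNReal.ofReal l with hL
  have hL0 : L ≠ 0 := by simpa [hL] using hl0
  have hLt : L ≠ ∞ := ENNReal.ofReal_ne_top
  have hfm : Measurable fun z => ‖f z‖ₑ ^ q := by
    refine Measurable.pow_const (Measurable.enorm ?_) q
    exact ((measurable_const.sub (measurable_id.const_mul _)).inv).pow_const _
  have hsub : carlesonSquare I l ⊆ {z | (6 * L) ^ (-(s * q)) ≤ ‖f z‖ₑ ^ q} := by
    intro z hz
    have hx := norm_one_sub_conj_mul_pos ha (hI.carlesonSquare_subset_disk hz)
    change _ ≤ ‖f z‖ₑ ^ q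
    have e : ‖f z‖ₑ = ENNReal.ofReal ‖1 - conj a * z‖ ^ (-s) := by
      rw [← ofReal_norm, hf, norm_pow, norm_inv, ENNReal.ofReal_rpow_of_pos hx,
        Real.rpow_neg hx.le, hs, Real.rpow_natCast, inv_pow]
    rw [e, ← ENNReal.rpow_mul, neg_mul]
    refine ennreal_rpow_neg_le_rpow_neg (by positivity) ?_
    rw [hL, ← ENNReal.ofReal_ofNat 6, ← ENNReal.ofReal_mul (by norm_num)]
    exact ENNReal.ofReal_le_ofReal (hSl z hz)
  have hexp : (2 + α - ((m + 2 : ℕ) : ℝ) * p) * (q / p) = -((((m + 2 : ℕ) : ℝ) * p - (2 + α)) *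
      (q / p)) := by ring
  have hmain : (6 * L) ^ (-(s * q)) * symbolMeasure g q β (carlesonSquare I l) ≤
      C₁ * (C₂ * L ^ ((2 + α - ((m + 2 : ℕ) : ℝ) * p) * (q / p))) := by
    calc _ ≤ (6 * L) ^ (-(s * q)) *
          symbolMeasure g q β {z | (6 * L) ^ (-(s * q)) ≤ ‖f z‖ₑ ^ q} := by gcongr
      _ ≤ ∫⁻ z, ‖f z‖ₑ ^ q ∂symbolMeasure g q β := mul_meas_ge_le_lintegral hfm _
      _ ≤ _ := h1 f ⟨hfdiff, hfin⟩
      _ ≤ _ := by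
          gcongr C₁ * ?_
          refine hnorm.trans ?_
          gcongr C₂ * ?_
          rw [hexp]
          refine ennreal_rpow_neg_le_rpow_neg
            (mul_nonneg (by linarith) (div_nonneg hq.le hp.le)) (ENNReal.ofReal_le_ofReal ?_)
          rw [hna]
          nlinarith
  have h6L0 : 6 * L ≠ 0 := mul_ne_zero (by simp) hL0
  have h6Lt : 6 * L ≠ ∞ := ENNReal.mul_ne_top (by simp) hLt
  calc symbolMeasure g q β (carlesonSquare I l)
      = (6 * L) ^ (s * q) * ((6 * L) ^ (-(s * q)) *
          symbolMeasure g q β (carlesonSquare I l)) := by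
        rw [← mul_assoc, ← ENNReal.rpow_add _ _ h6L0 h6Lt, add_neg_cancel, ENNReal.rpow_zero,
          one_mul]
    _ ≤ (6 * L) ^ (s * q) * (C₁ * (C₂ * L ^ ((2 + α - ((m + 2 : ℕ) : ℝ) * p) * (q / p)))) := by
        gcongr
    _ = C * (L ^ (s * q) * L ^ ((2 + α - ((m + 2 : ℕ) : ℝ) * p) * (q / p))) := by
        rw [ENNReal.mul_rpow_of_nonneg _ _ (by positivity), hC]
        ring
    _ = C * L ^ (q * (α + 2 - p) / p) := by
        rw [← ENNReal.rpow_add _ _ hL0 hLt]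
        congr 2
        rw [hs]
        push_cast
        field_simp
        ring
    _ ≤ ENNReal.ofReal (C.toReal + 1) * L ^ (q * (α + 2 - p) / p) := by
        gcongr
        exact (ENNReal.ofReal_toReal hCt).symm.le.trans (ENNReal.ofReal_le_ofReal (by linarith))
    _ = _ := by
        rw [ENNReal.ofReal_mul (by positivity), hL, ENNReal.ofReal_rpow_of_pos hl0]

/-- The test function is the logarithm of the kernel at depth `2 ^ (-K) ≈ l`. Its norm to the power
`p` is `O(K + 1)` while its modulus on the square is at least `(K + 1) log 2`, so Chebyshev gives
mass `O((K + 1) ^ (q / p - q))`. -/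
theorem IsBoundedOp.isLogCarleson {p q β : ℝ} (hp : 1 < p) (hpq : p < q)
    {g : ℂ → ℂ} (hg : DifferentiableOn ℂ g disk) (h : IsBoundedOp p (p - 2) q β (mulOp g)) :
    IsLogCarleson ((1 / p - 1) * q) (symbolMeasure g q β) := by
  have hp0 : 0 < p := by linarith
  have hq : 0 < q := hp0.trans hpq
  have hqp : 0 ≤ q / p := (div_pos hq hp0).le
  obtain ⟨C₁, hC₁, h1⟩ := h.exists_lintegral_le hp0 hpq (by linarith) hg
  obtain ⟨C₂, hC₂, h2⟩ := exists_lintegral_kernel_le_log hp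
  have hlog2 : 0 < Real.log 2 := Real.log_pos (by norm_num)
  have hlog2' : Real.log 2 ≤ 1 := by
    have := Real.log_le_sub_one_of_pos (by norm_num : (0 : ℝ) < 2)
    linarith
  -- On the square `|1 - āz| ≤ 6 · 2 ^ (-K)`. Since `12 = 2 · 6`, the shift makes the real part of
  -- `f` there at least `(K + 1) log 2`, which is positive even for `K = 0`.
  set B := Real.log 12 with hB
  have hB0 : 0 ≤ B := Real.log_nonneg (by norm_num)
  set D : ℝ≥0∞ := ENNReal.ofReal B ^ p + C₂ with hD
  have hDt : D ≠ ∞ := ENNReal.add_ne_top.2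
    ⟨ENNReal.rpow_ne_top_of_nonneg hp0.le ENNReal.ofReal_ne_top, hC₂⟩
  set Λ := ENNReal.ofReal (Real.log 2) with hΛ
  have hΛ0 : Λ ≠ 0 := by simpa [hΛ] using hlog2
  have hΛt : Λ ≠ ∞ := ENNReal.ofReal_ne_top
  set C : ℝ≥0∞ := Λ ^ (-q) * (C₁ * D ^ (q / p)) with hC
  have hCt : C ≠ ∞ := ENNReal.mul_ne_top (ENNReal.rpow_ne_top_of_ne_zero hΛ0 hΛt)
    (ENNReal.mul_ne_top hC₁ (ENNReal.rpow_ne_top_of_nonneg hqp hDt))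
  refine ⟨C.toReal + 1, by positivity, fun I l hI => ?_⟩
  have hl0 := hI.length_pos
  have hl1 := hI.length_le_one
  obtain ⟨K, hK1, hK2⟩ := exists_nat_pow_near_of_lt_one hl0 hl1
    (by norm_num : (0 : ℝ) < 1 / 2) (by norm_num)
  obtain ⟨ζ, hζ, hS⟩ := hI.exists_norm_le
  have hd0 : (0 : ℝ) < (1 / 2) ^ K := by positivity
  have hd1 : (1 / 2 : ℝ) ^ K ≤ 1 := pow_le_one₀ (by norm_num) (by norm_num)
  have hSl := hS _ hK2 hd1
  have hker := h2 ζ hζ K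
  set a : ℂ := (1 - (1 / 2) ^ K : ℝ) * ζ with ha'
  have hna : ‖a‖ = 1 - (1 / 2) ^ K := by
    rw [ha', norm_mul, hζ, mul_one, Complex.norm_real, Real.norm_of_nonneg (by linarith)]
  have ha : a ∈ disk := mem_disk.2 (by linarith)
  set f : ℂ → ℂ := fun z => B - Complex.log (1 - conj a * z) with hf
  have hfd : ∀ z ∈ disk, HasDerivAt f (-(-(conj a * 1) / (1 - conj a * z))) z := by
    intro z hz
    have h3 : HasDerivAt (fun z => 1 - conj a * z) (-(conj a * 1)) z :=
      ((hasDerivAt_id z).const_mul (conj a)).const_sub 1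
    refine (h3.clog ?_).const_sub _
    rw [sub_eq_add_neg]
    apply Complex.mem_slitPlane_of_norm_lt_one
    rw [norm_neg, norm_mul, RCLike.norm_conj]
    nlinarith [mem_disk.1 ha, mem_disk.1 hz, norm_nonneg a, norm_nonneg z]
  have hfdiff : DifferentiableOn ℂ f disk := fun z hz =>
    (hfd z hz).differentiableAt.differentiableWithinAt
  have hen : energy p (p - 2) f ≤ C₂ * ((K : ℝ≥0∞) + 1) := by
    refine le_trans (lintegral_mono_ae ?_) hker
    filter_upwards [ae_mem_disk] with z hz
    have hx := norm_one_sub_conj_mul_pos ha hz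
    gcongr
    calc ‖deriv f z‖ₑ ^ p ≤ (ENNReal.ofReal ‖1 - conj a * z‖)⁻¹ ^ p := by
          gcongr
          rw [(hfd z hz).deriv, ← ofReal_norm, ← ENNReal.ofReal_inv_of_pos hx]
          apply ENNReal.ofReal_le_ofReal
          rw [mul_one, norm_neg, norm_div, norm_neg, RCLike.norm_conj, ← one_div]
          gcongr
          exact (mem_disk.1 ha).le
      _ = _ := by rw [ENNReal.inv_rpow, ENNReal.rpow_neg]
  set κ : ℝ≥0∞ := (K : ℝ≥0∞) + 1 with hκ
  have hκ0 : κ ≠ 0 := by simp [hκ]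
  have hκt : κ ≠ ∞ := by simp [hκ]
  have hsum : ‖f 0‖ₑ ^ p + energy p (p - 2) f ≤ D * κ := by
    rw [hD, add_mul]
    refine add_le_add ?_ hen
    have h0 : ‖f 0‖ₑ = ENNReal.ofReal B := by
      rw [← ofReal_norm]
      simp [hf, abs_of_nonneg hB0]
    rw [h0]
    exact le_mul_of_one_le_right (zero_le) (by simp [hκ])
  have hfin : dirichletNorm p (p - 2) f < ∞ := by
    have h1 := dirichletNorm_rpow (p := p) (p - 2) 1 f
    rw [ENNReal.rpow_one] at h1
    rw [h1]
    exact ENNReal.rpow_lt_top_of_nonneg (by positivity)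
      (ne_top_of_le_ne_top (ENNReal.mul_ne_top hDt hκt) hsum)
  have hnorm : dirichletNorm p (p - 2) f ^ q ≤ D ^ (q / p) * κ ^ (q / p) := by
    rw [dirichletNorm_rpow, ← ENNReal.mul_rpow_of_nonneg _ _ hqp]
    gcongr
  have hfm : Measurable fun z => ‖f z‖ₑ ^ q := by
    refine Measurable.pow_const (Measurable.enorm ?_) q
    exact measurable_const.sub (Complex.measurable_log.comp
      (measurable_const.sub (measurable_id.const_mul _)))
  have hκΛ : κ * Λ = ENNReal.ofReal ((K + 1) * Real.log 2) := by
    rw [hκ, hΛ, ENNReal.ofReal_mul (by positivity), ENNReal.ofReal_add (by positivity) zero_le_one,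
      ENNReal.ofReal_natCast, ENNReal.ofReal_one]
  have hsub : carlesonSquare I l ⊆ {z | (κ * Λ) ^ q ≤ ‖f z‖ₑ ^ q} := by
    intro z hz
    have hx := norm_one_sub_conj_mul_pos ha (hI.carlesonSquare_subset_disk hz)
    change _ ≤ ‖f z‖ₑ ^ q
    gcongr
    rw [hκΛ, ← ofReal_norm]
    apply ENNReal.ofReal_le_ofReal
    refine le_trans ?_ ((le_abs_self _).trans (Complex.abs_re_le_norm _))
    simp only [hf, Complex.sub_re, Complex.ofReal_re, Complex.log_re]
    have h3 : Real.log ‖1 - conj a * z‖ ≤ Real.log (6 * (1 / 2) ^ K) :=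
      Real.log_le_log hx (hSl z hz)
    have h4 : Real.log (6 * (1 / 2) ^ K) = Real.log 6 - K * Real.log 2 := by
      rw [Real.log_mul (by norm_num) hd0.ne', Real.log_pow, one_div, Real.log_inv]
      ring
    have h5 : B = Real.log 2 + Real.log 6 := by
      rw [hB, ← Real.log_mul (by norm_num) (by norm_num)]
      norm_num
    rw [h5]
    linarith
  have hmain : (κ * Λ) ^ q * symbolMeasure g q β (carlesonSquare I l) ≤
      C₁ * (D ^ (q / p) * κ ^ (q / p)) := by
    calc _ ≤ (κ * Λ) ^ q * symbolMeasure g q β {z | (κ * Λ) ^ q ≤ ‖f z‖ₑ ^ q} := by gcongr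
      _ ≤ ∫⁻ z, ‖f z‖ₑ ^ q ∂symbolMeasure g q β := mul_meas_ge_le_lintegral hfm _
      _ ≤ _ := h1 f ⟨hfdiff, hfin⟩
      _ ≤ _ := by gcongr
  have hlogl : ENNReal.ofReal (Real.log (1 / l)) ≤ κ := by
    rw [hκ, ← ENNReal.ofReal_natCast, ← ENNReal.ofReal_one,
      ← ENNReal.ofReal_add (by positivity) zero_le_one]
    apply ENNReal.ofReal_le_ofReal
    have h3 : Real.log (1 / l) ≤ Real.log (2 ^ (K + 1)) := by
      refine Real.log_le_log (by positivity) ?_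
      rw [one_div_le hl0 (by positivity), ← one_div_pow]
      exact hK1.le
    rw [Real.log_pow] at h3
    push_cast at h3
    nlinarith [(Nat.cast_nonneg K : (0 : ℝ) ≤ K)]
  have hκΛ0 : κ * Λ ≠ 0 := mul_ne_zero hκ0 hΛ0
  have hκΛt : κ * Λ ≠ ∞ := ENNReal.mul_ne_top hκt hΛt
  have ht : (1 / p - 1) * q = -(q - q / p) := by ring
  have ht0 : 0 ≤ q - q / p := by
    rw [sub_nonneg]
    exact div_le_self hq.le hp.le
  calc symbolMeasure g q β (carlesonSquare I l)
      = (κ * Λ) ^ (-q) * ((κ * Λ) ^ q * symbolMeasure g q β (carlesonSquare I l)) := by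
        rw [← mul_assoc, ← ENNReal.rpow_add _ _ hκΛ0 hκΛt, neg_add_cancel, ENNReal.rpow_zero,
          one_mul]
    _ ≤ (κ * Λ) ^ (-q) * (C₁ * (D ^ (q / p) * κ ^ (q / p))) := by gcongr
    _ = C * (κ ^ (-q) * κ ^ (q / p)) := by
        rw [ENNReal.mul_rpow_of_ne_top hκt hΛt, hC]
        ring
    _ = C * κ ^ (-(q - q / p)) := by
        rw [← ENNReal.rpow_add _ _ hκ0 hκt]
        congr 2
        ring
    _ ≤ ENNReal.ofReal (C.toReal + 1) *
          ENNReal.ofReal (Real.log (1 / l)) ^ (-(q - q / p)) := by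
        -- Monotonicity in `[0, ∞]` includes the full arc, where `log (1 / l) = 0` and the negative
        -- power is `∞`.
        refine mul_le_mul' ?_ (ennreal_rpow_neg_le_rpow_neg ht0 hlogl)
        exact (ENNReal.ofReal_toReal hCt).symm.le.trans (ENNReal.ofReal_le_ofReal (by linarith))
    _ = _ := by rw [ht]

theorem one_mem_dirichletSpace {p : ℝ} (hp : 0 < p) (α : ℝ) :
    (fun _ => 1) ∈ dirichletSpace p α := by
  refine (mem_dirichletSpace_iff hp (differentiableOn_const 1)).2 ?_
  simp [energy, hp]

theorem IsBoundedOp.mem_dirichletSpace {p q α β : ℝ} (hp : 0 < p) {g : ℂ → ℂ}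
    (h : IsBoundedOp p α q β (mulOp g)) : g ∈ dirichletSpace q β := by
  obtain ⟨C, hC⟩ := h
  have e : mulOp g (fun _ => 1) = g := by
    funext z
    simp [mulOp]
  exact e ▸ (hC _ (one_mem_dirichletSpace hp α)).1

end DirichletMult

/-! ### Assembly of the three cases -/

theorem mainTheorem3 (p q α β : ℝ) (g : ℂ → ℂ)
    (hp : 0 < p) (hpq : p < q) (hα : -1 < α) (hβ : -1 < β)
    (hg : DifferentiableOn ℂ g DirichletMult.disk) :
    (p < α + 2 →
      (DirichletMult.IsBoundedOp p α q β (DirichletMult.mulOp g) ↔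
        DirichletMult.IsCarleson (q * (α + 2 - p) / p) (DirichletMult.symbolMeasure g q β) ∧
        DirichletMult.GrowthBigO g ((2 + α) / p - (2 + β) / q))) ∧
    (p = α + 2 →
      (DirichletMult.IsBoundedOp p α q β (DirichletMult.mulOp g) ↔
        DirichletMult.GrowthBigO g ((2 + α) / p - (2 + β) / q) ∧
        DirichletMult.IsLogCarleson ((1 / p - 1) * q) (DirichletMult.symbolMeasure g q β))) ∧
    (α + 2 < p →
      (DirichletMult.IsBoundedOp p α q β (DirichletMult.mulOp g) ↔
        DirichletMult.GrowthBigO g ((2 + α) / p - (2 + β) / q) ∧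
        g ∈ DirichletMult.dirichletSpace q β) ∧
      (g ∈ DirichletMult.dirichletSpace q β ↔
        IsFiniteMeasure (DirichletMult.symbolMeasure g q β))) := by
  open DirichletMult in
  have hq : 0 < q := hp.trans hpq
  have hμ := ae_symbolMeasure_mem_disk g q β
  have hfin : g ∈ dirichletSpace q β ↔ IsFiniteMeasure (symbolMeasure g q β) := by
    rw [mem_dirichletSpace_iff hq hg, isFiniteMeasure_symbolMeasure_iff]
  refine ⟨fun hpα => ⟨fun h => ⟨h.isCarleson hp hpq hα hg, h.growthBigO hp hq hα hg⟩,
    fun h => isBoundedOp_of_embedsInto hp hpq hg h.2 (h.1.embedsInto hp hpq hpα hμ)⟩, ?_,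
    fun hpα => ⟨⟨fun h => ⟨h.growthBigO hp hq hα hg, h.mem_dirichletSpace hp⟩, fun h => ?_⟩, hfin⟩⟩
  · intro hpα
    have hp1 : 1 < p := by linarith
    obtain rfl : α = p - 2 := by linarith
    refine ⟨fun h => ⟨h.growthBigO hp hq hα hg, h.isLogCarleson hp1 hpq hg⟩, fun h => ?_⟩
    -- The logarithmic condition gives no bound on the total mass at the full arc, so finiteness is
    -- supplied separately for the root of the tree.
    have := h.2.isFiniteMeasure hg hq
    exact isBoundedOp_of_embedsInto hp hpq hg h.1 (h.2.embedsInto hp1 hpq hμ)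
  · have := hfin.1 h.2
    exact isBoundedOp_of_embedsInto hp hpq hg h.1 (embedsInto_of_lt hp hq hpα hμ)
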